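/- **Setting.** Let $\Omega\subset\mathbb R^3$ be a bounded Lipschitz domain, $\nu$ the number of constituents and $n$ the number of chemical reactions. Put $D_z=W^{1,3}(\Omega)^\nu\times W^{1,3}_N(\Omega)\times W^{1,3}(\Omega)$, where $W^{1,3}_N$ consists of the vector fields $w\in W^{1,3}(\Omega)^3$ with $w\cdot n=0$ on $\partial\Omega$ in the weak (Gauss–Green) sense. Write $z=(\rho_1,\dots,\rho_\nu,M,e)$, where $e$ is the entropy density $s$ (energy representation) or the internal energy density $u$ (entropy representation); $\rho=\sum_\alpha\rho_\alpha$, $v=M/\rho$, and $\langle g,h\rangle=\int_\Omega g\cdot h\,dx$. Let $D\subseteq\mathbb R^{\nu+1}$ be open and let a $C^1$ potential be given on $D$: $u=u(\rho_1,\dots,\rho_\nu,s)$ in the energy representation, with $T=\partial_s u$, $\mu_\alpha=\partial_{\rho_\alpha}u$; respectively $s=s(\rho_1,\dots,\rho_\nu,u)$ in the entropy representation, with $1/T=\partial_u s$, $-\mu_\alpha/T=\partial_{\rho_\alpha}s$. In both cases $p=-u+Ts+\sum_\alpha\rho_\alpha\mu_\alpha$. The state space is the set of all $z\in D_z$ with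 $\rho\ge r$ a.e. for some $r>0$ and $(\rho_1,\dots,\rho_\nu,e)\in D$ a.e. Total energy and entropy are $H(z)=\int_\Omega\big(\tfrac{|M|^2}{2\rho}+u\big)dx$ and $S(z)=\int_\Omega s\,dx$. **Constitutive relations.** Let $\gamma_\alpha^k,m_\alpha\in\mathbb R$ satisfy $\sum_\alpha\gamma_\alpha^km_\alpha=0$ for every reaction $k$, and let $L^k,L^{kb},\lambda,\zeta,\kappa,B_\alpha,B_{\alpha\beta}$ be functions of $(\rho_1,\dots,\rho_\nu,e)$. Put $\mathbb L_\alpha=\sum_k\gamma^k_\alpha m_\alpha L^k$, $\mathbb L_{\alpha\beta}=\sum_{k,b}\gamma^k_\alpha m_\alpha L^{kb}\gamma^b_\beta m_\beta$, and $$q=\kappa T^2\nabla\tfrac1T-\sum_\beta B_\beta\nabla\tfrac{\mu_\beta}T,\qquad J_\alpha=B_\alpha\nabla\tfrac1T-\sum_\beta B_{\alpha\beta}\nabla\tfrac{\mu_\beta}T,$$ $$\Lambda^k=-\sum_bL^{kb}\sum_\alpha\mu_\alpha\gamma^b_\alpha m_\alpha+L^k\operatorname{div}v,\qquad \tau_\alpha=\sum_k\gamma^k_\alpha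 m_\alpha\Lambda^k,$$ $$\mathbf S=(\lambda-\tfrac23\zeta)\operatorname{div}v\,I+\zeta(\nabla v+\nabla v^{\mathsf T}).$$ **Isolated solutions.** Let $Z$ be a convex subset of the state space, and let $z:(a,b)\to Z$ be continuous in the norm of $D_z$. Let $z$ be a weak solution of the field equations of the isolated mixture (that is, $v\cdot n=q\cdot n=J_\alpha\cdot n=0$ and $\mathbf Sn=0$ on $\partial\Omega$): for a.e. $t\in(a,b)$ the field $v(t)$ satisfies $v\cdot n=0$ on $\partial\Omega$ in the weak sense, and $z$ is differentiable at $t$ as a curve in the dual $D_z^*$ with, for all $\phi=(\phi_1,\dots,\phi_\nu,\phi_M,\phi_e)\in D_z$, $$\langle\partial_tz,\phi\rangle=\int_\Omega\Big(\sum_\alpha\big[(\rho_\alpha v+J_\alpha)\cdot\nabla\phi_\alpha+\tau_\alpha\phi_\alpha\big]+(M\otimes v):\nabla\phi_M+\phi_M\cdot\nabla\big(-p+\sum_\beta\mathbb L_\beta\mu_\beta\big)-\mathbf S:\nabla\phi_M+\mathcal E(\phi_e)\Big)dx,$$ where in the energy representation $$\mathcal E(\phi)=s\,v\cdot\nabla\phi+q\cdot\nabla\tfrac{\phi}{T}+(\mathbf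 S:\nabla v)\tfrac{\phi}T-\sum_\alpha\Big[J_\alpha\cdot\nabla\tfrac{\mu_\alpha\phi}{T}+(\tau_\alpha-\mathbb L_\alpha\operatorname{div}v)\tfrac{\mu_\alpha\phi}T\Big],$$ and in the entropy representation $$\mathcal E(\phi)=(u v+q)\cdot\nabla\phi-v\cdot\nabla\Big(\big(-p+\sum_\beta\mathbb L_\beta\mu_\beta\big)\phi\Big)+(\mathbf S:\nabla v)\,\phi .$$ Assume that for some $\varepsilon>0$ and a.e. $t\in(a,b)$, at the state $z(t)$: $T>0$ a.e.; $T,\,1/T,\,\mu_\alpha,\,\mu_\alpha/T\in W^{1,3}(\Omega)$; $p,\,\mathbb L_\alpha\in W^{1,1+\varepsilon}(\Omega)$; $\mathbb L_{\alpha\beta}\in L^{1+\varepsilon}(\Omega)$; $\lambda,\kappa,\zeta,B_\alpha,B_{\alpha\beta}\in L^{3+\varepsilon}(\Omega)$. Assume also that for a.e. $t$ the functionals $H$ and $S$ have functional derivatives $\frac{\delta H}{\delta z},\frac{\delta S}{\delta z}\in D_z$ at $z(t)$. Here $g$ is a functional derivative of a functional $A$ at $w$ if $\frac{d}{d\epsilon}A(w+\epsilon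 h)|_{\epsilon=0}=\langle g,h\rangle$ for every $h\in D_z$ such that $w+\epsilon h$ is an admissible state for all small $|\epsilon|$ (the admissible states being the whole state space for $H$ and $S$, and $Z$ for observables). **Brackets.** For functionals $A,B$ with functional derivatives in $D_z$, abbreviate $A_{\rho_\alpha}=\frac{\delta A}{\delta\rho_\alpha}$, $A_M=\frac{\delta A}{\delta M}$, $A_e=\frac{\delta A}{\delta e}$. The Poisson bracket is $$\begin{aligned}\{A,B\}=\int_\Omega\Big(&-\sum_\alpha\rho_\alpha\big(A_M\cdot\nabla B_{\rho_\alpha}-B_M\cdot\nabla A_{\rho_\alpha}\big)+\sum_\alpha\big(A_M\cdot\nabla(B_{\rho_\alpha}\mathbb L_\alpha)-B_M\cdot\nabla(A_{\rho_\alpha}\mathbb L_\alpha)\big)\\&-\sum_iM_i\big(A_M\cdot\nabla B_{M_i}-B_M\cdot\nabla A_{M_i}\big)-e\,\big(A_M\cdot\nabla B_e-B_M\cdot\nabla A_e\big)-\mathcal P\Big)dx,\end{aligned}$$ with $\mathcal P=0$ in the energy representation and $\mathcal P=A_M\cdot\nabla(B_e\pi)-B_M\cdot\nabla(A_e\pi)$,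 $\pi=p-\sum_\beta\mathbb L_\beta\mu_\beta$, in the entropy representation. For the dissipation bracket put $\theta_A=\frac1TA_e$ and $\chi_{A,\alpha}=A_{\rho_\alpha}-\frac{\mu_\alpha}TA_e$ in the energy representation, $\theta_A=A_e$ and $\chi_{A,\alpha}=A_{\rho_\alpha}$ in the entropy representation, and in both $\Sigma_A=\nabla A_M+\nabla A_M^{\mathsf T}-\theta_A(\nabla v+\nabla v^{\mathsf T})$, $d_A=\operatorname{div}A_M-\theta_A\operatorname{div}v$. Then $$\begin{aligned}[A,B]=\int_\Omega\Big(&\tfrac{\zeta T}2\,\Sigma_A:\Sigma_B+T(\lambda-\tfrac23\zeta)\,d_Ad_B+\nabla\theta_A\cdot\big(\kappa T^2\nabla\theta_B+\sum_\beta B_\beta\nabla\chi_{B,\beta}\big)\\&+\sum_\alpha\nabla\chi_{A,\alpha}\cdot\big(B_\alpha\nabla\theta_B+\sum_\beta B_{\alpha\beta}\nabla\chi_{B,\beta}\big)+T\sum_{\alpha,\beta}\chi_{A,\alpha}\mathbb L_{\alpha\beta}\chi_{B,\beta}\Big)dx .\end{aligned}$$ **Theorem 4.12.** In either representation, for almost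 every $t\in(a,b)$ the following holds for every observable $A$, that is, for every continuous $A:Z\to\mathbb R$ (in particular every smooth one) that has at each point of $Z$ a functional derivative in $D_z$ which depends continuously, as a map $Z\to D_z$, on the point: the function $\tau\mapsto A(z(\tau))$ is differentiable at $t$, and the classical GENERIC equation $$\frac{dA}{dt}=\{A,H\}+[A,S]$$ holds, with both brackets evaluated at $z(t)$. -/

import Mathlib

noncomputable section

namespace Mixture

open MeasureTheory Filter Topology

/-- Physical space. -/
abbrev E3 := EuclideanSpace ℝ (Fin 3)

/-! ### Domains and Sobolev functions -/

/-- Bounded domain (open and connected) whose boundary is, near each of its points and after a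
rotation, the graph of a Lipschitz function, with the domain on one side of the graph. -/
def IsBoundedLipschitzDomain (Ω : Set E3) : Prop :=
  IsOpen Ω ∧ IsConnected Ω ∧ Bornology.IsBounded Ω ∧
    ∀ x₀ ∈ frontier Ω, ∃ (R : E3 ≃ₗᵢ[ℝ] E3) (g : EuclideanSpace ℝ (Fin 2) → ℝ) (K : NNReal),
      LipschitzWith K g ∧ ∃ r : ℝ, 0 < r ∧
        ∀ x ∈ Metric.ball x₀ r, (x ∈ Ω ↔ g !₂[R x 0, R x 1] < R x 2)

/-- `G` is the weak gradient of `f` on `Ω`. -/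
def IsWeakGradient (Ω : Set E3) (f : E3 → ℝ) (G : E3 → E3) : Prop :=
  LocallyIntegrableOn f Ω ∧ LocallyIntegrableOn G Ω ∧
    ∀ φ : E3 → ℝ, ContDiff ℝ (⊤ : ℕ∞) φ → HasCompactSupport φ → tsupport φ ⊆ Ω →
      ∀ i : Fin 3, ∫ x in Ω, f x * fderiv ℝ φ x (EuclideanSpace.single i 1)
        = - ∫ x in Ω, G x i * φ x

open Classical in
/-- The weak gradient (unique almost everywhere on `Ω`; zero if there is none). -/
def wgrad (Ω : Set E3) (f : E3 → ℝ) : E3 → E3 :=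
  if h : ∃ G, IsWeakGradient Ω f G then h.choose else fun _ => 0

/-- Membership in the Sobolev space `W^{1,p}(Ω)`. -/
def MemW (Ω : Set E3) (p : ENNReal) (f : E3 → ℝ) : Prop :=
  MemLp f p (volume.restrict Ω) ∧
    ∃ G, IsWeakGradient Ω f G ∧ MemLp G p (volume.restrict Ω)

/-- The norm of `W^{1,p}(Ω)`. -/
def sobNorm (Ω : Set E3) (p : ENNReal) (f : E3 → ℝ) : ℝ :=
  (eLpNorm f p (volume.restrict Ω)).toReal + (eLpNorm (wgrad Ω f) p (volume.restrict Ω)).toReal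

/-- The weak Jacobian matrix `(∇w)ᵢⱼ = ∂ⱼ wᵢ` of a vector field. -/
def jac (Ω : Set E3) (w : E3 → E3) (x : E3) : Matrix (Fin 3) (Fin 3) ℝ :=
  Matrix.of fun i j => wgrad Ω (fun y => w y i) x j

/-- The weak divergence. -/
def wdiv (Ω : Set E3) (w : E3 → E3) (x : E3) : ℝ := (jac Ω w x).trace

/-- The double contraction `A : B`. -/
def dcontr (A B : Matrix (Fin 3) (Fin 3) ℝ) : ℝ := ∑ i, ∑ j, A i j * B i j

/-- `w · n = 0` on the boundary, in the sense of the Gauss-Green formula: there is no boundary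
term when `w` is tested with the gradient of a Sobolev function. -/
def NormalTraceZero (Ω : Set E3) (w : E3 → E3) : Prop :=
  ∀ r : ℝ, 1 < r → ∀ ψ : E3 → ℝ, MemW Ω (ENNReal.ofReal r) ψ →
    ∫ x in Ω, (inner ℝ (w x) (wgrad Ω ψ x) + ψ x * wdiv Ω w x) = 0

/-! ### States, functionals, functional derivatives -/

/-- Block vectors of fields: the `ν` scalar fields `ρ₁, …, ρ_ν`, the vector field `M`, and one more
scalar field `e`, which is the entropy density or the internal energy density. -/
abbrev Fields (ν : ℕ) := (Fin ν → E3 → ℝ) × (E3 → E3) × (E3 → ℝ)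

variable {ν n : ℕ}

abbrev Fields.rho (z : Fields ν) (α : Fin ν) : E3 → ℝ := z.1 α
abbrev Fields.M (z : Fields ν) : E3 → E3 := z.2.1
abbrev Fields.e (z : Fields ν) : E3 → ℝ := z.2.2

/-- The mixture mass density `ρ = ∑ ρ_α`. -/
def Fields.mass (z : Fields ν) (x : E3) : ℝ := ∑ α, z.rho α x

/-- The barycentric velocity `v = M / ρ`. -/
def Fields.vel (z : Fields ν) (x : E3) : E3 := (z.mass x)⁻¹ • z.M x

/-- Values of the thermodynamic state variables `(ρ₁, …, ρ_ν, e)`. -/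
abbrev Values (ν : ℕ) := (Fin ν → ℝ) × ℝ

def Fields.val (z : Fields ν) (x : E3) : Values ν := (fun α => z.rho α x, z.e x)

/-- The space `D_z = W^{1,3}(Ω)^ν × W^{1,3}_N(Ω) × W^{1,3}(Ω)` of an isolated system. -/
def phaseSpace (Ω : Set E3) : Set (Fields ν) :=
  {z | (∀ α, MemW Ω 3 (z.rho α)) ∧ ((∀ i, MemW Ω 3 (fun x => z.M x i)) ∧ NormalTraceZero Ω z.M) ∧
    MemW Ω 3 z.e}

/-- The norm of `D_z`. -/
def phaseNorm (Ω : Set E3) (z : Fields ν) : ℝ :=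
  ∑ α, sobNorm Ω 3 (z.rho α) + ∑ i, sobNorm Ω 3 (fun x => z.M x i) + sobNorm Ω 3 z.e

/-- The state space `Z ⊆ D_z`: the mass density is bounded away from zero and the thermodynamic
state variables take their values in the set `D` on which the thermodynamic potential is given. -/
def stateSpace (Ω : Set E3) (D : Set (Values ν)) : Set (Fields ν) :=
  {z | z ∈ phaseSpace Ω ∧ (∃ r : ℝ, 0 < r ∧ ∀ᵐ x ∂volume.restrict Ω, r ≤ z.mass x) ∧
    ∀ᵐ x ∂volume.restrict Ω, z.val x ∈ D}

/-- The pairing `⟨g, h⟩ = ∫_Ω g · h dx`. -/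
def pairing (Ω : Set E3) (g h : Fields ν) : ℝ :=
  ∫ x in Ω, (∑ α, g.rho α x * h.rho α x + inner ℝ (g.M x) (h.M x) + g.e x * h.e x)

/-- `g` is a functional derivative at `w` of the functional `A` on the set `Z` of states:
`d/dε A(w + ε h) = ⟨g, h⟩` at `ε = 0` whenever `w + ε h` stays in `Z` for small `ε`. -/
def HasFunctionalDeriv (Ω : Set E3) (Z : Set (Fields ν)) (A : Fields ν → ℝ) (w g : Fields ν) :
    Prop :=
  ∀ h ∈ phaseSpace Ω, (∀ᶠ ε in 𝓝 (0 : ℝ), w + ε • h ∈ Z) →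
    HasDerivAt (fun ε : ℝ => A (w + ε • h)) (pairing Ω g h) 0

/-- Continuity of a real functional on `Z ⊆ D_z`. -/
def ContinuousFunctional (Ω : Set E3) (Z : Set (Fields ν)) (A : Fields ν → ℝ) : Prop :=
  ∀ w ∈ Z, ∀ ε > 0, ∃ η > 0, ∀ w' ∈ Z, phaseNorm Ω (w' - w) < η → |A w' - A w| < ε

/-- Continuity of a map from `Z ⊆ D_z` to `D_z`. -/
def ContinuousOperator (Ω : Set E3) (Z : Set (Fields ν)) (G : Fields ν → Fields ν) : Prop :=
  ∀ w ∈ Z, ∀ ε > 0, ∃ η > 0, ∀ w' ∈ Z, phaseNorm Ω (w' - w) < η → phaseNorm Ω (G w' - G w) < ε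

/-- `A` is a (continuously differentiable) observable on the set `Z` of states, with functional
derivative `δA : Z → D_z`. -/
structure IsSmoothObservable (Ω : Set E3) (Z : Set (Fields ν)) (A : Fields ν → ℝ)
    (δA : Fields ν → Fields ν) : Prop where
  continuous : ContinuousFunctional Ω Z A
  mem : ∀ w ∈ Z, δA w ∈ phaseSpace Ω
  hasDeriv : ∀ w ∈ Z, HasFunctionalDeriv Ω Z A w (δA w)
  continuous_deriv : ContinuousOperator Ω Z δA

/-! ### Thermodynamics and constitutive relations -/

/-- Which thermodynamic density is the potential. With `energy`, the field `e` is the entropy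
density `s` and the potential is `u(ρ₁, …, ρ_ν, s)`; with `entropy`, the field `e` is the internal
energy density `u` and the potential is `s(ρ₁, …, ρ_ν, u)`. -/
inductive Representation
  | energy
  | entropy

/-- `∂pot/∂e`. -/
def dE (pot : Values ν → ℝ) (y : Values ν) : ℝ := fderiv ℝ pot y (0, 1)

/-- `∂pot/∂ρ_α`. -/
def dRho (pot : Values ν → ℝ) (α : Fin ν) (y : Values ν) : ℝ := fderiv ℝ pot y (Pi.single α 1, 0)

/-- Absolute temperature: `T = ∂u/∂s`, respectively `1/T = ∂s/∂u`. -/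
def temp (rep : Representation) (pot : Values ν → ℝ) (y : Values ν) : ℝ :=
  match rep with
  | .energy => dE pot y
  | .entropy => (dE pot y)⁻¹

/-- Chemical potentials: `μ_α = ∂u/∂ρ_α`, respectively `-μ_α/T = ∂s/∂ρ_α`. -/
def chem (rep : Representation) (pot : Values ν → ℝ) (α : Fin ν) (y : Values ν) : ℝ :=
  match rep with
  | .energy => dRho pot α y
  | .entropy => - temp .entropy pot y * dRho pot α y

/-- Internal energy density. -/
def uDens (rep : Representation) (pot : Values ν → ℝ) (y : Values ν) : ℝ :=
  match rep with
  | .energy => pot y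
  | .entropy => y.2

/-- Entropy density. -/
def sDens (rep : Representation) (pot : Values ν → ℝ) (y : Values ν) : ℝ :=
  match rep with
  | .energy => y.2
  | .entropy => pot y

/-- Thermodynamic pressure `p = -u + T s + ∑ ρ_α μ_α`. -/
def pressure (rep : Representation) (pot : Values ν → ℝ) (y : Values ν) : ℝ :=
  - uDens rep pot y + temp rep pot y * sDens rep pot y + ∑ α, y.1 α * chem rep pot α y

/-- Total energy, kinetic plus internal. -/
def totalEnergy (rep : Representation) (pot : Values ν → ℝ) (Ω : Set E3) (z : Fields ν) : ℝ :=
  (∫ x in Ω, inner ℝ (z.M x) (z.M x) / (2 * z.mass x)) + ∫ x in Ω, uDens rep pot (z.val x)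

/-- Total entropy. -/
def totalEntropy (rep : Representation) (pot : Values ν → ℝ) (Ω : Set E3) (z : Fields ν) : ℝ :=
  ∫ x in Ω, sDens rep pot (z.val x)

/-- Material data of a mixture of `ν` constituents with `n` chemical reactions: stoichiometric
coefficients `γ_α^k`, molecular masses `m_α`, and the phenomenological coefficients, which are
functions of the thermodynamic state: `L^k`, `L^{kb}`, bulk viscosity `λ`, shear viscosity `ζ`, heat
conductivity `κ`, and the transport coefficients `B_α`, `B_{αβ}`. -/
structure Coefficients (ν n : ℕ) where
  γ : Fin ν → Fin n → ℝ
  m : Fin ν → ℝ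
  L : Fin n → Values ν → ℝ
  LL : Fin n → Fin n → Values ν → ℝ
  lam : Values ν → ℝ
  zeta : Values ν → ℝ
  kappa : Values ν → ℝ
  B : Fin ν → Values ν → ℝ
  BB : Fin ν → Fin ν → Values ν → ℝ

/-- No reaction changes the total mass. -/
def Coefficients.MassConserving (c : Coefficients ν n) : Prop := ∀ k, ∑ α, c.γ α k * c.m α = 0

/-- `𝕃_α = ∑_k γ_α^k m_α L^k`. -/
def Coefficients.bL (c : Coefficients ν n) (α : Fin ν) (y : Values ν) : ℝ :=
  ∑ k, c.γ α k * c.m α * c.L k y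

/-- `𝕃_{αβ} = ∑_{k,b} γ_α^k m_α L^{kb} γ_β^b m_β`. -/
def Coefficients.bLL (c : Coefficients ν n) (α β : Fin ν) (y : Values ν) : ℝ :=
  ∑ k, ∑ b, c.γ α k * c.m α * c.LL k b y * (c.γ β b * c.m β)

section Fluxes

variable (rep : Representation) (pot : Values ν → ℝ) (c : Coefficients ν n) (Ω : Set E3)

/-- `∇(1/T)`. -/
def gradInvT (z : Fields ν) (x : E3) : E3 := wgrad Ω (fun y => 1 / temp rep pot (z.val y)) x

/-- `∇(μ_α/T)`. -/
def gradMuT (z : Fields ν) (α : Fin ν) (x : E3) : E3 :=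
  wgrad Ω (fun y => chem rep pot α (z.val y) / temp rep pot (z.val y)) x

/-- Heat flux `q = κ T² ∇(1/T) - ∑ B_β ∇(μ_β/T)`. -/
def heatFlux (z : Fields ν) (x : E3) : E3 :=
  (c.kappa (z.val x) * temp rep pot (z.val x) ^ 2) • gradInvT rep pot Ω z x
    - ∑ β, c.B β (z.val x) • gradMuT rep pot Ω z β x

/-- Diffusion fluxes `J_α = B_α ∇(1/T) - ∑ B_{αβ} ∇(μ_β/T)`. -/
def diffFlux (z : Fields ν) (α : Fin ν) (x : E3) : E3 :=
  c.B α (z.val x) • gradInvT rep pot Ω z x - ∑ β, c.BB α β (z.val x) • gradMuT rep pot Ω z β x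

/-- Reaction rates `Λ^k = -∑_b L^{kb} (∑_α μ_α γ_α^b m_α) + L^k div v`. -/
def reactionRate (z : Fields ν) (k : Fin n) (x : E3) : ℝ :=
  - ∑ b, c.LL k b (z.val x) * ∑ α, chem rep pot α (z.val x) * c.γ α b * c.m α
    + c.L k (z.val x) * wdiv Ω z.vel x

/-- Mass productions `τ_α = ∑_k γ_α^k m_α Λ^k`. -/
def massProd (z : Fields ν) (α : Fin ν) (x : E3) : ℝ :=
  ∑ k, c.γ α k * c.m α * reactionRate rep pot c Ω z k x

/-- `∑_β 𝕃_β μ_β`. -/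
def sumLmu (y : Values ν) : ℝ := ∑ β, c.bL β y * chem rep pot β y

/-- `∇v + ∇vᵀ`. -/
def symGrad (w : E3 → E3) (x : E3) : Matrix (Fin 3) (Fin 3) ℝ :=
  jac Ω w x + (jac Ω w x).transpose

/-- Viscous stress `S = (λ - 2ζ/3) div(v) I + ζ (∇v + ∇vᵀ)`. -/
def viscousStress (z : Fields ν) (x : E3) : Matrix (Fin 3) (Fin 3) ℝ :=
  ((c.lam (z.val x) - 2 * c.zeta (z.val x) / 3) * wdiv Ω z.vel x) • (1 : Matrix (Fin 3) (Fin 3) ℝ)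
    + c.zeta (z.val x) • symGrad Ω z.vel x

/-! ### The weak formulation of the field equations of an isolated system -/

/-- Weak form, tested with `φ`, of the right-hand side of
`∂ₜρ_α = -div(ρ_α v + J_α) + τ_α` for all `α`. -/
def massForm (z φ : Fields ν) (x : E3) : ℝ :=
  ∑ α, (inner ℝ (z.rho α x • z.vel x + diffFlux rep pot c Ω z α x) (wgrad Ω (φ.rho α) x)
    + massProd rep pot c Ω z α x * φ.rho α x)

/-- Weak form of the right-hand side of `∂ₜM = -div(M ⊗ v - T)`, with stress tensor
`T = (-p + ∑ 𝕃_α μ_α) I + S`. -/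
def momentumForm (z φ : Fields ν) (x : E3) : ℝ :=
  dcontr (Matrix.of fun i j => z.M x i * z.vel x j) (jac Ω φ.M x)
    + inner ℝ (φ.M x)
        (wgrad Ω (fun y => - pressure rep pot (z.val y) + sumLmu rep pot c (z.val y)) x)
    - dcontr (viscousStress c Ω z x) (jac Ω φ.M x)

/-- Weak form of the right-hand side of the balance of the remaining state variable: the entropy
balance `∂ₜs = -div(s v + (q - ∑ J_α μ_α)/T) + Σ`, with entropy production
`Σ = q·∇(1/T) + (T:∇v + p div v)/T - ∑ (J_α·∇(μ_α/T) + τ_α μ_α/T)`, respectively the internal energy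
balance `∂ₜu = -div(u v + q) + T:∇v`. -/
def thermalForm (z φ : Fields ν) (x : E3) : ℝ :=
  match rep with
  | .energy =>
      z.e x * inner ℝ (z.vel x) (wgrad Ω φ.e x)
      + inner ℝ (heatFlux .energy pot c Ω z x)
          (wgrad Ω (fun y => φ.e y / temp .energy pot (z.val y)) x)
      + dcontr (viscousStress c Ω z x) (jac Ω z.vel x) * (φ.e x / temp .energy pot (z.val x))
      - ∑ α, (inner ℝ (diffFlux .energy pot c Ω z α x)
            (wgrad Ω (fun y => chem .energy pot α (z.val y) * φ.e y / temp .energy pot (z.val y)) x)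
          + (massProd .energy pot c Ω z α x - c.bL α (z.val x) * wdiv Ω z.vel x)
            * (chem .energy pot α (z.val x) * φ.e x / temp .energy pot (z.val x)))
  | .entropy =>
      inner ℝ (z.e x • z.vel x + heatFlux .entropy pot c Ω z x) (wgrad Ω φ.e x)
      - inner ℝ (z.vel x)
          (wgrad Ω (fun y => (- pressure .entropy pot (z.val y)
            + sumLmu .entropy pot c (z.val y)) * φ.e y) x)
      + dcontr (viscousStress c Ω z x) (jac Ω z.vel x) * φ.e x

/-- The functional on `D_z` to which `∂ₜz` has to be equal. All boundary integrals are absent, because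
the normal components of `v`, `q`, `J_α` and `S` vanish on the boundary. -/
def weakForm (z φ : Fields ν) : ℝ :=
  ∫ x in Ω, (massForm rep pot c Ω z φ x + momentumForm rep pot c Ω z φ x
    + thermalForm rep pot c Ω z φ x)

/-! ### The brackets, as functions of the state and of the two functional derivatives -/

/-- Poisson bracket `{A, B}(z)`, with `a = δA/δz` and `b = δB/δz`. -/
def poisson (z a b : Fields ν) : ℝ :=
  ∫ x in Ω,
    (- ∑ α, z.rho α x *
        (inner ℝ (a.M x) (wgrad Ω (b.rho α) x) - inner ℝ (b.M x) (wgrad Ω (a.rho α) x))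
    + ∑ α, (inner ℝ (a.M x) (wgrad Ω (fun y => b.rho α y * c.bL α (z.val y)) x)
        - inner ℝ (b.M x) (wgrad Ω (fun y => a.rho α y * c.bL α (z.val y)) x))
    - ∑ i, z.M x i * (inner ℝ (a.M x) (wgrad Ω (fun y => b.M y i) x)
        - inner ℝ (b.M x) (wgrad Ω (fun y => a.M y i) x))
    - z.e x * (inner ℝ (a.M x) (wgrad Ω b.e x) - inner ℝ (b.M x) (wgrad Ω a.e x))
    - match rep with
      | .energy => 0
      | .entropy =>
          inner ℝ (a.M x) (wgrad Ω (fun y => b.e y *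
            (pressure .entropy pot (z.val y) - sumLmu .entropy pot c (z.val y))) x)
          - inner ℝ (b.M x) (wgrad Ω (fun y => a.e y *
            (pressure .entropy pot (z.val y) - sumLmu .entropy pot c (z.val y))) x))

/-- `(1/T) δA/δs`, respectively `δA/δu`. -/
def thermalPart (z a : Fields ν) (x : E3) : ℝ :=
  match rep with
  | .energy => 1 / temp .energy pot (z.val x) * a.e x
  | .entropy => a.e x

/-- `δA/δρ_α - (μ_α/T) δA/δs`, respectively `δA/δρ_α`. -/
def chemPart (z a : Fields ν) (α : Fin ν) (x : E3) : ℝ :=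
  match rep with
  | .energy => a.rho α x - chem .energy pot α (z.val x) / temp .energy pot (z.val x) * a.e x
  | .entropy => a.rho α x

/-- `∇(δA/δM) + ∇(δA/δM)ᵀ - (∇v + ∇vᵀ) (1/T) δA/δs`, respectively with `δA/δu` at the end. -/
def shearPart (z a : Fields ν) (x : E3) : Matrix (Fin 3) (Fin 3) ℝ :=
  symGrad Ω a.M x - thermalPart rep pot z a x • symGrad Ω z.vel x

/-- `div(δA/δM) - div(v) (1/T) δA/δs`, respectively with `δA/δu` at the end. -/
def divPart (z a : Fields ν) (x : E3) : ℝ :=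
  wdiv Ω a.M x - wdiv Ω z.vel x * thermalPart rep pot z a x

/-- Dissipation bracket `[A, B](z)`, with `a = δA/δz` and `b = δB/δz`. -/
def dissipation (z a b : Fields ν) : ℝ :=
  ∫ x in Ω,
    (c.zeta (z.val x) * temp rep pot (z.val x) / 2
        * dcontr (shearPart rep pot Ω z a x) (shearPart rep pot Ω z b x)
    + temp rep pot (z.val x) * (c.lam (z.val x) - 2 * c.zeta (z.val x) / 3)
        * divPart rep pot Ω z a x * divPart rep pot Ω z b x
    + inner ℝ (wgrad Ω (thermalPart rep pot z a) x)
        ((c.kappa (z.val x) * temp rep pot (z.val x) ^ 2) • wgrad Ω (thermalPart rep pot z b) x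
          + ∑ β, c.B β (z.val x) • wgrad Ω (chemPart rep pot z b β) x)
    + ∑ α, inner ℝ (wgrad Ω (chemPart rep pot z a α) x)
        (c.B α (z.val x) • wgrad Ω (thermalPart rep pot z b) x
          + ∑ β, c.BB α β (z.val x) • wgrad Ω (chemPart rep pot z b β) x)
    + temp rep pot (z.val x) * ∑ α, ∑ β,
        chemPart rep pot z a α x * c.bLL α β (z.val x) * chemPart rep pot z b β x)

/-! ### Regularity and solutions -/

/-- The temperature is positive, and the coefficient functions at the state `z` are regular enough:
`T`, `1/T`, `μ_α`, `μ_α/T` are in `W^{1,3}`, `p` and `𝕃_α` in `W^{1,1+ε}`, `𝕃_{αβ}` in `L^{1+ε}`,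
and `λ`, `κ`, `ζ`, `B_α`, `B_{αβ}` in `L^{3+ε}`. -/
structure WellBehaved (ε : ℝ) (z : Fields ν) : Prop where
  temp_pos : ∀ᵐ x ∂volume.restrict Ω, 0 < temp rep pot (z.val x)
  temp : MemW Ω 3 (fun x => temp rep pot (z.val x))
  invTemp : MemW Ω 3 (fun x => 1 / Mixture.temp rep pot (z.val x))
  chem : ∀ α, MemW Ω 3 (fun x => chem rep pot α (z.val x))
  chemTemp : ∀ α, MemW Ω 3 (fun x => Mixture.chem rep pot α (z.val x) /
    Mixture.temp rep pot (z.val x))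
  pressure : MemW Ω (ENNReal.ofReal (1 + ε)) (fun x => pressure rep pot (z.val x))
  bL : ∀ α, MemW Ω (ENNReal.ofReal (1 + ε)) (fun x => c.bL α (z.val x))
  bLL : ∀ α β, MemLp (fun x => c.bLL α β (z.val x)) (ENNReal.ofReal (1 + ε)) (volume.restrict Ω)
  lam : MemLp (fun x => c.lam (z.val x)) (ENNReal.ofReal (3 + ε)) (volume.restrict Ω)
  kappa : MemLp (fun x => c.kappa (z.val x)) (ENNReal.ofReal (3 + ε)) (volume.restrict Ω)
  zeta : MemLp (fun x => c.zeta (z.val x)) (ENNReal.ofReal (3 + ε)) (volume.restrict Ω)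
  B : ∀ α, MemLp (fun x => c.B α (z.val x)) (ENNReal.ofReal (3 + ε)) (volume.restrict Ω)
  BB : ∀ α β, MemLp (fun x => c.BB α β (z.val x)) (ENNReal.ofReal (3 + ε)) (volume.restrict Ω)

end Fluxes

/-- The curve `z` is differentiable at `t` with derivative `ℓ` as a curve in the dual of `D_z`, into
which `D_z` is embedded by the pairing. -/
def HasDualDerivAt (Ω : Set E3) (z : ℝ → Fields ν) (ℓ : Fields ν → ℝ) (t : ℝ) : Prop :=
  (∃ C : ℝ, ∀ φ ∈ phaseSpace Ω, |ℓ φ| ≤ C * phaseNorm Ω φ) ∧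
    ∀ ε > 0, ∀ᶠ τ in 𝓝 t, ∀ φ ∈ phaseSpace Ω,
      |pairing Ω (z τ - z t) φ - (τ - t) * ℓ φ| ≤ ε * |τ - t| * phaseNorm Ω φ

/-- `z` is a weak solution, on the time interval `(a, b)`, of the field equations of the isolated
mixture: `v · n = 0` on the boundary, and `∂ₜz(t)` is, for almost every `t`, the functional `weakForm`
on `D_z`. Testing with all of `D_z` without boundary integrals expresses that the normal components
of `q`, `J_α` and `S` vanish on the boundary. -/
def IsIsolatedSolution (rep : Representation) (pot : Values ν → ℝ) (c : Coefficients ν n)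
    (Ω : Set E3) (a b : ℝ) (z : ℝ → Fields ν) : Prop :=
  ∀ᵐ t ∂volume.restrict (Set.Ioo a b),
    NormalTraceZero Ω (z t).vel ∧ HasDualDerivAt Ω z (weakForm rep pot c Ω (z t)) t

/-- Continuity of the curve `z` in the norm of `D_z` on the interval `(a, b)`. -/
def IsContinuousCurve (Ω : Set E3) (a b : ℝ) (z : ℝ → Fields ν) : Prop :=
  ∀ t ∈ Set.Ioo a b, Tendsto (fun τ => phaseNorm Ω (z τ - z t)) (𝓝 t) (𝓝 0)

end Mixture

end

noncomputable section

namespace Mixture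

open MeasureTheory Filter Topology

/-! ### Weak directional derivatives -/

/-! Two independent facts carry the theorem.

The first is a chain rule along the curve (`hasDerivAt_observable`). On the segment from `z t` to `z
τ`, which convexity keeps in `Z`, the mean value theorem writes the increment of `A` as the pairing
of `z τ - z t` with the functional derivative of `A` at an intermediate state. That state tends to
`z t` in the norm of the phase space, hence so does the derivative of `A` there, while the
difference quotient of the curve converges in the dual space. The limit is the weak form of the
field equations tested with `δA (z t)`.

The second is an identity at a fixed state (`weakForm_eq_brackets`): for every `φ` in the phase
space, the weak form tested with `φ` is the sum of the two brackets. The derivatives of energy and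
entropy are first identified almost everywhere (`HasFunctionalDeriv.ae_eq`) by perturbing the state
with fields localized both in space and in the values of the state; in particular the momentum
component of the energy derivative is `v`, which makes `v` a Sobolev field. In the dissipation
bracket the entropy then contributes exactly the forces `∇(1/T)`, `-∇(μ/T)` and `-∇v/T`, which turns
the bracket into fluxes. In the Poisson bracket the pressure gradient comes from the Gibbs-Duhem
relation (energy representation) or from the extra term with `π` (entropy representation). The
`|v|²/2` terms cancel because `M = ρ v` and because the reactions conserve mass. What is left over
are the Gauss-Green integrands of `v` against `φ_α 𝕃_α`, whose integrals vanish since `v · n = 0`.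

The rest is the analysis which makes these manipulations legitimate: product and chain rules for
weak derivatives, and integrability of every term, so that integrals can be split. Both rest on the
Sobolev embedding for Lipschitz domains, proved by the Gagliardo-Nirenberg argument along cone
directions (`memLp_three_half`) and then improved by taking powers (`memLp_improve`). `Sob Ω s`
packages the outcome: class `1 / 3` is an algebra acting by multiplication on every class with `1 /
3 ≤ s < 1`. -/

/-- Test functions on `Ω`. -/
structure IsTest (Ω : Set E3) (φ : E3 → ℝ) : Prop where
  smooth : ContDiff ℝ (⊤ : ℕ∞) φ
  compact : HasCompactSupport φ
  subset : tsupport φ ⊆ Ω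

theorem locallyIntegrableOn_congr_ae {Ω : Set E3} {F : Type*} [NormedAddCommGroup F]
    {f g : E3 → F} (hΩ : IsOpen Ω)
    (hf : LocallyIntegrableOn f Ω) (h : f =ᵐ[volume.restrict Ω] g) : LocallyIntegrableOn g Ω := by
  rw [locallyIntegrableOn_iff hΩ.isLocallyClosed] at hf ⊢
  intro K hK hc
  exact (hf K hK hc).congr_fun_ae (ae_restrict_of_ae_restrict_of_subset hK h)

variable {Ω : Set E3} {F : Type*} [NormedAddCommGroup F] [NormedSpace ℝ F]
  {F' : Type*} [NormedAddCommGroup F'] [NormedSpace ℝ F']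

/-- `f'` is the weak derivative of `f` on `Ω` in the direction `v`. -/
structure HasWeakDeriv (Ω : Set E3) (v : E3) (f f' : E3 → F) : Prop where
  loc : LocallyIntegrableOn f Ω
  loc' : LocallyIntegrableOn f' Ω
  eq : ∀ φ, IsTest Ω φ → ∫ x in Ω, fderiv ℝ φ x v • f x = - ∫ x in Ω, φ x • f' x

theorem integrable_smul_of_tsupport_subset {g : E3 → ℝ} {f : E3 → F}
    (hg : Continuous g) (hc : HasCompactSupport g) (hs : tsupport g ⊆ Ω)
    (hf : LocallyIntegrableOn f Ω) : Integrable (fun x => g x • f x) := by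
  have h1 : IntegrableOn f (tsupport g) := hf.integrableOn_compact_subset hs hc
  have h2 : IntegrableOn (fun x => g x • f x) (tsupport g) :=
    h1.continuousOn_smul hg.continuousOn hc
  refine (integrableOn_iff_integrable_of_support_subset ?_).1 h2
  intro x hx
  apply subset_tsupport g
  intro h
  simp [h] at hx

theorem setIntegral_smul_of_tsupport_subset {g : E3 → ℝ} {f : E3 → F}
    (hs : tsupport g ⊆ Ω) : ∫ x in Ω, g x • f x = ∫ x, g x • f x := by
  apply setIntegral_eq_integral_of_forall_compl_eq_zero
  intro x hx
  have : g x = 0 := by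
    by_contra h
    exact hx (hs (subset_tsupport g h))
  simp [this]

namespace IsTest

variable {φ ψ : E3 → ℝ}

theorem continuous (h : IsTest Ω φ) : Continuous φ := h.smooth.continuous

theorem differentiable (h : IsTest Ω φ) : Differentiable ℝ φ :=
  h.smooth.differentiable (by simp)

theorem continuous_fderiv (h : IsTest Ω φ) (v : E3) : Continuous fun x => fderiv ℝ φ x v :=
  (h.smooth.continuous_fderiv (by simp)).clm_apply continuous_const

theorem tsupport_fderiv (v : E3) : tsupport (fun x => fderiv ℝ φ x v) ⊆ tsupport φ := by
  refine closure_minimal ?_ (isClosed_tsupport φ)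
  intro x hx
  apply support_fderiv_subset ℝ (f := φ)
  intro h
  simp [h] at hx

theorem compact_fderiv (h : IsTest Ω φ) (v : E3) :
    HasCompactSupport fun x => fderiv ℝ φ x v :=
  h.compact.of_isClosed_subset (isClosed_tsupport _) (tsupport_fderiv v)

theorem integrable_smul (h : IsTest Ω φ) {f : E3 → F} (hf : LocallyIntegrableOn f Ω) :
    Integrable fun x => φ x • f x :=
  integrable_smul_of_tsupport_subset h.continuous h.compact h.subset hf

theorem integrable_fderiv_smul (h : IsTest Ω φ) (v : E3) {f : E3 → F}
    (hf : LocallyIntegrableOn f Ω) : Integrable fun x => fderiv ℝ φ x v • f x :=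
  integrable_smul_of_tsupport_subset (h.continuous_fderiv v) (h.compact_fderiv v)
    ((tsupport_fderiv v).trans h.subset) hf

theorem mono {Ω' : Set E3} (h : IsTest Ω φ) (hs : Ω ⊆ Ω') : IsTest Ω' φ :=
  ⟨h.smooth, h.compact, h.subset.trans hs⟩

end IsTest

namespace HasWeakDeriv

variable {v : E3} {f f' g g' : E3 → F}

theorem congr (hΩ : IsOpen Ω) (h : HasWeakDeriv Ω v f f') (hf : f =ᵐ[volume.restrict Ω] g)
    (hf' : f' =ᵐ[volume.restrict Ω] g') : HasWeakDeriv Ω v g g' where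
  loc := locallyIntegrableOn_congr_ae hΩ h.loc hf
  loc' := locallyIntegrableOn_congr_ae hΩ h.loc' hf'
  eq φ hφ := by
    have e1 : ∫ x in Ω, fderiv ℝ φ x v • f x = ∫ x in Ω, fderiv ℝ φ x v • g x :=
      integral_congr_ae (hf.mono fun x hx => by simp only [hx])
    have e2 : ∫ x in Ω, φ x • f' x = ∫ x in Ω, φ x • g' x :=
      integral_congr_ae (hf'.mono fun x hx => by simp only [hx])
    rw [← e1, ← e2, h.eq φ hφ]

theorem ae_unique (hΩ : IsOpen Ω) [CompleteSpace F] (h : HasWeakDeriv Ω v f f')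
    (h' : HasWeakDeriv Ω v f g') : f' =ᵐ[volume.restrict Ω] g' := by
  have hl : LocallyIntegrableOn (fun x => f' x - g' x) Ω := h.loc'.sub h'.loc'
  have key := hΩ.ae_eq_zero_of_integral_contDiff_smul_eq_zero hl (fun φ h1 h2 h3 => by
    have hφ : IsTest Ω φ := ⟨h1, h2, h3⟩
    have e : ∫ x in Ω, φ x • f' x = ∫ x in Ω, φ x • g' x := by
      have := (h.eq φ hφ).symm.trans (h'.eq φ hφ)
      simpa using this
    rw [setIntegral_smul_of_tsupport_subset h3, setIntegral_smul_of_tsupport_subset h3] at e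
    simp_rw [smul_sub]
    rw [integral_sub (hφ.integrable_smul h.loc') (hφ.integrable_smul h'.loc'), e, sub_self])
  rw [EventuallyEq, ae_restrict_iff' hΩ.measurableSet]
  filter_upwards [key] with x hx hxΩ
  exact sub_eq_zero.1 (hx hxΩ)

theorem add (h : HasWeakDeriv Ω v f f') (hg : HasWeakDeriv Ω v g g') :
    HasWeakDeriv Ω v (fun x => f x + g x) (fun x => f' x + g' x) where
  loc := h.loc.add hg.loc
  loc' := h.loc'.add hg.loc'
  eq φ hφ := by
    simp_rw [smul_add]
    rw [integral_add (hφ.integrable_fderiv_smul v h.loc).integrableOn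
        (hφ.integrable_fderiv_smul v hg.loc).integrableOn,
      integral_add (hφ.integrable_smul h.loc').integrableOn
        (hφ.integrable_smul hg.loc').integrableOn, h.eq φ hφ, hg.eq φ hφ, neg_add]

theorem const_smul (h : HasWeakDeriv Ω v f f') (c : ℝ) :
    HasWeakDeriv Ω v (fun x => c • f x) (fun x => c • f' x) where
  loc := h.loc.smul c
  loc' := h.loc'.smul c
  eq φ hφ := by
    simp_rw [smul_comm _ c]
    rw [integral_smul, integral_smul, h.eq φ hφ, smul_neg]

theorem neg (h : HasWeakDeriv Ω v f f') :
    HasWeakDeriv Ω v (fun x => - f x) (fun x => - f' x) := by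
  simpa using h.const_smul (-1)

theorem sub (h : HasWeakDeriv Ω v f f') (hg : HasWeakDeriv Ω v g g') :
    HasWeakDeriv Ω v (fun x => f x - g x) (fun x => f' x - g' x) := by
  simpa [sub_eq_add_neg] using h.add hg.neg

theorem zero : HasWeakDeriv Ω v (fun _ => (0 : F)) (fun _ => 0) where
  loc := locallyIntegrableOn_zero
  loc' := locallyIntegrableOn_zero
  eq φ hφ := by simp

theorem sum {ι : Type*} (s : Finset ι) {f f' : ι → E3 → F}
    (h : ∀ i ∈ s, HasWeakDeriv Ω v (f i) (f' i)) :
    HasWeakDeriv Ω v (fun x => ∑ i ∈ s, f i x) (fun x => ∑ i ∈ s, f' i x) := by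
  classical
  induction s using Finset.induction_on with
  | empty => simpa using zero
  | insert a s ha ih =>
    simp_rw [Finset.sum_insert ha]
    exact (h a (by simp)).add (ih fun i hi => h i (by simp [hi]))

/-- Dependence on the direction is linear. -/
theorem add_dir {w : E3} {f'' : E3 → F} (h : HasWeakDeriv Ω v f f')
    (hg : HasWeakDeriv Ω w f f'') : HasWeakDeriv Ω (v + w) f (fun x => f' x + f'' x) where
  loc := h.loc
  loc' := h.loc'.add hg.loc'
  eq φ hφ := by
    simp_rw [map_add, add_smul, smul_add]
    rw [integral_add (hφ.integrable_fderiv_smul v h.loc).integrableOn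
        (hφ.integrable_fderiv_smul w h.loc).integrableOn,
      integral_add (hφ.integrable_smul h.loc').integrableOn
        (hφ.integrable_smul hg.loc').integrableOn, h.eq φ hφ, hg.eq φ hφ, neg_add]

theorem smul_dir (h : HasWeakDeriv Ω v f f') (c : ℝ) :
    HasWeakDeriv Ω (c • v) f (fun x => c • f' x) where
  loc := h.loc
  loc' := h.loc'.smul c
  eq φ hφ := by
    simp_rw [map_smul, smul_assoc, smul_comm _ c]
    rw [integral_smul, integral_smul, h.eq φ hφ, smul_neg]

theorem sum_dir {ι : Type*} (s : Finset ι) {w : ι → E3} {f' : ι → E3 → F}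
    (hf : LocallyIntegrableOn f Ω) (h : ∀ i ∈ s, HasWeakDeriv Ω (w i) f (f' i)) :
    HasWeakDeriv Ω (∑ i ∈ s, w i) f (fun x => ∑ i ∈ s, f' i x) := by
  classical
  induction s using Finset.induction_on with
  | empty => exact ⟨hf, by simpa using locallyIntegrableOn_zero, fun φ _ => by simp⟩
  | insert a s ha ih =>
    simp_rw [Finset.sum_insert ha]
    exact (h a (by simp)).add_dir (ih fun i hi => h i (by simp [hi]))

/-- Bundling components into one vector-valued function lets a single chain rule cover functions of
several Sobolev functions: products as well as thermodynamic potentials. -/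
theorem prodMk [CompleteSpace F] [CompleteSpace F'] {g g' : E3 → F'} (h : HasWeakDeriv Ω v f f')
    (hg : HasWeakDeriv Ω v g g') :
    HasWeakDeriv Ω v (fun x => (f x, g x)) (fun x => (f' x, g' x)) := by
  have aux : ∀ {f : E3 → F} {g : E3 → F'}, LocallyIntegrableOn f Ω → LocallyIntegrableOn g Ω →
      LocallyIntegrableOn (fun x => (f x, g x)) Ω := by
    intro f g hf hg x hx
    obtain ⟨s, hs, h1⟩ := hf x hx
    obtain ⟨t, ht, h2⟩ := hg x hx
    exact ⟨s ∩ t, inter_mem hs ht, Integrable.prodMk (h1.mono_set Set.inter_subset_left)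
      (h2.mono_set Set.inter_subset_right)⟩
  refine ⟨aux h.loc hg.loc, aux h.loc' hg.loc', fun φ hφ => ?_⟩
  simp_rw [Prod.smul_mk]
  rw [integral_pair (hφ.integrable_fderiv_smul v h.loc).integrableOn
      (hφ.integrable_fderiv_smul v hg.loc).integrableOn,
    integral_pair (hφ.integrable_smul h.loc').integrableOn
      (hφ.integrable_smul hg.loc').integrableOn, h.eq φ hφ, hg.eq φ hφ, Prod.neg_mk]

theorem pi {ι : Type*} [Fintype ι] [CompleteSpace F] {f f' : ι → E3 → F}
    (h : ∀ i, HasWeakDeriv Ω v (f i) (f' i)) :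
    HasWeakDeriv Ω v (fun x i => f i x) (fun x i => f' i x) := by
  classical
  have e : ∀ f : ι → E3 → F, (fun x i => f i x)
      = fun x => ∑ i, (ContinuousLinearMap.single ℝ (fun _ : ι => F) i) (f i x) := by
    intro f
    funext x
    exact (Finset.univ_sum_single (fun i => f i x)).symm
  rw [e f, e f']
  refine sum _ fun i _ => ?_
  set L := ContinuousLinearMap.single ℝ (fun _ : ι => F) i
  have aux : ∀ {f : E3 → F}, LocallyIntegrableOn f Ω → LocallyIntegrableOn (fun x => L (f x)) Ω := by
    intro f hf x hx
    obtain ⟨s, hs, h1⟩ := hf x hx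
    exact ⟨s, hs, L.integrable_comp h1⟩
  refine ⟨aux (h i).loc, aux (h i).loc', fun φ hφ => ?_⟩
  simp_rw [← map_smul]
  rw [L.integral_comp_comm (hφ.integrable_fderiv_smul v (h i).loc).integrableOn,
    L.integral_comp_comm (hφ.integrable_smul (h i).loc').integrableOn, (h i).eq φ hφ, map_neg]

/-- Dominated convergence for weak derivatives. -/
theorem of_tendsto (hΩ : IsOpen Ω) {fn fn' : ℕ → E3 → ℝ} {f f' bd bd' : E3 → ℝ}
    (h : ∀ k, HasWeakDeriv Ω v (fn k) (fn' k))
    (hb : LocallyIntegrableOn bd Ω) (hb' : LocallyIntegrableOn bd' Ω)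
    (h1 : ∀ k, ∀ᵐ x ∂volume.restrict Ω, |fn k x| ≤ bd x)
    (h2 : ∀ k, ∀ᵐ x ∂volume.restrict Ω, |fn' k x| ≤ bd' x)
    (h3 : ∀ᵐ x ∂volume.restrict Ω, Tendsto (fun k => fn k x) atTop (𝓝 (f x)))
    (h4 : ∀ᵐ x ∂volume.restrict Ω, Tendsto (fun k => fn' k x) atTop (𝓝 (f' x))) :
    HasWeakDeriv Ω v f f' := by
  have aux : ∀ {fn : ℕ → E3 → ℝ} {f bd : E3 → ℝ}, (∀ k, LocallyIntegrableOn (fn k) Ω) →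
      LocallyIntegrableOn bd Ω → (∀ k, ∀ᵐ x ∂volume.restrict Ω, |fn k x| ≤ bd x) →
      (∀ᵐ x ∂volume.restrict Ω, Tendsto (fun k => fn k x) atTop (𝓝 (f x))) →
      LocallyIntegrableOn f Ω ∧ ∀ g : E3 → ℝ, Continuous g → HasCompactSupport g →
        tsupport g ⊆ Ω → Tendsto (fun k => ∫ x in Ω, g x • fn k x) atTop
          (𝓝 (∫ x in Ω, g x • f x)) := by
    intro fn f bd hfn hbd hle hlim
    have hl : LocallyIntegrableOn f Ω := by
      rw [locallyIntegrableOn_iff hΩ.isLocallyClosed] at hbd ⊢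
      intro K hK hc
      have hm : ∀ k, AEStronglyMeasurable (fn k) (volume.restrict K) := fun k =>
        ((hfn k).integrableOn_compact_subset hK hc).aestronglyMeasurable
      refine (hbd K hK hc).mono' (aestronglyMeasurable_of_tendsto_ae atTop hm
        (ae_restrict_of_ae_restrict_of_subset hK hlim)) ?_
      filter_upwards [ae_restrict_of_ae_restrict_of_subset hK hlim,
        ae_restrict_of_ae_restrict_of_subset hK (ae_all_iff.2 hle)] with x hx hx'
      exact le_of_tendsto hx.abs (Eventually.of_forall hx')
    refine ⟨hl, fun g hg hgc hgs => ?_⟩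
    refine tendsto_integral_of_dominated_convergence (fun x => |g x| • bd x) (fun k => ?_) ?_
      (fun k => ?_) ?_
    · exact (integrable_smul_of_tsupport_subset hg hgc hgs (hfn k)).integrableOn.aestronglyMeasurable
    · refine (integrable_smul_of_tsupport_subset (g := fun x => |g x|) hg.abs hgc.norm ?_
        hbd).integrableOn
      refine (closure_mono ?_).trans hgs
      intro x hx h
      exact hx (by simp [h])
    · filter_upwards [hle k] with x hx
      rw [norm_smul, Real.norm_eq_abs, Real.norm_eq_abs, smul_eq_mul]
      exact mul_le_mul_of_nonneg_left hx (abs_nonneg _)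
    · filter_upwards [hlim] with x hx
      exact hx.const_smul _
  obtain ⟨l1, c1⟩ := aux (fun k => (h k).loc) hb h1 h3
  obtain ⟨l2, c2⟩ := aux (fun k => (h k).loc') hb' h2 h4
  refine ⟨l1, l2, fun φ hφ => ?_⟩
  have t1 := c1 _ (hφ.continuous_fderiv v) (hφ.compact_fderiv v)
    ((IsTest.tsupport_fderiv v).trans hφ.subset)
  have t2 := (c2 _ hφ.continuous hφ.compact hφ.subset).neg
  simp_rw [(h _).eq φ hφ] at t1
  exact tendsto_nhds_unique t1 t2

end HasWeakDeriv

end Mixture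

end

set_option linter.unusedSectionVars false

noncomputable section

namespace Mixture

open MeasureTheory Filter Topology
open scoped Convolution

variable {Ω : Set E3} {E : Type*} [NormedAddCommGroup E] [NormedSpace ℝ E]

/-! ### Mollification and the chain rule -/

/-- A sequence of bump functions shrinking to the origin. -/
def moll (k : ℕ) : ContDiffBump (0 : E3) where
  rIn := 1 / (k + 1) / 2
  rOut := 1 / (k + 1)
  rIn_pos := by positivity
  rIn_lt_rOut := half_lt_self (by positivity)

theorem moll_rOut_tendsto : Tendsto (fun k => (moll k).rOut) atTop (𝓝 0) :=
  tendsto_one_div_add_atTop_nhds_zero_nat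

/-- The mollified function. -/
def mollify (k : ℕ) (f : E3 → E) : E3 → E :=
  (moll k).normed volume ⋆[ContinuousLinearMap.lsmul ℝ ℝ, volume] f

theorem mollify_tendsto_ae [CompleteSpace E] {f : E3 → E} (hf : LocallyIntegrable f) :
    ∀ᵐ x, Tendsto (fun k => mollify k f x) atTop (𝓝 (f x)) :=
  ContDiffBump.ae_convolution_tendsto_right_of_locallyIntegrable (K := 2) moll_rOut_tendsto
    (Eventually.of_forall fun k => by simp only [moll]; linarith) hf

theorem contDiff_mollify {f : E3 → E} (hf : LocallyIntegrable f) (k : ℕ) :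
    ContDiff ℝ (⊤ : ℕ∞) (mollify k f) :=
  (moll k).hasCompactSupport_normed.contDiff_convolution_left _ (moll k).contDiff_normed hf

theorem mollify_exists {f : E3 → E} (hf : LocallyIntegrable f) (k : ℕ) :
    ConvolutionExists ((moll k).normed volume) f (ContinuousLinearMap.lsmul ℝ ℝ) volume :=
  (moll k).hasCompactSupport_normed.convolutionExists_left _ (moll k).continuous_normed hf

theorem integrable_mollify {f : E3 → E} (hf : Integrable f) (k : ℕ) : Integrable (mollify k f) :=
  (moll k).integrable_normed.integrable_convolution _ hf

variable [CompleteSpace E]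

theorem mollify_sub {f g : E3 → E} (hf : LocallyIntegrable f) (hg : LocallyIntegrable g) (k : ℕ)
    (x : E3) : mollify k (fun y => f y - g y) x = mollify k f x - mollify k g x := by
  have h1 := mollify_exists hf k x
  have h2 := mollify_exists hg k x
  simp only [mollify, convolution_def]
  rw [← integral_sub h1 h2]
  simp [smul_sub]

theorem integral_norm_mollify_le {f : E3 → E} (hf : Integrable f) (k : ℕ) :
    ∫ x, ‖mollify k f x‖ ≤ ∫ x, ‖f x‖ := by
  have h1 : ∀ x, ‖mollify k f x‖ ≤ mollify k (fun y => ‖f y‖) x := by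
    intro x
    simp only [mollify, convolution_def]
    refine (norm_integral_le_integral_norm _).trans_eq ?_
    simp [norm_smul, abs_of_nonneg ((moll k).nonneg_normed _)]
  refine (integral_mono (integrable_mollify hf k).norm (integrable_mollify hf.norm k) h1).trans_eq ?_
  simp only [mollify]
  rw [integral_convolution _ (moll k).integrable_normed hf.norm]
  simp [(moll k).integral_normed]

/-- Density argument. For a continuous compactly supported `g` the mollifications converge uniformly
and, for small radii, vanish outside one compact set. Mollification contracts the L¹ norm, so an L¹
approximation of `f` by such a `g` transfers the convergence. -/
theorem tendsto_integral_norm_mollify_sub {f : E3 → E} (hf : Integrable f) :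
    Tendsto (fun k => ∫ x, ‖mollify k f x - f x‖) atTop (𝓝 0) := by
  rw [Metric.tendsto_atTop]
  intro ε hε
  obtain ⟨g, hgc, hfg, hg, hgi⟩ := hf.exists_hasCompactSupport_integral_sub_le
    (show 0 < ε / 4 by positivity)
  set K := Metric.cthickening 1 (tsupport g) with hK
  have hKc : IsCompact K := hgc.isCompact.cthickening
  set m := volume.real K with hm
  have hm0 : 0 ≤ m := measureReal_nonneg
  obtain ⟨δ, hδ, hgu⟩ := Metric.uniformContinuous_iff.1
    (hgc.uniformContinuous_of_continuous hg) (ε / 4 / (m + 1)) (by positivity)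
  have hev : ∀ᶠ k in atTop, (moll k).rOut < min 1 δ :=
    moll_rOut_tendsto.eventually_lt_const (by positivity)
  obtain ⟨N, hN⟩ := eventually_atTop.1 hev
  refine ⟨N, fun k hk => ?_⟩
  have hr := hN k hk
  -- Uniform continuity bounds the error on `K`. Off `K` both terms vanish, because the
  -- mollification radius is below the thickening radius 1.
  have key : ∀ x, ‖mollify k g x - g x‖ ≤ K.indicator (fun _ => ε / 4 / (m + 1)) x := by
    intro x
    by_cases hx : x ∈ K
    · rw [Set.indicator_of_mem hx, ← dist_eq_norm]
      refine (moll k).dist_normed_convolution_le hg.aestronglyMeasurable fun y hy => ?_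
      exact (hgu ((Metric.mem_ball.1 hy).trans (hr.trans_le (min_le_right _ _)))).le
    · rw [Set.indicator_of_notMem hx, ← dist_eq_norm]
      refine (moll k).dist_normed_convolution_le hg.aestronglyMeasurable fun y hy => ?_
      have hz : ∀ y, y ∈ Metric.ball x 1 → g y = 0 := by
        intro y hy
        by_contra h
        refine hx (Metric.mem_cthickening_of_dist_le x y 1 _ (subset_tsupport g h) ?_)
        rw [dist_comm]
        exact (Metric.mem_ball.1 hy).le
      rw [hz y (Metric.ball_subset_ball (hr.trans_le (min_le_left _ _)).le hy),
        hz x (Metric.mem_ball_self one_pos), dist_self]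
  have hfl := hf.locallyIntegrable
  have hgl := hgi.locallyIntegrable
  have hfgi : Integrable (fun x => f x - g x) := hf.sub hgi
  have b1 := integral_norm_mollify_le hfgi k
  have b2 : ∫ x, ‖mollify k g x - g x‖ ≤ ε / 4 := by
    refine (integral_mono ((integrable_mollify hgi k).sub hgi).norm
      ((integrable_indicator_iff hKc.measurableSet).2 (integrableOn_const hKc.measure_ne_top))
      key).trans ?_
    rw [integral_indicator hKc.measurableSet, setIntegral_const, smul_eq_mul, ← hm]
    rw [mul_div_assoc', div_le_iff₀ (by positivity)]
    nlinarith
  have hp : ∀ x, ‖mollify k f x - f x‖ ≤ ‖mollify k (fun y => f y - g y) x‖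
      + ‖mollify k g x - g x‖ + ‖f x - g x‖ := by
    intro x
    rw [mollify_sub hfl hgl]
    have : mollify k f x - f x = (mollify k f x - mollify k g x) + (mollify k g x - g x)
      - (f x - g x) := by abel
    rw [this]
    exact (norm_sub_le _ _).trans (add_le_add (norm_add_le _ _) le_rfl)
  have i1 := (integrable_mollify hfgi k).norm
  have i2 : Integrable fun x => ‖mollify k g x - g x‖ := ((integrable_mollify hgi k).sub hgi).norm
  have i12 : Integrable fun x => ‖mollify k (fun y => f y - g y) x‖ + ‖mollify k g x - g x‖ :=
    i1.add i2
  have b : ∫ x, ‖mollify k f x - f x‖ ≤ ∫ x, (‖mollify k (fun y => f y - g y) x‖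
      + ‖mollify k g x - g x‖ + ‖f x - g x‖) := integral_mono ((integrable_mollify hf k).sub hf).norm (i12.add hfgi.norm) hp
  rw [dist_zero_right, Real.norm_of_nonneg (integral_nonneg fun x => norm_nonneg _)]
  have e : ∫ x, (‖mollify k (fun y => f y - g y) x‖ + ‖mollify k g x - g x‖ + ‖f x - g x‖)
      = (∫ x, ‖mollify k (fun y => f y - g y) x‖) + (∫ x, ‖mollify k g x - g x‖)
        + ∫ x, ‖f x - g x‖ := by
    rw [integral_add i12 hfgi.norm, integral_add i1 i2]
  have b' := b.trans_eq e
  linarith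

theorem fderiv_mollify {f : E3 → E} (hf : LocallyIntegrable f) (k : ℕ) (x v : E3) :
    fderiv ℝ (mollify k f) x v
      = ∫ y, fderiv ℝ ((moll k).normed volume) (x - y) v • f y := by
  have hc := (moll k).hasCompactSupport_normed (μ := (volume : Measure E3))
  have hs : ContDiff ℝ 1 ((moll k).normed (volume : Measure E3)) := (moll k).contDiff_normed
  have hd : HasFDerivAt (mollify k f) _ x :=
    hc.hasFDerivAt_convolution_left (ContinuousLinearMap.lsmul ℝ ℝ) hs hf x
  rw [hd.fderiv]
  have hex := HasCompactSupport.convolutionExists_left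
    ((ContinuousLinearMap.lsmul ℝ ℝ : ℝ →L[ℝ] E →L[ℝ] E).precompL E3) (hc.fderiv ℝ)
    (hs.continuous_fderiv one_ne_zero) hf x
  rw [convolution_def, ContinuousLinearMap.integral_apply hex]
  rw [← integral_sub_left_eq_self _ _ x]
  simp

namespace HasWeakDeriv

variable {v : E3}

/-- As a function of `y`, the kernel `ρ (x - y)` is itself a test function on `Ω` as long as its
ball lies in `K`, so the definition of the weak derivative can be applied to it. Cutting off to `K`
makes the functions globally integrable and is invisible at such `x`. -/
theorem fderiv_mollify_eq {w W : E3 → E} (h : HasWeakDeriv Ω v w W) {K : Set E3} (hKΩ : K ⊆ Ω)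
    (hK : IsCompact K) {k : ℕ} {x : E3} (hx : Metric.closedBall x (moll k).rOut ⊆ K) :
    fderiv ℝ (mollify k (K.indicator w)) x v = mollify k (K.indicator W) x := by
  have hm := hK.measurableSet
  have hw : LocallyIntegrable (K.indicator w) := ((integrable_indicator_iff hm).2
    (h.loc.integrableOn_compact_subset hKΩ hK)).locallyIntegrable
  set ρ := (moll k).normed (volume : Measure E3) with hρ
  have hsup : tsupport (fun y => ρ (x - y)) ⊆ Metric.closedBall x (moll k).rOut := by
    refine closure_minimal ?_ Metric.isClosed_closedBall
    intro y hy
    have : x - y ∈ Function.support ρ := hy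
    rw [hρ, (moll k).support_normed_eq, mem_ball_zero_iff] at this
    rw [Metric.mem_closedBall, dist_comm, dist_eq_norm]
    exact this.le
  have hψ : IsTest Ω (fun y => ρ (x - y)) :=
    ⟨(moll k).contDiff_normed.comp (contDiff_const.sub contDiff_id),
      HasCompactSupport.of_support_subset_isCompact (isCompact_closedBall x (moll k).rOut)
        ((subset_tsupport _).trans hsup), hsup.trans (hx.trans hKΩ)⟩
  have hz : ∀ y ∉ K, ρ (x - y) = 0 := fun y hy => by
    by_contra h0
    exact hy (hx (hsup (subset_tsupport _ h0)))
  have hd : ∀ y, fderiv ℝ (fun y => ρ (x - y)) y v = - fderiv ℝ ρ (x - y) v := by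
    intro y
    have h1 : HasFDerivAt ρ (fderiv ℝ ρ (x - y)) (x - y) :=
      (((moll k).contDiff_normed (n := 1)).differentiable one_ne_zero _).hasFDerivAt
    have h2 : HasFDerivAt (fun y : E3 => x - y) (-ContinuousLinearMap.id ℝ E3) y :=
      (hasFDerivAt_id y).const_sub x
    have h3 := h1.comp y h2
    rw [show (fun y => ρ (x - y)) = ρ ∘ (fun y => x - y) from rfl, h3.fderiv]
    simp
  have hdz : ∀ y ∉ K, fderiv ℝ ρ (x - y) v = 0 := fun y hy => by
    have := hd y
    rw [eq_comm, neg_eq_iff_eq_neg] at this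
    rw [this, neg_eq_zero]
    by_contra h0
    exact hy (hx (hsup (IsTest.tsupport_fderiv v (subset_tsupport _ h0))))
  rw [fderiv_mollify hw]
  have key := h.eq _ hψ
  rw [setIntegral_smul_of_tsupport_subset hψ.subset, setIntegral_smul_of_tsupport_subset
    ((IsTest.tsupport_fderiv v).trans hψ.subset)] at key
  have e1 : ∫ y, fderiv ℝ ρ (x - y) v • K.indicator w y
      = - ∫ y, fderiv ℝ (fun y => ρ (x - y)) y v • w y := by
    rw [← integral_neg]
    refine integral_congr_ae (Eventually.of_forall fun y => ?_)
    simp only [hd]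
    by_cases hy : y ∈ K
    · simp [hy]
    · simp [hy, hdz y hy]
  have e2 : mollify k (K.indicator W) x = ∫ y, ρ (x - y) • W y := by
    simp only [mollify, convolution_def]
    rw [← integral_sub_left_eq_self _ _ x]
    refine integral_congr_ae (Eventually.of_forall fun y => ?_)
    by_cases hy : y ∈ K
    · simp [hy, hρ]
    · simp [hy, hz y hy]
  rw [e1, e2, key, neg_neg]

/-- Chain rule for weak derivatives. -/
theorem comp (hΩ : IsOpen Ω) {w W : E3 → E} (h : HasWeakDeriv Ω v w W) {Φ : E → ℝ}
    (hΦ : ContDiff ℝ 1 Φ) {C : ℝ} (hC : ∀ y, ‖fderiv ℝ Φ y‖ ≤ C) :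
    HasWeakDeriv Ω v (fun x => Φ (w x)) (fun x => fderiv ℝ Φ (w x) (W x)) := by
  have hC0 : 0 ≤ C := (norm_nonneg _).trans (hC 0)
  have hlip : ∀ a b, |Φ a - Φ b| ≤ C * ‖a - b‖ := fun a b =>
    Convex.norm_image_sub_le_of_norm_fderiv_le (𝕜 := ℝ)
      (fun x _ => hΦ.differentiable one_ne_zero x) (fun x _ => hC x) convex_univ trivial trivial
  have hcont : Continuous fun p : E × E => fderiv ℝ Φ p.1 p.2 :=
    ((hΦ.continuous_fderiv one_ne_zero).comp continuous_fst).clm_apply continuous_snd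
  have hbd : ∀ a b, |fderiv ℝ Φ a b| ≤ C * ‖b‖ := fun a b =>
    ((fderiv ℝ Φ a).le_opNorm b).trans (mul_le_mul_of_nonneg_right (hC a) (norm_nonneg _))
  refine ⟨?_, ?_, fun φ hφ => ?_⟩
  · have := h.loc
    rw [locallyIntegrableOn_iff hΩ.isLocallyClosed] at this ⊢
    intro K hK hc
    have hi := this K hK hc
    refine Integrable.mono' (((integrableOn_const hc.measure_ne_top (C := |Φ 0|))).add
      (hi.norm.const_mul C)) (hΦ.continuous.comp_aestronglyMeasurable hi.aestronglyMeasurable)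
      (Eventually.of_forall fun x => ?_)
    have := hlip (w x) 0
    have h3 : |Φ (w x)| ≤ |Φ (w x) - Φ 0| + |Φ 0| := by
      simpa using abs_add_le (Φ (w x) - Φ 0) (Φ 0)
    simp only [sub_zero] at this
    simp only [Real.norm_eq_abs, Pi.add_apply]
    linarith
  · have h1 := h.loc
    have h2 := h.loc'
    rw [locallyIntegrableOn_iff hΩ.isLocallyClosed] at h1 h2 ⊢
    intro K hK hc
    refine Integrable.mono' ((h2 K hK hc).norm.const_mul C)
      (hcont.comp_aestronglyMeasurable ((h1 K hK hc).aestronglyMeasurable.prodMk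
        (h2 K hK hc).aestronglyMeasurable)) (Eventually.of_forall fun x => hbd _ _)
  -- A compact neighbourhood of the support with room `δ`: once the mollification radius is below
  -- `δ`, mollifying at points of the support only sees values inside it.
  obtain ⟨δ, hδ, hδΩ⟩ := hφ.compact.isCompact.exists_cthickening_subset_open hΩ hφ.subset
  set K := Metric.cthickening δ (tsupport φ) with hKdef
  have hK : IsCompact K := hφ.compact.isCompact.cthickening
  have hm := hK.measurableSet
  set w₀ := K.indicator w with hw₀
  set W₀ := K.indicator W with hW₀
  have hw : Integrable w₀ := (integrable_indicator_iff hm).2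
    (h.loc.integrableOn_compact_subset hδΩ hK)
  have hW : Integrable W₀ := (integrable_indicator_iff hm).2
    (h.loc'.integrableOn_compact_subset hδΩ hK)
  have hwK : ∀ x ∈ tsupport φ, w₀ x = w x ∧ W₀ x = W x := fun x hx => by
    have := Metric.self_subset_cthickening (δ := δ) _ hx
    exact ⟨Set.indicator_of_mem this _, Set.indicator_of_mem this _⟩
  obtain ⟨B, hB⟩ := hφ.compact.exists_bound_of_continuous hφ.continuous
  obtain ⟨B', hB'⟩ := (hφ.compact_fderiv v).exists_bound_of_continuous (hφ.continuous_fderiv v)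
  have hB0 : 0 ≤ B := (norm_nonneg _).trans (hB 0)
  have hB0' : 0 ≤ B' := (norm_nonneg _).trans (hB' 0)
  have huniv : IsTest Set.univ φ := hφ.mono (Set.subset_univ _)
  have hcl : ∀ {g : E3 → ℝ}, Continuous g → LocallyIntegrableOn g Set.univ := fun hg =>
    hg.locallyIntegrable.locallyIntegrableOn _
  have hwc : ∀ k, ContDiff ℝ 1 (fun x => Φ (mollify k w₀ x)) := fun k =>
    hΦ.comp ((contDiff_mollify hw.locallyIntegrable k).of_le (by exact_mod_cast le_top))
  have hD : ∀ k, ∫ x, fderiv ℝ φ x v • Φ (mollify k w₀ x)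
      = - ∫ x, φ x • fderiv ℝ Φ (mollify k w₀ x) (fderiv ℝ (mollify k w₀) x v) := by
    intro k
    have hg := hwc k
    have hdg : ∀ x, fderiv ℝ (fun x => Φ (mollify k w₀ x)) x v
        = fderiv ℝ Φ (mollify k w₀ x) (fderiv ℝ (mollify k w₀) x v) := by
      intro x
      rw [show (fun x => Φ (mollify k w₀ x)) = Φ ∘ mollify k w₀ from rfl,
        fderiv_comp x (hΦ.differentiable one_ne_zero _)
          ((contDiff_mollify hw.locallyIntegrable k).differentiable (by simp) x)]
      rfl
    have := integral_smul_fderiv_eq_neg_fderiv_smul_of_integrable (v := v) (μ := volume)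
      (f := φ) (g := fun x => Φ (mollify k w₀ x))
      (huniv.integrable_fderiv_smul v (hcl hg.continuous))
      (huniv.integrable_smul (hcl ((hg.continuous_fderiv one_ne_zero).clm_apply continuous_const)))
      (huniv.integrable_smul (hcl hg.continuous)) (fun x _ => hφ.differentiable x)
      (fun x _ => hg.differentiable one_ne_zero x)
    simp_rw [hdg] at this
    rw [this, neg_neg]
  have hev : ∀ᶠ k in atTop, ∫ x, fderiv ℝ φ x v • Φ (mollify k w₀ x)
      = - ∫ x, φ x • fderiv ℝ Φ (mollify k w₀ x) (mollify k W₀ x) := by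
    filter_upwards [moll_rOut_tendsto.eventually_lt_const hδ] with k hk
    rw [hD k]
    congr 1
    refine integral_congr_ae (Eventually.of_forall fun x => ?_)
    by_cases hx : x ∈ tsupport φ
    · simp only
      rw [h.fderiv_mollify_eq hδΩ hK (k := k) (x := x)
        ((Metric.closedBall_subset_closedBall hk.le).trans
          (Metric.closedBall_subset_cthickening hx δ))]
    · simp [image_eq_zero_of_notMem_tsupport hx]
  have iw : ∀ k, Integrable fun x => ‖mollify k w₀ x - w₀ x‖ := fun k =>
    ((integrable_mollify hw k).sub hw).norm
  have iW : ∀ k, Integrable fun x => ‖mollify k W₀ x - W₀ x‖ := fun k =>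
    ((integrable_mollify hW k).sub hW).norm
  have iΦ : Integrable fun x => fderiv ℝ φ x v • Φ (w₀ x) := by
    have hl : LocallyIntegrable fun x => Φ (w₀ x) := by
      intro x
      refine ((hw.norm.const_mul C).locallyIntegrable.add (locallyIntegrable_const |Φ 0|)).mono
        (hΦ.continuous.comp_aestronglyMeasurable hw.aestronglyMeasurable)
        (Eventually.of_forall fun x => ?_) x
      have := hlip (w₀ x) 0
      have h3 : |Φ (w₀ x)| ≤ |Φ (w₀ x) - Φ 0| + |Φ 0| := by
        simpa using abs_add_le (Φ (w₀ x) - Φ 0) (Φ 0)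
      simp only [sub_zero] at this
      refine le_trans ?_ (le_abs_self _)
      simp only [Real.norm_eq_abs, Pi.add_apply]
      linarith
    exact huniv.integrable_fderiv_smul v (hl.locallyIntegrableOn _)
  have T1 : Tendsto (fun k => ∫ x, fderiv ℝ φ x v • Φ (mollify k w₀ x)) atTop
      (𝓝 (∫ x, fderiv ℝ φ x v • Φ (w₀ x))) := by
    rw [tendsto_iff_norm_sub_tendsto_zero]
    refine squeeze_zero (fun _ => norm_nonneg _) (fun k => ?_)
      (by simpa using (tendsto_integral_norm_mollify_sub hw).const_mul (B' * C))
    rw [← integral_sub (huniv.integrable_fderiv_smul v (hcl (hwc k).continuous)) iΦ,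
      ← integral_const_mul]
    refine norm_integral_le_of_norm_le ((iw k).const_mul _) (Eventually.of_forall fun x => ?_)
    rw [← smul_sub, norm_smul, mul_assoc]
    exact mul_le_mul (hB' x) (hlip _ _) (norm_nonneg _) hB0'
  have mW : ∀ k, AEStronglyMeasurable (fun x => φ x • fderiv ℝ Φ (mollify k w₀ x) (W₀ x)) :=
    fun k => hφ.continuous.aestronglyMeasurable.smul (hcont.comp_aestronglyMeasurable
      ((integrable_mollify hw k).aestronglyMeasurable.prodMk hW.aestronglyMeasurable))
  have mW' : ∀ k, AEStronglyMeasurable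
      (fun x => φ x • fderiv ℝ Φ (mollify k w₀ x) (mollify k W₀ x)) :=
    fun k => hφ.continuous.aestronglyMeasurable.smul (hcont.comp_aestronglyMeasurable
      ((integrable_mollify hw k).aestronglyMeasurable.prodMk
        (integrable_mollify hW k).aestronglyMeasurable))
  have bW : ∀ x a b, ‖φ x • fderiv ℝ Φ a b‖ ≤ B * C * ‖b‖ := fun x a b => by
    rw [norm_smul, mul_assoc]
    exact mul_le_mul (hB x) (hbd _ _) (norm_nonneg _) hB0
  -- The coefficient `fderiv ℝ Φ (mollify k w₀ x)` is bounded but converges only pointwise almost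
  -- everywhere. Keeping `W₀` fixed allows dominated convergence here; replacing `W₀` by its
  -- mollification afterwards costs at most `B * C` times an L¹ distance.
  have T2 : Tendsto (fun k => ∫ x, φ x • fderiv ℝ Φ (mollify k w₀ x) (W₀ x)) atTop
      (𝓝 (∫ x, φ x • fderiv ℝ Φ (w₀ x) (W₀ x))) := by
    refine tendsto_integral_of_dominated_convergence (fun x => B * C * ‖W₀ x‖) mW
      (hW.norm.const_mul _) (fun k => Eventually.of_forall fun x => bW x _ _) ?_
    filter_upwards [mollify_tendsto_ae hw.locallyIntegrable] with x hx
    exact (((hcont.comp (Continuous.prodMk_left (W₀ x))).tendsto _).comp hx).const_smul _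
  have T3 : Tendsto (fun k => ∫ x, φ x • fderiv ℝ Φ (mollify k w₀ x) (mollify k W₀ x)) atTop
      (𝓝 (∫ x, φ x • fderiv ℝ Φ (w₀ x) (W₀ x))) := by
    refine tendsto_of_tendsto_of_dist T2 ?_
    refine squeeze_zero (fun _ => dist_nonneg) (fun k => ?_)
      (by simpa using (tendsto_integral_norm_mollify_sub hW).const_mul (B * C))
    rw [dist_comm, dist_eq_norm, ← integral_sub (((integrable_mollify hW k).norm.const_mul _).mono' (mW' k)
      (Eventually.of_forall fun x => bW x _ _)) ((hW.norm.const_mul _).mono' (mW k)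
      (Eventually.of_forall fun x => bW x _ _)), ← integral_const_mul]
    refine norm_integral_le_of_norm_le ((iW k).const_mul _) (Eventually.of_forall fun x => ?_)
    rw [← smul_sub, ← map_sub]
    exact bW x _ _
  have hfin := tendsto_nhds_unique (T1.congr' hev) T3.neg
  rw [setIntegral_smul_of_tsupport_subset hφ.subset,
    setIntegral_smul_of_tsupport_subset ((IsTest.tsupport_fderiv v).trans hφ.subset)]
  have e1 : ∫ x, fderiv ℝ φ x v • Φ (w x) = ∫ x, fderiv ℝ φ x v • Φ (w₀ x) := by
    refine integral_congr_ae (Eventually.of_forall fun x => ?_)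
    by_cases hx : x ∈ tsupport φ
    · simp only [(hwK x hx).1]
    · have : fderiv ℝ φ x v = 0 := image_eq_zero_of_notMem_tsupport
        (f := fun x => fderiv ℝ φ x v) fun h' => hx (IsTest.tsupport_fderiv v h')
      simp [this]
  have e2 : ∫ x, φ x • fderiv ℝ Φ (w x) (W x) = ∫ x, φ x • fderiv ℝ Φ (w₀ x) (W₀ x) := by
    refine integral_congr_ae (Eventually.of_forall fun x => ?_)
    by_cases hx : x ∈ tsupport φ
    · simp only [(hwK x hx).1, (hwK x hx).2]
    · simp [image_eq_zero_of_notMem_tsupport hx]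
  rw [e1, e2, hfin]

end HasWeakDeriv

end Mixture

end

set_option linter.unusedSectionVars false

noncomputable section

namespace Mixture

open MeasureTheory Filter Topology

variable {Ω : Set E3}

/-! ### Truncation and the product rule -/

/-- A smooth truncation of the identity. -/
def trunc (k : ℕ) (a : ℝ) : ℝ := a / (1 + a ^ 2 / (k + 1))

/-- The derivative of `trunc k`. -/
def truncD (k : ℕ) (a : ℝ) : ℝ := (1 - a ^ 2 / (k + 1)) / (1 + a ^ 2 / (k + 1)) ^ 2

theorem trunc_denom_pos (k : ℕ) (a : ℝ) : 0 < 1 + a ^ 2 / ((k : ℝ) + 1) := by positivity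

theorem hasDerivAt_trunc (k : ℕ) (a : ℝ) : HasDerivAt (trunc k) (truncD k a) a := by
  have h1 : HasDerivAt (fun a : ℝ => 1 + a ^ 2 / ((k : ℝ) + 1)) (2 * a / (k + 1)) a := by
    simpa using ((hasDerivAt_pow 2 a).div_const ((k : ℝ) + 1)).const_add 1
  have h2 := (hasDerivAt_id a).div h1 (trunc_denom_pos k a).ne'
  have e : truncD k a = (1 * (1 + a ^ 2 / ((k : ℝ) + 1)) - id a * (2 * a / (k + 1)))
      / (1 + a ^ 2 / ((k : ℝ) + 1)) ^ 2 := by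
    simp only [truncD, id]
    congr 1
    ring
  rw [e]
  exact h2

theorem contDiff_trunc (k : ℕ) {n : WithTop ℕ∞} : ContDiff ℝ n (trunc k) :=
  contDiff_id.div (contDiff_const.add ((contDiff_id.pow 2).div_const _))
    fun a => (trunc_denom_pos k a).ne'

theorem abs_trunc_le (k : ℕ) (a : ℝ) : |trunc k a| ≤ |a| := by
  rw [trunc, abs_div, abs_of_pos (trunc_denom_pos k a)]
  exact div_le_self (abs_nonneg _) (by have : 0 ≤ a ^ 2 / ((k : ℝ) + 1) := by positivity
                                       linarith)

theorem abs_trunc_le_const (k : ℕ) (a : ℝ) : |trunc k a| ≤ k + 1 := by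
  rw [trunc, abs_div, abs_of_pos (trunc_denom_pos k a), div_le_iff₀ (trunc_denom_pos k a)]
  have hk : (0 : ℝ) ≤ k := Nat.cast_nonneg k
  have e : ((k : ℝ) + 1) * (1 + a ^ 2 / (k + 1)) = k + 1 + a ^ 2 := by
    field_simp
  rw [e, ← sq_abs]
  nlinarith [sq_nonneg (|a| - 1)]

theorem abs_truncD_le (k : ℕ) (a : ℝ) : |truncD k a| ≤ 1 := by
  have h : 0 ≤ a ^ 2 / ((k : ℝ) + 1) := by positivity
  rw [truncD, abs_div, abs_of_pos (by positivity : 0 < (1 + a ^ 2 / ((k : ℝ) + 1)) ^ 2),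
    div_le_one (by positivity), abs_le]
  constructor <;> nlinarith

theorem tendsto_sq_div (a : ℝ) :
    Tendsto (fun k : ℕ => a ^ 2 / ((k : ℝ) + 1)) atTop (𝓝 0) :=
  tendsto_const_nhds.div_atTop (tendsto_natCast_atTop_atTop.atTop_add tendsto_const_nhds)

theorem tendsto_trunc (a : ℝ) : Tendsto (fun k => trunc k a) atTop (𝓝 a) := by
  have h1 : Tendsto (fun k : ℕ => 1 + a ^ 2 / ((k : ℝ) + 1)) atTop (𝓝 1) := by
    simpa using (tendsto_sq_div a).const_add 1
  have := (tendsto_const_nhds (x := a)).div h1 one_ne_zero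
  rw [div_one] at this
  exact this

theorem tendsto_truncD (a : ℝ) : Tendsto (fun k => truncD k a) atTop (𝓝 1) := by
  have h1 : Tendsto (fun k : ℕ => 1 + a ^ 2 / ((k : ℝ) + 1)) atTop (𝓝 1) := by
    simpa using (tendsto_sq_div a).const_add 1
  have h2 : Tendsto (fun k : ℕ => 1 - a ^ 2 / ((k : ℝ) + 1)) atTop (𝓝 1) := by
    simpa using (tendsto_sq_div a).const_sub 1
  have := h2.div (h1.pow 2) (by norm_num)
  rw [one_pow, div_one] at this
  exact this

namespace HasWeakDeriv

variable {v : E3} {f f' g g' : E3 → ℝ}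

/-- The product rule. -/
theorem mul (hΩ : IsOpen Ω) (hf : HasWeakDeriv Ω v f f') (hg : HasWeakDeriv Ω v g g')
    (h0 : LocallyIntegrableOn (fun x => f x * g x) Ω)
    (h1 : LocallyIntegrableOn (fun x => f' x * g x) Ω)
    (h2 : LocallyIntegrableOn (fun x => f x * g' x) Ω) :
    HasWeakDeriv Ω v (fun x => f x * g x) (fun x => f' x * g x + f x * g' x) := by
  have hd : ∀ (k : ℕ) (p : ℝ × ℝ), HasFDerivAt (fun p : ℝ × ℝ => trunc k p.1 * trunc k p.2)
      (trunc k p.1 • (truncD k p.2 • ContinuousLinearMap.snd ℝ ℝ ℝ)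
        + trunc k p.2 • (truncD k p.1 • ContinuousLinearMap.fst ℝ ℝ ℝ)) p := by
    intro k p
    exact ((hasDerivAt_trunc k p.1).comp_hasFDerivAt p hasFDerivAt_fst).mul
      ((hasDerivAt_trunc k p.2).comp_hasFDerivAt p hasFDerivAt_snd)
  have hval : ∀ (k : ℕ) (p q : ℝ × ℝ), fderiv ℝ (fun p : ℝ × ℝ => trunc k p.1 * trunc k p.2) p q
      = trunc k p.1 * (truncD k p.2 * q.2) + trunc k p.2 * (truncD k p.1 * q.1) := by
    intro k p q
    rw [(hd k p).fderiv]
    simp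
  have hle : ∀ (k : ℕ) (p q : ℝ × ℝ),
      |trunc k p.1 * (truncD k p.2 * q.2)| ≤ |trunc k p.1| * |q.2| ∧
      |trunc k p.2 * (truncD k p.1 * q.1)| ≤ |trunc k p.2| * |q.1| := by
    intro k p q
    simp only [abs_mul]
    constructor <;>
    · refine mul_le_mul_of_nonneg_left ?_ (abs_nonneg _)
      exact mul_le_of_le_one_left (abs_nonneg _) (abs_truncD_le _ _)
  -- The product is not a function of the pair with bounded derivative, but the product of
  -- truncations is, so the chain rule applies. The limit is then dominated by `|f g|` and `|f g'| +
  -- |f' g|`, which are locally integrable by assumption.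
  have hk : ∀ k : ℕ, HasWeakDeriv Ω v (fun x => trunc k (f x) * trunc k (g x))
      (fun x => trunc k (f x) * (truncD k (g x) * g' x)
        + trunc k (g x) * (truncD k (f x) * f' x)) := by
    intro k
    have := (hf.prodMk hg).comp hΩ (Φ := fun p : ℝ × ℝ => trunc k p.1 * trunc k p.2)
      (C := 2 * (k + 1)) (((contDiff_trunc k).comp contDiff_fst).mul
        ((contDiff_trunc k).comp contDiff_snd)) (fun p => by
          refine ContinuousLinearMap.opNorm_le_bound _ (by positivity) fun q => ?_
          rw [hval, Real.norm_eq_abs]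
          refine (abs_add_le _ _).trans ((add_le_add (hle k p q).1 (hle k p q).2).trans ?_)
          have a1 := abs_trunc_le_const k p.1
          have a2 := abs_trunc_le_const k p.2
          have b1 : |q.1| ≤ ‖q‖ := norm_fst_le q
          have b2 : |q.2| ≤ ‖q‖ := norm_snd_le q
          have hk0 : (0 : ℝ) ≤ k + 1 := by positivity
          have c1 := mul_le_mul a1 b2 (abs_nonneg _) hk0
          have c2 := mul_le_mul a2 b1 (abs_nonneg _) hk0
          linarith)
    simpa only [hval] using this
  refine of_tendsto hΩ hk h0.norm (h2.norm.add h1.norm) (fun k => ?_) (fun k => ?_) ?_ ?_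
  · refine Eventually.of_forall fun x => ?_
    rw [abs_mul, norm_mul]
    exact mul_le_mul (abs_trunc_le _ _) (abs_trunc_le _ _) (abs_nonneg _) (norm_nonneg _)
  · refine Eventually.of_forall fun x => ?_
    have := hle k (f x, g x) (f' x, g' x)
    refine (abs_add_le _ _).trans (add_le_add (this.1.trans ?_) (this.2.trans ?_))
    · refine le_of_le_of_eq ?_ (norm_mul _ _).symm
      exact mul_le_mul_of_nonneg_right (abs_trunc_le _ _) (abs_nonneg _)
    · refine le_of_le_of_eq ?_ ((norm_mul _ _).trans (mul_comm _ _)).symm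
      exact mul_le_mul_of_nonneg_right (abs_trunc_le _ _) (abs_nonneg _)
  · exact Eventually.of_forall fun x => (tendsto_trunc _).mul (tendsto_trunc _)
  · refine Eventually.of_forall fun x => ?_
    have := ((tendsto_trunc (f x)).mul ((tendsto_truncD (g x)).mul_const (g' x))).add
      ((tendsto_trunc (g x)).mul ((tendsto_truncD (f x)).mul_const (f' x)))
    convert this using 2
    ring

end HasWeakDeriv

/-- A smooth function is its own weak derivative. -/
theorem HasWeakDeriv.of_contDiff {v : E3} {χ : E3 → ℝ} (hχ : ContDiff ℝ (⊤ : ℕ∞) χ) :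
    HasWeakDeriv Ω v χ (fun x => fderiv ℝ χ x v) := by
  have hc : Continuous fun x => fderiv ℝ χ x v :=
    (hχ.continuous_fderiv (by simp)).clm_apply continuous_const
  have hcl : ∀ {g : E3 → ℝ}, Continuous g → LocallyIntegrableOn g Set.univ := fun hg =>
    hg.locallyIntegrable.locallyIntegrableOn _
  refine ⟨hχ.continuous.locallyIntegrable.locallyIntegrableOn _,
    hc.locallyIntegrable.locallyIntegrableOn _, fun φ hφ => ?_⟩
  have hu : IsTest Set.univ φ := hφ.mono (Set.subset_univ _)
  rw [setIntegral_smul_of_tsupport_subset hφ.subset,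
    setIntegral_smul_of_tsupport_subset ((IsTest.tsupport_fderiv v).trans hφ.subset)]
  have := integral_smul_fderiv_eq_neg_fderiv_smul_of_integrable (v := v) (μ := volume)
    (f := φ) (g := χ) (hu.integrable_fderiv_smul v (hcl hχ.continuous))
    (hu.integrable_smul (hcl hc)) (hu.integrable_smul (hcl hχ.continuous))
    (fun x _ => hφ.differentiable x) (fun x _ => hχ.differentiable (by simp) x)
  rw [this, neg_neg]

/-! ### Weak gradients -/

/-- The standard basis vector. -/
abbrev basisVec (i : Fin 3) : E3 := EuclideanSpace.single i 1

theorem isWeakGradient_iff {f : E3 → ℝ} {G : E3 → E3} :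
    IsWeakGradient Ω f G ↔ LocallyIntegrableOn f Ω ∧ LocallyIntegrableOn G Ω ∧
      ∀ i, HasWeakDeriv Ω (basisVec i) f (fun x => G x i) := by
  have aux : ∀ i, LocallyIntegrableOn G Ω → LocallyIntegrableOn (fun x => G x i) Ω := by
    intro i hG x hx
    obtain ⟨s, hs, h1⟩ := hG x hx
    exact ⟨s, hs, (EuclideanSpace.proj (𝕜 := ℝ) i).integrable_comp h1⟩
  constructor
  · rintro ⟨h1, h2, h3⟩
    refine ⟨h1, h2, fun i => ⟨h1, aux i h2, fun φ hφ => ?_⟩⟩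
    simpa [mul_comm] using h3 φ hφ.smooth hφ.compact hφ.subset i
  · rintro ⟨h1, h2, h3⟩
    refine ⟨h1, h2, fun φ a b c i => ?_⟩
    simpa [mul_comm] using (h3 i).eq φ ⟨a, b, c⟩

theorem locallyIntegrableOn_of_coord {G : E3 → E3}
    (h : ∀ i, LocallyIntegrableOn (fun x => G x i) Ω) : LocallyIntegrableOn G Ω := by
  have e : G = fun x => ∑ i, G x i • basisVec i := by
    funext x
    ext j
    simp [basisVec, Finset.sum_apply, Pi.single_apply]
  have aux : ∀ i, LocallyIntegrableOn (fun x => G x i • basisVec i) Ω := by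
    intro i x hx
    obtain ⟨s, hs, h1⟩ := h i x hx
    exact ⟨s, hs, h1.smul_const _⟩
  rw [e]
  have : ∀ s : Finset (Fin 3), LocallyIntegrableOn (fun x => ∑ i ∈ s, G x i • basisVec i) Ω := by
    intro s
    induction s using Finset.induction_on with
    | empty => simpa using locallyIntegrableOn_zero
    | insert a s ha ih =>
      simp_rw [Finset.sum_insert ha]
      exact (aux a).add ih
  exact this _

theorem isWeakGradient_of_forall {f : E3 → ℝ} {G : E3 → E3}
    (h : ∀ i, HasWeakDeriv Ω (basisVec i) f (fun x => G x i)) : IsWeakGradient Ω f G :=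
  isWeakGradient_iff.2 ⟨(h 0).loc, locallyIntegrableOn_of_coord fun i => (h i).loc', h⟩

namespace IsWeakGradient

variable {f g : E3 → ℝ} {G H : E3 → E3}

theorem hasWeakDeriv (h : IsWeakGradient Ω f G) (i : Fin 3) :
    HasWeakDeriv Ω (basisVec i) f (fun x => G x i) := (isWeakGradient_iff.1 h).2.2 i

theorem ae_unique (hΩ : IsOpen Ω) (h : IsWeakGradient Ω f G) (h' : IsWeakGradient Ω f H) :
    G =ᵐ[volume.restrict Ω] H := by
  have := ae_all_iff.2 fun i => (h.hasWeakDeriv i).ae_unique hΩ (h'.hasWeakDeriv i)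
  filter_upwards [this] with x hx
  ext i
  exact hx i

theorem congr (hΩ : IsOpen Ω) (h : IsWeakGradient Ω f G) (hf : f =ᵐ[volume.restrict Ω] g)
    (hG : G =ᵐ[volume.restrict Ω] H) : IsWeakGradient Ω g H :=
  isWeakGradient_of_forall fun i => (h.hasWeakDeriv i).congr hΩ hf
    (hG.mono fun x hx => by simp only [hx])

theorem wgrad (h : IsWeakGradient Ω f G) : IsWeakGradient Ω f (wgrad Ω f) := by
  have : ∃ G, IsWeakGradient Ω f G := ⟨G, h⟩
  rw [Mixture.wgrad, dif_pos this]
  exact this.choose_spec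

theorem wgrad_ae (hΩ : IsOpen Ω) (h : IsWeakGradient Ω f G) :
    Mixture.wgrad Ω f =ᵐ[volume.restrict Ω] G := h.wgrad.ae_unique hΩ h

theorem add (h : IsWeakGradient Ω f G) (h' : IsWeakGradient Ω g H) :
    IsWeakGradient Ω (fun x => f x + g x) (fun x => G x + H x) :=
  isWeakGradient_of_forall fun i => (h.hasWeakDeriv i).add (h'.hasWeakDeriv i)

theorem sub (h : IsWeakGradient Ω f G) (h' : IsWeakGradient Ω g H) :
    IsWeakGradient Ω (fun x => f x - g x) (fun x => G x - H x) :=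
  isWeakGradient_of_forall fun i => (h.hasWeakDeriv i).sub (h'.hasWeakDeriv i)

theorem neg (h : IsWeakGradient Ω f G) : IsWeakGradient Ω (fun x => - f x) (fun x => - G x) :=
  isWeakGradient_of_forall fun i => (h.hasWeakDeriv i).neg

theorem const_mul (h : IsWeakGradient Ω f G) (c : ℝ) :
    IsWeakGradient Ω (fun x => c * f x) (fun x => c • G x) :=
  isWeakGradient_of_forall fun i => (h.hasWeakDeriv i).const_smul c

theorem const (c : ℝ) : IsWeakGradient Ω (fun _ => c) (fun _ => 0) :=
  isWeakGradient_of_forall fun i => by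
    simpa using HasWeakDeriv.of_contDiff (Ω := Ω) (v := basisVec i) (χ := fun _ => c) contDiff_const

theorem sum {ι : Type*} (s : Finset ι) {f : ι → E3 → ℝ} {G : ι → E3 → E3}
    (h : ∀ i ∈ s, IsWeakGradient Ω (f i) (G i)) :
    IsWeakGradient Ω (fun x => ∑ i ∈ s, f i x) (fun x => ∑ i ∈ s, G i x) :=
  isWeakGradient_of_forall fun j => by
    simpa [Finset.sum_apply] using HasWeakDeriv.sum s fun i hi => (h i hi).hasWeakDeriv j

end IsWeakGradient

/-- Equality holds at every point: the gradient is chosen from the predicate `IsWeakGradient Ω f`,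
and that predicate is literally the same for `f` and `g`. -/
theorem wgrad_congr_ae (hΩ : IsOpen Ω) {f g : E3 → ℝ} (h : f =ᵐ[volume.restrict Ω] g) :
    wgrad Ω f = wgrad Ω g := by
  have : IsWeakGradient Ω f = IsWeakGradient Ω g := by
    funext G
    exact propext ⟨fun h' => h'.congr hΩ h ae_eq_rfl, fun h' => h'.congr hΩ h.symm ae_eq_rfl⟩
  unfold wgrad
  revert this
  generalize IsWeakGradient Ω f = P
  generalize IsWeakGradient Ω g = Q
  rintro rfl
  rfl

end Mixture

end

set_option linter.unusedSectionVars false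

noncomputable section

namespace Mixture

open MeasureTheory Filter Topology
open scoped Convolution

variable {Ω : Set E3}

/-! ### Representation by line integrals, near a boundary point with a cone condition -/

/-- Average of `ψ` over the segment from `x - R • d` to `x`. -/
def segInt (R : ℝ) (d : E3) (ψ : E3 → ℝ) (x : E3) : ℝ := ∫ s in Set.Ioc 0 R, ψ (x - s • d)

/-- As a convolution with respect to the image of Lebesgue measure on a segment, it inherits
smoothness from `ψ` by the general theory. -/
theorem segInt_eq_convolution (R : ℝ) (d : E3) {ψ : E3 → ℝ} (hψ : Continuous ψ) :
    segInt R d ψ = (fun _ : E3 => (1 : ℝ)) ⋆[ContinuousLinearMap.lsmul ℝ ℝ,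
      (volume.restrict (Set.Ioc 0 R)).map fun s : ℝ => s • d] ψ := by
  funext x
  rw [convolution_def, integral_map (by fun_prop) (by fun_prop)]
  simp [segInt]

theorem contDiff_segInt (R : ℝ) (d : E3) {ψ : E3 → ℝ} (hψ : ContDiff ℝ (⊤ : ℕ∞) ψ)
    (hc : HasCompactSupport ψ) : ContDiff ℝ (⊤ : ℕ∞) (segInt R d ψ) := by
  rw [segInt_eq_convolution R d hψ.continuous]
  have : IsFiniteMeasure ((volume.restrict (Set.Ioc 0 R)).map fun s : ℝ => s • d) :=
    Measure.isFiniteMeasure_map _ _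
  exact hc.contDiff_convolution_right _ (locallyIntegrable_const 1) hψ

/-- Moving along `d` merely shifts the interval of integration, so the fundamental theorem of
calculus leaves the two end values. -/
theorem fderiv_segInt {R : ℝ} (hR : 0 ≤ R) (d : E3) {ψ : E3 → ℝ} (hψ : ContDiff ℝ (⊤ : ℕ∞) ψ)
    (hc : HasCompactSupport ψ) (x : E3) :
    fderiv ℝ (segInt R d ψ) x d = ψ x - ψ (x - R • d) := by
  have hl : Continuous fun s : ℝ => ψ (x - s • d) := hψ.continuous.comp (by fun_prop)
  have e : (fun h : ℝ => segInt R d ψ (x + h • d)) = fun h : ℝ =>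
      (∫ s in (0 : ℝ)..(R - h), ψ (x - s • d)) - ∫ s in (0 : ℝ)..(0 - h), ψ (x - s • d) := by
    funext h
    rw [intervalIntegral.integral_interval_sub_left (hl.intervalIntegrable _ _)
      (hl.intervalIntegrable _ _), ← intervalIntegral.integral_comp_sub_right
      (fun s => ψ (x - s • d)) h, segInt, ← intervalIntegral.integral_of_le hR]
    refine intervalIntegral.integral_congr fun s _ => congrArg ψ ?_
    module
  have hF : ∀ a : ℝ, HasDerivAt (fun h : ℝ => ∫ s in (0 : ℝ)..(a - h), ψ (x - s • d))
      (- ψ (x - a • d)) 0 := by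
    intro a
    have h1 := (hl.integral_hasStrictDerivAt 0 (a - 0)).hasDerivAt
    have h2 : HasDerivAt (fun h : ℝ => a - h) (-1) 0 := (hasDerivAt_id _).const_sub a
    have h3 := h1.comp (0 : ℝ) h2
    simp only [sub_zero, mul_neg, mul_one] at h3
    exact h3
  have h1 : HasDerivAt (fun h : ℝ => segInt R d ψ (x + h • d)) (ψ x - ψ (x - R • d)) 0 := by
    rw [e]
    convert! (hF R).sub (hF 0) using 1
    rw [zero_smul, sub_zero]
    ring
  have h2 : HasDerivAt (fun h : ℝ => x + h • d) d 0 := by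
    simpa using ((hasDerivAt_id (0 : ℝ)).smul_const d).const_add x
  have hdf : DifferentiableAt ℝ (segInt R d ψ) (x + (0 : ℝ) • d) :=
    (contDiff_segInt R d hψ hc).differentiable (by simp) _
  have h3 := hdf.hasFDerivAt.comp_hasDerivAt (0 : ℝ) h2
  rw [zero_smul, add_zero] at h3
  exact h3.unique h1

/-- Translations along a fixed direction, as a measure preserving map of the product. -/
theorem measurePreserving_shift (m : Measure ℝ) [SFinite m] (d : E3) :
    MeasurePreserving (fun p : ℝ × E3 => (p.1, p.2 + p.1 • d)) (m.prod volume) (m.prod volume) :=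
  (MeasurePreserving.id m).skew_product (g := fun s x => x + s • d) (by fun_prop)
    (Eventually.of_forall fun s => map_add_right_eq_self volume (s • d))

/-- Fubini and translation invariance: integrating backwards along `d` is adjoint to integrating
forwards. -/
theorem integral_segInt_mul (R : ℝ) (d : E3) {ψ W : E3 → ℝ} (hψ : Continuous ψ)
    (hc : HasCompactSupport ψ) (hW : Integrable W) :
    Integrable (fun x => ∫ s in Set.Ioc 0 R, W (x + s • d)) ∧
    ∫ x, segInt R d ψ x * W x = ∫ x, ψ x * ∫ s in Set.Ioc 0 R, W (x + s • d) := by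
  set m := (volume.restrict (Set.Ioc 0 R) : Measure ℝ) with hm
  obtain ⟨B, hB⟩ := hc.exists_bound_of_continuous hψ
  have i1 : Integrable (fun p : ℝ × E3 => W p.2) (m.prod volume) := hW.comp_snd m
  have i2 : Integrable (fun p : ℝ × E3 => W (p.2 + p.1 • d)) (m.prod volume) :=
    (measurePreserving_shift m d).integrable_comp_of_integrable i1
  have i3 : Integrable (fun p : ℝ × E3 => ψ (p.2 - p.1 • d) * W p.2) (m.prod volume) :=
    i1.bdd_mul (c := B) (by fun_prop) (Eventually.of_forall fun p => hB _)
  have i4 : Integrable (fun p : ℝ × E3 => ψ p.2 * W (p.2 + p.1 • d)) (m.prod volume) :=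
    i2.bdd_mul (c := B) (by fun_prop) (Eventually.of_forall fun p => hB _)
  refine ⟨i2.integral_prod_right, ?_⟩
  have e1 : ∀ x, segInt R d ψ x * W x = ∫ s, ψ (x - s • d) * W x ∂m := fun x =>
    (integral_mul_const _ _).symm
  have e2 : ∀ x, ψ x * ∫ s, W (x + s • d) ∂m = ∫ s, ψ x * W (x + s • d) ∂m := fun x =>
    (integral_const_mul _ _).symm
  simp_rw [e1, e2]
  rw [← integral_prod_symm _ i3, ← integral_prod_symm _ i4, integral_prod _ i3, integral_prod _ i4]
  refine integral_congr_ae (Eventually.of_forall fun s => ?_)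
  simp only
  rw [← integral_add_right_eq_self _ (s • d)]
  simp

/-- The fundamental theorem of calculus along the ray `x + s • d`, at whose far end `χ f` vanishes.
It is proved by duality. For a test function `ψ` near `x₀`, `segInt R d ψ * χ` is again a test
function on `Ω`: from points of `V` one may move in direction `d` without leaving `V`, and inside
the ball `V` is `Ω`. Its derivative along `d` contains `ψ * χ`, so the definition of the weak
derivative gives the identity tested with `ψ`. -/
theorem ae_eq_line_integral {V : Set E3} {x₀ d : E3} {r R : ℝ} (hΩ : IsOpen Ω)
    (hV : ∀ x ∈ Metric.ball x₀ r, x ∈ Ω ↔ x ∈ V)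
    (hd : ∀ x ∈ V, ∀ s : ℝ, 0 ≤ s → x + s • d ∈ V) (hR : 0 ≤ R) (hRr : 2 * r ≤ R * ‖d‖)
    {χ : E3 → ℝ} (hχ : IsTest (Metric.ball x₀ r) χ) {f f' : E3 → ℝ} (hf : HasWeakDeriv Ω d f f')
    (hfi : IntegrableOn f Ω) (hfi' : IntegrableOn f' Ω) :
    ∀ᵐ x, x ∈ Ω ∩ Metric.ball x₀ r → χ x * f x = - ∫ s in Set.Ioc 0 R,
      Ω.indicator (fun x => fderiv ℝ χ x d * f x + χ x * f' x) (x + s • d) := by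
  set W := Ω.indicator (fun x => fderiv ℝ χ x d * f x + χ x * f' x) with hW
  obtain ⟨B, hB⟩ := hχ.compact.exists_bound_of_continuous hχ.continuous
  obtain ⟨B', hB'⟩ := (hχ.compact_fderiv d).exists_bound_of_continuous (hχ.continuous_fderiv d)
  have i1 : IntegrableOn (fun x => χ x * f x) Ω :=
    hfi.bdd_mul (c := B) hχ.continuous.aestronglyMeasurable (Eventually.of_forall fun x => hB x)
  have iW0 : IntegrableOn (fun x => fderiv ℝ χ x d * f x + χ x * f' x) Ω :=
    (hfi.bdd_mul (c := B') (hχ.continuous_fderiv d).aestronglyMeasurable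
      (Eventually.of_forall fun x => hB' x)).add
    (hfi'.bdd_mul (c := B) hχ.continuous.aestronglyMeasurable (Eventually.of_forall fun x => hB x))
  have iW : Integrable W := (integrable_indicator_iff hΩ.measurableSet).2 iW0
  have iS : Integrable (fun x => ∫ s in Set.Ioc 0 R, W (x + s • d)) :=
    (integral_segInt_mul R d (ψ := fun _ => 0) continuous_const .zero iW).1
  set U := Ω ∩ Metric.ball x₀ r with hU
  have hUo : IsOpen U := hΩ.inter Metric.isOpen_ball
  have key := hUo.ae_eq_zero_of_integral_contDiff_smul_eq_zero
    (f := fun x => χ x * f x + ∫ s in Set.Ioc 0 R, W (x + s • d))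
    ((i1.locallyIntegrableOn.mono_set Set.inter_subset_left).add
      (iS.locallyIntegrable.locallyIntegrableOn _)) (fun ψ h1 h2 h3 => ?_)
  · filter_upwards [key] with x hx hxU
    linarith [hx hxU]
  have hψ : IsTest U ψ := ⟨h1, h2, h3⟩
  have hψΩ : IsTest Ω ψ := hψ.mono Set.inter_subset_left
  -- the test function is the segment integral, cut off
  have hsm := contDiff_segInt R d h1 h2
  have hsupp : ∀ x, x ∈ Metric.ball x₀ r → segInt R d ψ x ≠ 0 → x ∈ V := by
    intro x hx hne
    by_contra hxV
    refine hne ?_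
    have : ∀ s ∈ Set.Ioc 0 R, ψ (x - s • d) = 0 := by
      intro s hs
      by_contra h0
      have hmem := h3 (subset_tsupport ψ h0)
      have := hd _ ((hV _ hmem.2).1 hmem.1) s hs.1.le
      simp only [sub_add_cancel] at this
      exact hxV this
    rw [segInt, setIntegral_congr_fun measurableSet_Ioc this]
    simp
  have htest : IsTest Ω (fun x => segInt R d ψ x * χ x) := by
    refine ⟨hsm.mul hχ.smooth, hχ.compact.mul_left, ?_⟩
    -- the support of the segment integral lies in a compact translate hull of the support
    set T := (fun p : E3 × ℝ => p.1 + p.2 • d) '' (tsupport ψ ×ˢ Set.Icc 0 R) with hT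
    have hTc : IsCompact T := (h2.isCompact.prod isCompact_Icc).image (by fun_prop)
    have hsub : tsupport (fun x => segInt R d ψ x * χ x) ⊆ T ∩ tsupport χ := by
      refine closure_minimal ?_ (hTc.isClosed.inter (isClosed_tsupport χ))
      intro x hx
      have hx1 : segInt R d ψ x ≠ 0 := left_ne_zero_of_mul hx
      have hx2 : χ x ≠ 0 := right_ne_zero_of_mul hx
      refine ⟨?_, subset_tsupport χ hx2⟩
      by_contra hxT
      refine hx1 ?_
      have : ∀ s ∈ Set.Ioc 0 R, ψ (x - s • d) = 0 := by
        intro s hs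
        by_contra h0
        exact hxT ⟨(x - s • d, s), ⟨subset_tsupport ψ h0, hs.1.le, hs.2⟩, by simp⟩
      rw [segInt, setIntegral_congr_fun measurableSet_Ioc this]
      simp
    rintro x hx
    obtain ⟨⟨⟨y, s⟩, ⟨hy, hs⟩, rfl⟩, hxχ⟩ := hsub hx
    have hyU := h3 hy
    exact (hV _ (hχ.subset hxχ)).2 (hd _ ((hV _ hyU.2).1 hyU.1) s hs.1)
  -- The segment is at least as long as the diameter of the ball, so its two ends cannot both lie in
  -- the open ball.
  have hfar : ∀ x, ψ (x - R • d) * χ x = 0 := by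
    intro x
    by_contra h0
    have a1 := (h3 (subset_tsupport ψ (left_ne_zero_of_mul h0))).2
    have a2 := hχ.subset (subset_tsupport χ (right_ne_zero_of_mul h0))
    rw [Metric.mem_ball, dist_eq_norm] at a1 a2
    have : ‖R • d‖ < 2 * r := by
      have e : R • d = (x - x₀) - (x - R • d - x₀) := by abel
      rw [e]
      refine (norm_sub_le _ _).trans_lt ?_
      linarith
    rw [norm_smul, Real.norm_of_nonneg hR] at this
    linarith
  have hfd : ∀ x, fderiv ℝ (fun x => segInt R d ψ x * χ x) x d
      = segInt R d ψ x * fderiv ℝ χ x d + ψ x * χ x := by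
    intro x
    have e := (hsm.differentiable (by simp) x).hasFDerivAt.mul (hχ.differentiable x).hasFDerivAt
    rw [show (fun x => segInt R d ψ x * χ x) = segInt R d ψ * χ from rfl, e.fderiv]
    simp only [add_apply, smul_apply, smul_eq_mul,
      fderiv_segInt hR d h1 h2]
    have := hfar x
    linear_combination (-this)
  have hw := hf.eq _ htest
  simp_rw [hfd, smul_eq_mul] at hw
  have hchi : LocallyIntegrableOn (fun x => χ x * f x) Ω := i1.locallyIntegrableOn
  obtain ⟨Bs, hBs⟩ : ∃ Bs, ∀ x, ‖segInt R d ψ x‖ ≤ Bs := by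
    obtain ⟨Bψ, hBψ⟩ := h2.exists_bound_of_continuous h1.continuous
    refine ⟨Bψ * (volume.real (Set.Ioc 0 R)), fun x => ?_⟩
    exact norm_setIntegral_le_of_norm_le_const measure_Ioc_lt_top fun s _ => hBψ _
  have j1 : IntegrableOn (fun x => segInt R d ψ x * (fderiv ℝ χ x d * f x)) Ω :=
    (hfi.bdd_mul (c := B') (hχ.continuous_fderiv d).aestronglyMeasurable
      (Eventually.of_forall fun x => hB' x)).bdd_mul (c := Bs) hsm.continuous.aestronglyMeasurable
      (Eventually.of_forall hBs)
  have j2 : IntegrableOn (fun x => ψ x * (χ x * f x)) Ω := (hψΩ.integrable_smul hchi).integrableOn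
  have j3 : IntegrableOn (fun x => segInt R d ψ x * (χ x * f' x)) Ω :=
    (hfi'.bdd_mul (c := B) hχ.continuous.aestronglyMeasurable
      (Eventually.of_forall fun x => hB x)).bdd_mul (c := Bs) hsm.continuous.aestronglyMeasurable
      (Eventually.of_forall hBs)
  have e1 : ∫ x in Ω, (segInt R d ψ x * fderiv ℝ χ x d + ψ x * χ x) * f x
      = (∫ x in Ω, segInt R d ψ x * (fderiv ℝ χ x d * f x)) + ∫ x in Ω, ψ x * (χ x * f x) := by
    rw [← integral_add j1 j2]
    exact integral_congr_ae (Eventually.of_forall fun x => by simp only; ring)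
  have e2 : ∫ x, segInt R d ψ x * W x
      = (∫ x in Ω, segInt R d ψ x * (fderiv ℝ χ x d * f x))
        + ∫ x in Ω, segInt R d ψ x * χ x * f' x := by
    have e3 : (fun x => segInt R d ψ x * W x) = Ω.indicator
        (fun x => segInt R d ψ x * (fderiv ℝ χ x d * f x + χ x * f' x)) := by
      funext x
      by_cases hx : x ∈ Ω <;> simp [hW, hx]
    rw [e3, integral_indicator hΩ.measurableSet]
    have j3' : IntegrableOn (fun x => segInt R d ψ x * χ x * f' x) Ω := by
      simpa only [mul_assoc] using j3
    rw [← integral_add j1 j3']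
    exact integral_congr_ae (Eventually.of_forall fun x => by simp only; ring)
  have e4 := (integral_segInt_mul R d h1.continuous h2 iW).2
  have e5 : ∫ x in Ω, ψ x * (χ x * f x) = ∫ x, ψ x * (χ x * f x) :=
    setIntegral_smul_of_tsupport_subset hψΩ.subset
  have j4 : Integrable (fun x => ψ x * (χ x * f x)) := hψΩ.integrable_smul hchi
  have j5 : Integrable (fun x => ψ x * ∫ s in Set.Ioc 0 R, W (x + s • d)) :=
    hψΩ.integrable_smul (iS.locallyIntegrable.locallyIntegrableOn _)
  simp_rw [smul_eq_mul, mul_add]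
  rw [integral_add j4 j5]
  linarith

/-- The line bound in the shape the Gagliardo-Nirenberg argument needs: extended by zero to the
whole space, and with the integral taken over the entire line so that the length of the ray
disappears. -/
theorem enorm_le_line_lintegral {V : Set E3} {x₀ d : E3} {r : ℝ} (hΩ : IsOpen Ω)
    (hV : ∀ x ∈ Metric.ball x₀ r, x ∈ Ω ↔ x ∈ V) (hd0 : d ≠ 0)
    (hd : ∀ x ∈ V, ∀ s : ℝ, 0 ≤ s → x + s • d ∈ V)
    {χ : E3 → ℝ} (hχ : IsTest (Metric.ball x₀ r) χ) {f f' : E3 → ℝ} (hf : HasWeakDeriv Ω d f f')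
    (hfi : IntegrableOn f Ω) (hfi' : IntegrableOn f' Ω) :
    ∀ᵐ x, ‖Ω.indicator (fun x => χ x * f x) x‖ₑ ≤ ∫⁻ s : ℝ,
      ‖Ω.indicator (fun x => fderiv ℝ χ x d * f x + χ x * f' x) (x + s • d)‖ₑ := by
  have hd' : 0 < ‖d‖ := norm_pos_iff.2 hd0
  filter_upwards [ae_eq_line_integral (R := 2 * |r| / ‖d‖) hΩ hV hd (by positivity)
    (by rw [div_mul_cancel₀ _ hd'.ne']; linarith [le_abs_self r]) hχ hf hfi hfi'] with x hx
  by_cases hxΩ : x ∈ Ω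
  · rw [Set.indicator_of_mem hxΩ]
    by_cases hxB : x ∈ Metric.ball x₀ r
    · rw [hx ⟨hxΩ, hxB⟩, enorm_neg]
      exact (enorm_integral_le_lintegral_enorm _).trans (setLIntegral_le_lintegral _ _)
    · have : χ x = 0 := by
        by_contra h
        exact hxB (hχ.subset (subset_tsupport χ h))
      simp [this]
  · simp [hxΩ]

end Mixture

end

set_option linter.unusedSectionVars false

noncomputable section

namespace Mixture

open MeasureTheory Filter Topology
open scoped ENNReal

variable {Ω : Set E3}

/-! ### The embedding of `W^{1,1}` into `L^{3/2}` on Lipschitz domains -/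

/-- Line integrals of `H` see null sets, so domination is wanted at every point. Adding `⊤` on a
measurable null set to a measurable representative achieves this without changing the integral. -/
theorem exists_measurable_majorant {H : E3 → ℝ≥0∞} (hH : AEMeasurable H) :
    ∃ H' : E3 → ℝ≥0∞, Measurable H' ∧ (∀ x, H x ≤ H' x) ∧ ∫⁻ x, H' x = ∫⁻ x, H x := by
  set N := toMeasurable volume {x | H x ≠ hH.mk H x} with hN
  have hN0 : volume N = 0 := by
    rw [hN, measure_toMeasurable]
    exact hH.ae_eq_mk
  have hNm : MeasurableSet N := measurableSet_toMeasurable _ _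
  refine ⟨fun x => hH.mk H x + N.indicator (fun _ => ⊤) x,
    hH.measurable_mk.add (measurable_const.indicator hNm), fun x => ?_, ?_⟩
  · by_cases hx : x ∈ N
    · simp [hx]
    · have : H x = hH.mk H x := by
        by_contra h
        exact hx (subset_toMeasurable _ _ h)
      rw [this]
      exact le_self_add
  · refine lintegral_congr_ae ?_
    filter_upwards [hH.ae_eq_mk, compl_mem_ae_iff.2 hN0] with x hx hx'
    simp [Set.indicator_of_notMem (show x ∉ N from hx'), hx]

/-- The Gagliardo-Nirenberg argument, along the directions of a basis. -/
theorem lintegral_rpow_lt_top_of_line_bounds (b : Module.Basis (Fin 3) ℝ E3) {A H : E3 → ℝ≥0∞}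
    (hH : AEMeasurable H) (hHi : ∫⁻ x, H x < ⊤)
    (hA : ∀ i, ∀ᵐ x, A x ≤ ∫⁻ s : ℝ, H (x + s • b i)) :
    ∫⁻ x, A x ^ (3 / 2 : ℝ) < ⊤ := by
  obtain ⟨H', hm, hle, hint⟩ := exists_measurable_majorant hH
  rw [← hint] at hHi
  have hA' : ∀ i, ∀ᵐ x, A x ≤ ∫⁻ s : ℝ, H' (x + s • b i) := fun i =>
    (hA i).mono fun x hx => hx.trans (lintegral_mono fun s => hle _)
  -- In the coordinates of `b` the given directions become the coordinate axes. Lebesgue measure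
  -- changes only by a constant factor, which does not affect finiteness.
  set e : E3 ≃L[ℝ] (Fin 3 → ℝ) := b.equivFunL with he
  set L : (Fin 3 → ℝ) ≃L[ℝ] E3 := e.symm with hL
  set μ' : Measure E3 := (volume : Measure (Fin 3 → ℝ)).map L with hμ'
  have hLe : MeasurableEmbedding L := L.toHomeomorph.measurableEmbedding
  have : μ'.IsAddHaarMeasure := L.isAddHaarMeasure_map volume
  have hLapp : ∀ y i s, L (Function.update y i (y i + s)) = L y + s • b i := by
    intro y i s
    have hu : Function.update y i (y i + s) = y + s • (Pi.single i 1 : Fin 3 → ℝ) := by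
      funext j
      by_cases h : j = i
      · subst h; simp
      · simp [h]
    have hb : L (Pi.single i 1) = b i := by
      change b.equivFun.symm (Pi.single i 1) = b i
      simp [Module.Basis.equivFun_symm_apply, Pi.single_apply]
    rw [hu, map_add, map_smul, hb]
  have hac : μ' ≪ volume := Measure.absolutelyContinuous_isAddHaarMeasure _ _
  have hAy : ∀ i, ∀ᵐ y, A (L y) ≤ ∫⁻ s : ℝ, H' (L (Function.update y i s)) := by
    intro i
    have h1 : ∀ᵐ x ∂μ', A x ≤ ∫⁻ s : ℝ, H' (x + s • b i) := hac.ae_le (hA' i)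
    filter_upwards [hLe.ae_map_iff.1 h1] with y hy
    refine hy.trans_eq ?_
    rw [← lintegral_add_left_eq_self (fun s => H' (L (Function.update y i s))) (y i)]
    exact lintegral_congr fun s => by rw [hLapp]
  have hmL : Measurable fun y => H' (L y) := hm.comp L.continuous.measurable
  have key : ∫⁻ y, A (L y) ^ (3 / 2 : ℝ) ≤ (∫⁻ y, H' (L y)) ^ (3 / 2 : ℝ) := by
    -- The exponent 3/2 is conjugate to the dimension 3. Each of the three axes bounds one factor `A
    -- ^ (1 / 2)` of `A ^ (3 / 2)`.
    have hconj : Real.HolderConjugate (Fintype.card (Fin 3)) (3 / 2 : ℝ) := by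
      rw [Real.holderConjugate_iff]
      norm_num
    refine le_trans (lintegral_mono_ae ?_)
      (lintegral_prod_lintegral_pow_le (fun _ : Fin 3 => (volume : Measure ℝ)) hconj hmL)
    filter_upwards [ae_all_iff.2 hAy] with y hy
    have e1 : A (L y) ^ (3 / 2 : ℝ) = ∏ _i : Fin 3, A (L y) ^ ((1 : ℝ) / 2) := by
      rw [Finset.prod_const, Finset.card_univ, Fintype.card_fin, ← ENNReal.rpow_natCast,
        ← ENNReal.rpow_mul]
      norm_num
    rw [e1]
    refine Finset.prod_le_prod' fun i _ => ?_
    norm_num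
    exact ENNReal.rpow_le_rpow (hy i) (by norm_num)
  have hfin : ∫⁻ y, H' (L y) < ⊤ := by
    rw [← hLe.lintegral_map (f := H'), ← hμ', Measure.isAddLeftInvariant_eq_smul μ' volume,
      lintegral_smul_measure]
    exact ENNReal.mul_lt_top ENNReal.coe_lt_top hHi
  have hfin2 : ∫⁻ x, A x ^ (3 / 2 : ℝ) ∂μ' < ⊤ := by
    rw [hμ', hLe.lintegral_map]
    exact key.trans_lt (ENNReal.rpow_lt_top_of_nonneg (by norm_num) hfin.ne)
  rw [Measure.isAddLeftInvariant_eq_smul (volume : Measure E3) μ', lintegral_smul_measure]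
  exact ENNReal.mul_lt_top ENNReal.coe_lt_top hfin2

/-- Weak directional derivatives from the weak gradient. -/
theorem IsWeakGradient.hasWeakDeriv_dir {f : E3 → ℝ} {G : E3 → E3} (h : IsWeakGradient Ω f G)
    (d : E3) : HasWeakDeriv Ω d f (fun x => ∑ i, d i * G x i) := by
  have e : d = ∑ i, d i • basisVec i := by
    ext j
    simp [basisVec, Finset.sum_apply, Pi.single_apply]
  have := HasWeakDeriv.sum_dir Finset.univ h.1
    (fun i _ => (h.hasWeakDeriv i).smul_dir (d i))
  rw [← e] at this
  simpa using this

/-- The cutoff equals one on the ball of half the radius, so a bound for `χ f` is a bound for `f`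
there. One integrable function has to dominate along all three directions; the sum of the
directional derivatives `W i` does. -/
theorem lintegral_rpow_lt_top_of_cone (hΩ : IsOpen Ω) (b : Module.Basis (Fin 3) ℝ E3)
    {V : Set E3} {x₀ : E3} {r : ℝ} (hr : 0 < r) (hV : ∀ x ∈ Metric.ball x₀ r, x ∈ Ω ↔ x ∈ V)
    (hd : ∀ i, ∀ x ∈ V, ∀ s : ℝ, 0 ≤ s → x + s • b i ∈ V) {f : E3 → ℝ} {G : E3 → E3}
    (h : IsWeakGradient Ω f G) (hf : IntegrableOn f Ω) (hG : IntegrableOn G Ω) :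
    ∫⁻ x in Ω ∩ Metric.ball x₀ (r / 2), ‖f x‖ₑ ^ (3 / 2 : ℝ) < ⊤ := by
  let χ : ContDiffBump x₀ := ⟨r / 2, 3 * r / 4, by positivity, by linarith⟩
  have hχ : IsTest (Metric.ball x₀ r) χ :=
    ⟨χ.contDiff, χ.hasCompactSupport, by
      rw [χ.tsupport_eq]
      exact Metric.closedBall_subset_ball (by simp only [χ]; linarith)⟩
  have hGi : ∀ i, IntegrableOn (fun x => G x i) Ω := fun i =>
    (EuclideanSpace.proj (𝕜 := ℝ) i).integrable_comp hG
  set W : Fin 3 → E3 → ℝ := fun i => Ω.indicator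
    (fun x => fderiv ℝ χ x (b i) * f x + χ x * ∑ j, b i j * G x j) with hW
  have hGd : ∀ i, IntegrableOn (fun x => ∑ j, b i j * G x j) Ω := fun i =>
    integrable_finsetSum _ fun j _ => (hGi j).const_mul _
  have hWi : ∀ i, Integrable (W i) := by
    intro i
    obtain ⟨B, hB⟩ := hχ.compact.exists_bound_of_continuous hχ.continuous
    obtain ⟨B', hB'⟩ := (hχ.compact_fderiv (b i)).exists_bound_of_continuous
      (hχ.continuous_fderiv (b i))
    refine (integrable_indicator_iff hΩ.measurableSet).2 ?_
    exact (hf.bdd_mul (c := B') (hχ.continuous_fderiv _).aestronglyMeasurable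
      (Eventually.of_forall fun x => hB' x)).add
      ((hGd i).bdd_mul (c := B) hχ.continuous.aestronglyMeasurable
      (Eventually.of_forall fun x => hB x))
  have key := lintegral_rpow_lt_top_of_line_bounds b
    (A := fun x => ‖Ω.indicator (fun x => χ x * f x) x‖ₑ) (H := fun x => ∑ i, ‖W i x‖ₑ)
    (Finset.aemeasurable_fun_sum _ fun i _ => (hWi i).aestronglyMeasurable.enorm)
    (by
      rw [lintegral_finsetSum' _ fun i _ => (hWi i).aestronglyMeasurable.enorm]
      exact ENNReal.sum_lt_top.2 fun i _ => (hWi i).2)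
    (fun i => by
      filter_upwards [enorm_le_line_lintegral hΩ hV (b.ne_zero i) (hd i) hχ
        (h.hasWeakDeriv_dir (b i)) hf (hGd i)] with x hx
      exact hx.trans (lintegral_mono fun s =>
        Finset.single_le_sum (f := fun j => ‖W j (x + s • b i)‖ₑ) (fun _ _ => zero_le)
          (Finset.mem_univ i)))
  refine lt_of_le_of_lt ?_ key
  have hm : MeasurableSet (Ω ∩ Metric.ball x₀ (r / 2)) :=
    hΩ.measurableSet.inter measurableSet_ball
  rw [← lintegral_indicator hm]
  refine lintegral_mono fun x => ?_
  by_cases hx : x ∈ Ω ∩ Metric.ball x₀ (r / 2)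
  · have h1 : χ x = 1 := χ.one_of_mem_closedBall (Metric.ball_subset_closedBall hx.2)
    simp [hx, hx.1, h1]
  · simp [hx]

/-- Above the graph of a `K`-Lipschitz function one may move in any direction of a sufficiently
narrow vertical cone. With horizontal tilt `ε = 1 / (K + 1)` and unit vertical speed, the graph
rises by at most `K ε ≤ 1` per unit of height gained. Two tilted vectors and the vertical one form a
basis. -/
theorem exists_basis_of_frontier {V : Set E3} (R : E3 ≃ₗᵢ[ℝ] E3)
    (g : EuclideanSpace ℝ (Fin 2) → ℝ) (K : NNReal) (hg : LipschitzWith K g)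
    (hV : V = {x | g !₂[R x 0, R x 1] < R x 2}) :
    ∃ b : Module.Basis (Fin 3) ℝ E3, ∀ i, ∀ x ∈ V, ∀ s : ℝ, 0 ≤ s → x + s • b i ∈ V := by
  set ε : ℝ := 1 / (K + 1) with hε
  have hK0 : (0 : ℝ) ≤ K := K.2
  have hεp : 0 < ε := by positivity
  have hKε : K * ε ≤ 1 := by
    rw [hε, mul_one_div, div_le_one (by positivity)]
    linarith
  let u : Fin 3 → E3 := ![!₂[ε, 0, 1], !₂[0, ε, 1], !₂[0, 0, 1]]
  have hu : LinearIndependent ℝ u := by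
    rw [Fintype.linearIndependent_iff]
    intro c hc
    have h0 := congrArg (fun w : E3 => w 0) hc
    have h1 := congrArg (fun w : E3 => w 1) hc
    have h2 := congrArg (fun w : E3 => w 2) hc
    simp [Fin.sum_univ_three, u, hεp.ne'] at h0 h1 h2
    intro i
    fin_cases i
    · exact h0
    · exact h1
    · simpa [h0, h1] using h2
  have hcard : Fintype.card (Fin 3) = Module.finrank ℝ E3 := by simp
  let b0 := basisOfLinearIndependentOfCardEqFinrank hu hcard
  let b := b0.map R.symm.toLinearEquiv
  have hb : ∀ i, R (b i) = u i := by
    intro i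
    simp [b, b0]
  refine ⟨b, fun i x hx s hs => ?_⟩
  rw [hV] at hx ⊢
  simp only [Set.mem_ofPred_eq] at hx ⊢
  have hRx : R (x + s • b i) = R x + s • u i := by rw [map_add, map_smul, hb]
  rw [hRx]
  have h2 : u i 2 = 1 := by fin_cases i <;> simp [u]
  have hn : ‖(!₂[u i 0, u i 1] : EuclideanSpace ℝ (Fin 2))‖ ≤ ε := by
    rw [EuclideanSpace.norm_eq, Fin.sum_univ_two]
    fin_cases i <;> simp [u, abs_of_pos hεp, hεp.le]
  have hsplit : (!₂[(R x + s • u i) 0, (R x + s • u i) 1] : EuclideanSpace ℝ (Fin 2))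
      = !₂[R x 0, R x 1] + s • !₂[u i 0, u i 1] := by
    ext j
    fin_cases j <;> simp
  have hl := hg.dist_le_mul (!₂[R x 0, R x 1] + s • !₂[u i 0, u i 1]) !₂[R x 0, R x 1]
  rw [dist_eq_norm, dist_eq_norm, add_sub_cancel_left, norm_smul, Real.norm_of_nonneg hs] at hl
  have hl' := (le_abs_self _).trans hl
  rw [hsplit]
  simp only [PiLp.add_apply, PiLp.smul_apply, h2, smul_eq_mul, mul_one]
  have h3 : K * (s * ‖(!₂[u i 0, u i 1] : EuclideanSpace ℝ (Fin 2))‖) ≤ s := by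
    calc K * (s * ‖(!₂[u i 0, u i 1] : EuclideanSpace ℝ (Fin 2))‖)
        ≤ K * (s * ε) := by gcongr
      _ = s * (K * ε) := by ring
      _ ≤ s * 1 := by gcongr
      _ = s := mul_one s
  linarith

/-- Sobolev embedding: an integrable function with integrable weak gradient on a bounded Lipschitz
domain is in `L^{3/2}`. -/
theorem memLp_three_half (hΩ : IsBoundedLipschitzDomain Ω) {f : E3 → ℝ} {G : E3 → E3}
    (h : IsWeakGradient Ω f G) (hf : IntegrableOn f Ω) (hG : IntegrableOn G Ω) :
    MemLp f (ENNReal.ofReal (3 / 2)) (volume.restrict Ω) := by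
  obtain ⟨ho, -, hb, hfr⟩ := hΩ
  refine ⟨hf.aestronglyMeasurable, ?_⟩
  have hlocal : ∀ x ∈ closure Ω, ∃ U ∈ 𝓝[closure Ω] x,
      ∫⁻ y in Ω ∩ U, ‖f y‖ₑ ^ (3 / 2 : ℝ) < ⊤ := by
    intro x hx
    by_cases hxΩ : x ∈ Ω
    · obtain ⟨r, hr, hball⟩ := Metric.isOpen_iff.1 ho x hxΩ
      refine ⟨Metric.ball x (r / 2), mem_nhdsWithin_of_mem_nhds
        (Metric.ball_mem_nhds _ (by positivity)), ?_⟩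
      -- Around an interior point no cone is needed: on a ball inside `Ω` the set `V` can be the
      -- whole space.
      exact lintegral_rpow_lt_top_of_cone ho (EuclideanSpace.basisFun (Fin 3) ℝ).toBasis
        (V := Set.univ) hr (fun y hy => iff_of_true (hball hy) trivial) (fun _ _ _ _ _ => trivial)
        h hf hG
    · have hxf : x ∈ frontier Ω := by
        rw [frontier, ho.interior_eq]
        exact ⟨hx, hxΩ⟩
      obtain ⟨R, g, K, hgK, r, hr, hball⟩ := hfr x hxf
      obtain ⟨b, hb⟩ := exists_basis_of_frontier R g K hgK rfl
      refine ⟨Metric.ball x (r / 2), mem_nhdsWithin_of_mem_nhds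
        (Metric.ball_mem_nhds _ (by positivity)), ?_⟩
      exact lintegral_rpow_lt_top_of_cone ho b hr hball hb h hf hG
  have hc : IsCompact (closure Ω) := hb.isCompact_closure
  have hfin : ∫⁻ y in Ω ∩ closure Ω, ‖f y‖ₑ ^ (3 / 2 : ℝ) < ⊤ := by
    refine hc.induction_on (p := fun s => ∫⁻ y in Ω ∩ s, ‖f y‖ₑ ^ (3 / 2 : ℝ) < ⊤) ?_ ?_ ?_ hlocal
    · simp
    · intro s t hst ht
      exact (lintegral_mono_set (Set.inter_subset_inter_right _ hst)).trans_lt ht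
    · intro s t hs ht
      rw [Set.inter_union_distrib_left]
      exact (lintegral_union_le _ _ _).trans_lt (ENNReal.add_lt_top.2 ⟨hs, ht⟩)
  rw [Set.inter_eq_left.2 subset_closure] at hfin
  have hp0 : ENNReal.ofReal (3 / 2) ≠ 0 := by
    simp
  rw [eLpNorm_lt_top_iff_lintegral_rpow_enorm_lt_top hp0 ENNReal.ofReal_ne_top,
    ENNReal.toReal_ofReal (by norm_num)]
  exact hfin

end Mixture

end

set_option linter.unusedSectionVars false

noncomputable section

namespace Mixture

open MeasureTheory Filter Topology
open scoped ENNReal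

variable {Ω : Set E3} {F : Type*} [NormedAddCommGroup F]

/-! ### Hölder classes, indexed by the reciprocal exponent -/

/-- `f ∈ L^q(Ω)` whenever `1 / q > s`. -/
def LpBelow (Ω : Set E3) (s : ℝ) (f : E3 → F) : Prop :=
  ∀ θ : ℝ, s < θ → MemLp f (ENNReal.ofReal θ)⁻¹ (volume.restrict Ω)

theorem isFiniteMeasure_of_isBounded (h : Bornology.IsBounded Ω) :
    IsFiniteMeasure (volume.restrict Ω) :=
  ⟨by rw [Measure.restrict_apply_univ]; exact h.measure_lt_top⟩

theorem memLp_inv_iff {f : E3 → F} {q : ℝ} (hq : 0 < q) {μ : Measure E3} :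
    MemLp f (ENNReal.ofReal (1 / q))⁻¹ μ ↔ MemLp f (ENNReal.ofReal q) μ := by
  rw [one_div, ENNReal.ofReal_inv_of_pos hq, inv_inv]

namespace LpBelow

variable {s t : ℝ} {f g : E3 → F}

theorem mono (h : LpBelow Ω s f) (hst : s ≤ t) : LpBelow Ω t f :=
  fun θ hθ => h θ (hst.trans_lt hθ)

theorem congr (h : LpBelow Ω s f) (hfg : f =ᵐ[volume.restrict Ω] g) : LpBelow Ω s g :=
  fun θ hθ => (memLp_congr_ae hfg).1 (h θ hθ)

theorem add (h : LpBelow Ω s f) (hg : LpBelow Ω s g) : LpBelow Ω s (fun x => f x + g x) :=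
  fun θ hθ => (h θ hθ).add (hg θ hθ)

theorem sub (h : LpBelow Ω s f) (hg : LpBelow Ω s g) : LpBelow Ω s (fun x => f x - g x) :=
  fun θ hθ => (h θ hθ).sub (hg θ hθ)

theorem neg (h : LpBelow Ω s f) : LpBelow Ω s (fun x => - f x) :=
  fun θ hθ => (h θ hθ).neg

theorem sum {ι : Type*} (u : Finset ι) {f : ι → E3 → F} (h : ∀ i ∈ u, LpBelow Ω s (f i)) :
    LpBelow Ω s (fun x => ∑ i ∈ u, f i x) :=
  fun θ hθ => memLp_finsetSum u fun i hi => h i hi θ hθ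

theorem of_memLp [IsFiniteMeasure (volume.restrict Ω)] {q : ℝ} (hq : 0 < q)
    (h : MemLp f (ENNReal.ofReal q) (volume.restrict Ω)) : LpBelow Ω (1 / q) f := by
  intro θ hθ
  rw [← memLp_inv_iff hq] at h
  exact h.mono_exponent (ENNReal.inv_le_inv.2 (ENNReal.ofReal_le_ofReal hθ.le))

theorem memLp (h : LpBelow Ω s f) {q : ℝ} (hq : 0 < q) (hs : s < 1 / q) :
    MemLp f (ENNReal.ofReal q) (volume.restrict Ω) := (memLp_inv_iff hq).1 (h _ hs)

theorem integrable (h : LpBelow Ω s f) (hs : s < 1) : IntegrableOn f Ω := by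
  have := h.memLp one_pos (by simpa using hs)
  rwa [ENNReal.ofReal_one, memLp_one_iff_integrable] at this

theorem const [IsFiniteMeasure (volume.restrict Ω)] (c : F) : LpBelow Ω s (fun _ => c) :=
  fun _ _ => memLp_const c

theorem const_mul {f : E3 → ℝ} (h : LpBelow Ω s f) (c : ℝ) : LpBelow Ω s (fun x => c * f x) :=
  fun θ hθ => (h θ hθ).const_mul c

/-- The index is a reciprocal exponent, so Hölder's inequality adds indices. The slack `θ - s - t`
is shared equally between the factors. -/
theorem mul {f g : E3 → ℝ} (hs : 0 ≤ s) (ht : 0 ≤ t) (h : LpBelow Ω s f) (hg : LpBelow Ω t g) :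
    LpBelow Ω (s + t) (fun x => f x * g x) := by
  intro θ hθ
  set δ := (θ - s - t) / 2 with hδ
  have hδ0 : 0 < δ := by rw [hδ]; linarith
  have h1 := h (s + δ) (by linarith)
  have h2 := hg (t + δ) (by linarith)
  have : ENNReal.HolderTriple (ENNReal.ofReal (s + δ))⁻¹ (ENNReal.ofReal (t + δ))⁻¹
      (ENNReal.ofReal θ)⁻¹ := by
    constructor
    rw [inv_inv, inv_inv, inv_inv, ← ENNReal.ofReal_add (by positivity) (by positivity)]
    congr 1
    rw [hδ]
    ring
  exact h2.mul h1

end LpBelow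

theorem memLp_of_coord {p : ℝ≥0∞} {μ : Measure E3} {G : E3 → E3}
    (h : ∀ i, MemLp (fun x => G x i) p μ) : MemLp G p μ := by
  have e : G = fun x => ∑ i, G x i • basisVec i := by
    funext x
    ext j
    simp [basisVec, Finset.sum_apply, Pi.single_apply]
  rw [e]
  exact memLp_finsetSum _ fun i _ => by
    have h1 : MemLp (fun x => ‖G x i • basisVec i‖) p μ := by
      simpa [norm_smul] using (h i).norm
    exact (memLp_norm_iff ((h i).1.smul_const _)).1 h1

theorem memLp_coord {p : ℝ≥0∞} {μ : Measure E3} {G : E3 → E3} (h : MemLp G p μ) (i : Fin 3) :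
    MemLp (fun x => G x i) p μ :=
  (EuclideanSpace.proj (𝕜 := ℝ) i : E3 →L[ℝ] ℝ).comp_memLp' h

theorem memLp_rpow_iff {μ : Measure E3} {f : E3 → ℝ} (hf : AEStronglyMeasurable f μ) {γ θ : ℝ}
    (hγ : 0 < γ) :
    MemLp (fun x => |f x| ^ γ) (ENNReal.ofReal (γ * θ))⁻¹ μ ↔
      MemLp f (ENNReal.ofReal θ)⁻¹ μ := by
  have h := memLp_norm_rpow_iff (p := (ENNReal.ofReal θ)⁻¹) (q := ENNReal.ofReal γ) hf
    (by simpa using hγ) ENNReal.ofReal_ne_top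
  rw [ENNReal.toReal_ofReal hγ.le] at h
  rw [← h]
  have e : (ENNReal.ofReal (γ * θ))⁻¹ = (ENNReal.ofReal θ)⁻¹ / ENNReal.ofReal γ := by
    rw [ENNReal.ofReal_mul hγ.le, ENNReal.mul_inv (Or.inr ENNReal.ofReal_ne_top)
      (Or.inl ENNReal.ofReal_ne_top), mul_comm, div_eq_mul_inv]
  rw [e]
  rfl

/-! ### Powers of Sobolev functions -/

/-- The bracket `(1 + a ^ 2) ^ (1 / 2)` stands in for `|a|`: it has the same integrability on a
bounded domain, and all its powers are smooth. -/
theorem hasDerivAt_bracket_trunc (γ : ℝ) (k : ℕ) (a : ℝ) :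
    HasDerivAt (fun a => (1 + trunc k a ^ 2) ^ (γ / 2))
      (γ * trunc k a * truncD k a * (1 + trunc k a ^ 2) ^ (γ / 2 - 1)) a := by
  have h1 : HasDerivAt (fun a => 1 + trunc k a ^ 2) (2 * trunc k a * truncD k a) a := by
    simpa using ((hasDerivAt_trunc k a).pow 2).const_add 1
  have h2 := h1.rpow_const (p := γ / 2) (Or.inl (by positivity))
  convert! h2 using 1
  ring

theorem bracket_deriv_le {γ : ℝ} (hγ : 1 ≤ γ) (k : ℕ) (a : ℝ) :
    |γ * trunc k a * truncD k a * (1 + trunc k a ^ 2) ^ (γ / 2 - 1)|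
      ≤ γ * (1 + trunc k a ^ 2) ^ ((γ - 1) / 2) := by
  have hp : 0 < 1 + trunc k a ^ 2 := by positivity
  have h1 : |trunc k a| ≤ (1 + trunc k a ^ 2) ^ (1 / 2 : ℝ) := by
    rw [← Real.sqrt_eq_rpow]
    exact Real.abs_le_sqrt (by linarith)
  rw [abs_mul, abs_mul, abs_mul, abs_of_nonneg (by linarith : 0 ≤ γ),
    abs_of_pos (Real.rpow_pos_of_pos hp _)]
  have e : (1 + trunc k a ^ 2) ^ ((γ - 1) / 2)
      = (1 + trunc k a ^ 2) ^ (1 / 2 : ℝ) * (1 + trunc k a ^ 2) ^ (γ / 2 - 1) := by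
    rw [← Real.rpow_add hp]
    congr 1
    ring
  rw [e]
  have h2 := mul_le_mul h1 (abs_truncD_le k a) (abs_nonneg _) (by positivity)
  have h3 := mul_le_mul_of_nonneg_right h2 (Real.rpow_pos_of_pos hp (γ / 2 - 1)).le
  have h4 := mul_le_mul_of_nonneg_left h3 (by linarith : 0 ≤ γ)
  calc _ = γ * (|trunc k a| * |truncD k a| * (1 + trunc k a ^ 2) ^ (γ / 2 - 1)) := by ring
    _ ≤ _ := h4
    _ = _ := by ring

theorem trunc_sq_le (k : ℕ) (a : ℝ) : trunc k a ^ 2 ≤ a ^ 2 := sq_le_sq.2 (abs_trunc_le k a)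

theorem trunc_sq_le_const (k : ℕ) (a : ℝ) : trunc k a ^ 2 ≤ ((k : ℝ) + 1) ^ 2 := by
  refine sq_le_sq.2 ((abs_trunc_le_const k a).trans (le_abs_self _))

/-- Powers have unbounded derivative, so the chain rule is applied to truncations first. Truncation
decreases the bracket, which leaves the two integrable majorants `h1` and `h2` for dominated
convergence. -/
theorem hasWeakDeriv_bracket (hΩ : IsOpen Ω) {v : E3} {f f' : E3 → ℝ} {γ : ℝ} (hγ : 1 ≤ γ)
    (h : HasWeakDeriv Ω v f f') (h1 : LocallyIntegrableOn (fun x => (1 + f x ^ 2) ^ (γ / 2)) Ω)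
    (h2 : LocallyIntegrableOn (fun x => γ * (1 + f x ^ 2) ^ ((γ - 1) / 2) * |f' x|) Ω) :
    HasWeakDeriv Ω v (fun x => (1 + f x ^ 2) ^ (γ / 2))
      (fun x => γ * f x * (1 + f x ^ 2) ^ (γ / 2 - 1) * f' x) := by
  have hd := hasDerivAt_bracket_trunc γ
  have hk : ∀ k : ℕ, HasWeakDeriv Ω v (fun x => (1 + trunc k (f x) ^ 2) ^ (γ / 2))
      (fun x => γ * trunc k (f x) * truncD k (f x) * (1 + trunc k (f x) ^ 2) ^ (γ / 2 - 1)
        * f' x) := by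
    intro k
    have := h.comp hΩ (Φ := fun a => (1 + trunc k a ^ 2) ^ (γ / 2))
      (C := γ * (1 + ((k : ℝ) + 1) ^ 2) ^ ((γ - 1) / 2))
      ((contDiff_const.add ((contDiff_trunc k).pow 2)).rpow_const_of_ne fun a => by positivity)
      (fun a => by
        rw [← norm_deriv_eq_norm_fderiv, (hd k a).deriv]
        refine (bracket_deriv_le hγ k a).trans ?_
        refine mul_le_mul_of_nonneg_left ?_ (by linarith)
        exact Real.rpow_le_rpow (by positivity) (by linarith [trunc_sq_le_const k a]) (by linarith))
    refine this.congr hΩ ae_eq_rfl (Eventually.of_forall fun x => ?_)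
    simp only
    rw [(hd k (f x)).hasFDerivAt.fderiv]
    simp [mul_comm]
  refine HasWeakDeriv.of_tendsto hΩ hk h1 h2 (fun k => ?_) (fun k => ?_) ?_ ?_
  · refine Eventually.of_forall fun x => ?_
    rw [abs_of_nonneg (by positivity)]
    exact Real.rpow_le_rpow (by positivity) (by linarith [trunc_sq_le k (f x)]) (by linarith)
  · refine Eventually.of_forall fun x => ?_
    rw [abs_mul]
    refine mul_le_mul_of_nonneg_right ((bracket_deriv_le hγ k _).trans ?_) (abs_nonneg _)
    refine mul_le_mul_of_nonneg_left ?_ (by linarith)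
    exact Real.rpow_le_rpow (by positivity) (by linarith [trunc_sq_le k (f x)]) (by linarith)
  · refine Eventually.of_forall fun x => ?_
    exact (((tendsto_trunc (f x)).pow 2).const_add 1).rpow_const (Or.inl (by positivity))
  · refine Eventually.of_forall fun x => ?_
    have t1 := (((tendsto_trunc (f x)).pow 2).const_add 1).rpow_const (p := γ / 2 - 1)
      (Or.inl (by positivity))
    have t2 := ((((tendsto_trunc (f x)).const_mul γ).mul (tendsto_truncD (f x))).mul t1).mul_const
      (f' x)
    simpa using t2

/-- Improvement of integrability: the embedding of `W^{1,1}` applied to a power of `f`. -/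
theorem memLp_improve (hΩ : IsBoundedLipschitzDomain Ω) {f : E3 → ℝ} {G : E3 → E3} {γ θ η : ℝ}
    (h : IsWeakGradient Ω f G) (hγ : 1 < γ) (hθ : 0 < θ) (hη : 0 < η)
    (hf : MemLp f (ENNReal.ofReal θ)⁻¹ (volume.restrict Ω))
    (hG : MemLp G (ENNReal.ofReal η)⁻¹ (volume.restrict Ω)) (h1 : (γ - 1) * θ + η ≤ 1)
    (h2 : γ * θ ≤ 1) : MemLp f (ENNReal.ofReal (2 / (3 * γ)))⁻¹ (volume.restrict Ω) := by
  have ho := hΩ.1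
  have := isFiniteMeasure_of_isBounded hΩ.2.2.1
  have hγ0 : 0 < γ := by linarith
  set j : E3 → ℝ := fun x => (1 + f x ^ 2) ^ (1 / 2 : ℝ) with hj
  have hj0 : ∀ x, 0 ≤ j x := fun x => by positivity
  have hjpow : ∀ x (a : ℝ), j x ^ a = (1 + f x ^ 2) ^ (a / 2) := fun x a => by
    rw [hj, ← Real.rpow_mul (by positivity)]
    congr 1
    ring
  have hjm : AEStronglyMeasurable j (volume.restrict Ω) := by
    have hc : Continuous fun a : ℝ => (1 + a ^ 2) ^ (1 / 2 : ℝ) :=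
      (continuous_const.add (continuous_id.pow 2)).rpow_const fun a => Or.inr (by norm_num)
    exact hc.comp_aestronglyMeasurable hf.1
  have hjL : MemLp j (ENNReal.ofReal θ)⁻¹ (volume.restrict Ω) := by
    refine MemLp.of_le ((memLp_const (1 : ℝ)).add hf.norm) hjm (Eventually.of_forall fun x => ?_)
    rw [Real.norm_of_nonneg (hj0 x)]
    refine le_trans ?_ (le_abs_self _)
    simp only [hj, ← Real.sqrt_eq_rpow, Pi.add_apply, Real.norm_eq_abs]
    rw [Real.sqrt_le_left (by positivity), ← sq_abs (f x)]
    nlinarith [abs_nonneg (f x)]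
  have hpow : ∀ {a : ℝ}, 0 < a → MemLp (fun x => (1 + f x ^ 2) ^ (a / 2))
      (ENNReal.ofReal (a * θ))⁻¹ (volume.restrict Ω) := by
    intro a ha
    have := (memLp_rpow_iff hjm ha).2 hjL
    simpa only [abs_of_nonneg (hj0 _), hjpow] using this
  have one_le : ∀ {a : ℝ}, a ≤ 1 → (1 : ℝ≥0∞) ≤ (ENNReal.ofReal a)⁻¹ := fun ha => by
    rw [ENNReal.one_le_inv]
    exact ENNReal.ofReal_le_one.2 ha
  -- Hypothesis `h2` makes the power of order `γ` integrable, and `h1` is Hölder's condition for its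
  -- gradient, which is of size `γ (1 + f²)^((γ - 1) / 2) |∇f|`.
  have hi1 : IntegrableOn (fun x => (1 + f x ^ 2) ^ (γ / 2)) Ω :=
    (hpow hγ0).integrable (one_le h2)
  have hGi : ∀ i, MemLp (fun x => G x i) (ENNReal.ofReal η)⁻¹ (volume.restrict Ω) :=
    fun i => memLp_coord hG i
  have hi2 : ∀ i, IntegrableOn (fun x => γ * (1 + f x ^ 2) ^ ((γ - 1) / 2) * |G x i|) Ω := by
    intro i
    have : ENNReal.HolderTriple (ENNReal.ofReal ((γ - 1) * θ))⁻¹ (ENNReal.ofReal η)⁻¹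
        (ENNReal.ofReal ((γ - 1) * θ + η))⁻¹ := by
      constructor
      rw [inv_inv, inv_inv, inv_inv, ← ENNReal.ofReal_add (by nlinarith) hη.le]
    have h3 : MemLp (fun x => (1 + f x ^ 2) ^ ((γ - 1) / 2) * |G x i|)
        (ENNReal.ofReal ((γ - 1) * θ + η))⁻¹ (volume.restrict Ω) :=
      (hGi i).norm.mul (hpow (by linarith : 0 < γ - 1))
    have h4 : IntegrableOn (fun x => (1 + f x ^ 2) ^ ((γ - 1) / 2) * |G x i|) Ω :=
      h3.integrable (one_le h1)
    simp only [mul_assoc]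
    exact h4.const_mul γ
  set G' : E3 → E3 := fun x => (γ * f x * (1 + f x ^ 2) ^ (γ / 2 - 1)) • G x with hG'
  have hw : IsWeakGradient Ω (fun x => (1 + f x ^ 2) ^ (γ / 2)) G' :=
    isWeakGradient_of_forall fun i => hasWeakDeriv_bracket ho hγ.le (h.hasWeakDeriv i)
      hi1.locallyIntegrableOn (hi2 i).locallyIntegrableOn
  have hbound : ∀ x, |γ * f x * (1 + f x ^ 2) ^ (γ / 2 - 1)|
      ≤ γ * (1 + f x ^ 2) ^ ((γ - 1) / 2) := by
    intro x
    have hp : 0 < 1 + f x ^ 2 := by positivity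
    have h5 : |f x| ≤ (1 + f x ^ 2) ^ (1 / 2 : ℝ) := by
      rw [← Real.sqrt_eq_rpow]
      exact Real.abs_le_sqrt (by linarith)
    have e : (1 + f x ^ 2) ^ ((γ - 1) / 2)
        = (1 + f x ^ 2) ^ (1 / 2 : ℝ) * (1 + f x ^ 2) ^ (γ / 2 - 1) := by
      rw [← Real.rpow_add hp]
      congr 1
      ring
    rw [abs_mul, abs_mul, abs_of_pos hγ0, abs_of_pos (Real.rpow_pos_of_pos hp _), e, mul_assoc]
    gcongr
  have hG'i : IntegrableOn G' Ω := by
    refine memLp_one_iff_integrable.1 (memLp_of_coord fun i => memLp_one_iff_integrable.2 ?_)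
    refine (hi2 i).mono' ?_ (Eventually.of_forall fun x => ?_)
    · have hc : Continuous fun a : ℝ => γ * a * (1 + a ^ 2) ^ (γ / 2 - 1) :=
        (continuous_const.mul continuous_id).mul
          ((by fun_prop : Continuous fun a : ℝ => 1 + a ^ 2).rpow_const
            fun a => Or.inl (by positivity))
      exact (hc.comp_aestronglyMeasurable hf.1).mul (hGi i).1
    · simp only [hG', PiLp.smul_apply, smul_eq_mul]
      rw [norm_mul]
      exact mul_le_mul_of_nonneg_right (hbound x) (norm_nonneg _)
  -- The power of order `γ` lies in `L^{3/2}`, hence `f` lies in `L^{3γ/2}`, whose reciprocal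
  -- exponent is `2 / (3 * γ)`.
  have hL := memLp_three_half hΩ hw hi1 hG'i
  rw [← memLp_inv_iff (by norm_num)] at hL
  have e : (1 / (3 / 2) : ℝ) = γ * (2 / (3 * γ)) := by field_simp
  have hjγ : MemLp (fun x => |j x| ^ γ) (ENNReal.ofReal (γ * (2 / (3 * γ))))⁻¹
      (volume.restrict Ω) := by
    rw [← e]
    simpa only [abs_of_nonneg (hj0 _), hjpow] using hL
  have hjfin := (memLp_rpow_iff hjm hγ0).1 hjγ
  refine hjfin.mono hf.1 (Eventually.of_forall fun x => ?_)
  rw [Real.norm_of_nonneg (hj0 x), Real.norm_eq_abs]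
  simp only [hj, ← Real.sqrt_eq_rpow]
  exact Real.abs_le_sqrt (by linarith)

end Mixture

end

set_option linter.unusedSectionVars false

noncomputable section

namespace Mixture

open MeasureTheory Filter Topology
open scoped ENNReal

variable {Ω : Set E3}

/-! ### An algebra of Sobolev functions -/

/-- Functions with the integrability that the Sobolev embedding gives to `W^{1,1/s}`, up to an
arbitrarily small loss. -/
structure Sob (Ω : Set E3) (s : ℝ) (f : E3 → ℝ) : Prop where
  grad : IsWeakGradient Ω f (wgrad Ω f)
  lp : LpBelow Ω (s - 1 / 3) f
  lpGrad : ∀ i, LpBelow Ω s (fun x => wgrad Ω f x i)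

theorem LpBelow.coord {s : ℝ} {G : E3 → E3} (h : LpBelow Ω s G) (i : Fin 3) :
    LpBelow Ω s (fun x => G x i) := fun θ hθ => memLp_coord (h θ hθ) i

theorem LpBelow.of_coord {s : ℝ} {G : E3 → E3} (h : ∀ i, LpBelow Ω s (fun x => G x i)) :
    LpBelow Ω s G := fun θ hθ => memLp_of_coord fun i => h i θ hθ

theorem memLp_three_iff {F : Type*} [NormedAddCommGroup F] {f : E3 → F} {μ : Measure E3} :
    MemLp f (ENNReal.ofReal (1 / 3))⁻¹ μ ↔ MemLp f 3 μ := by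
  rw [memLp_inv_iff (by norm_num), ENNReal.ofReal_ofNat]

/-- Bootstrap for the critical space `W^{1,3}`: starting from the exponent 3, each use of
`memLp_improve` raises the exponent by 3/2, so every finite exponent is eventually reached. -/
theorem lpBelow_zero_of_memLp_three (hΩ : IsBoundedLipschitzDomain Ω) {f : E3 → ℝ} {G : E3 → E3}
    (h : IsWeakGradient Ω f G) (hf : MemLp f 3 (volume.restrict Ω))
    (hG : MemLp G 3 (volume.restrict Ω)) : LpBelow Ω 0 f := by
  have := isFiniteMeasure_of_isBounded hΩ.2.2.1
  have key : ∀ k : ℕ, MemLp f (ENNReal.ofReal (2 / (3 * (k + 2))))⁻¹ (volume.restrict Ω) := by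
    intro k
    induction k with
    | zero =>
      rw [← memLp_three_iff] at hf
      have e : 2 / (3 * (((0 : ℕ) : ℝ) + 2)) = 1 / 3 := by norm_num
      rwa [e]
    | succ k ih =>
      have hk : (0 : ℝ) ≤ k := Nat.cast_nonneg k
      -- The choice `γ = k + 3` makes the gradient condition an equality: `(k + 2) * 2 / (3 * (k +
      -- 2)) + 1 / 3 = 1`.
      have := memLp_improve hΩ (γ := k + 3) h (by linarith) (by positivity)
        (by norm_num : (0 : ℝ) < 1 / 3) ih (memLp_three_iff.2 hG)
        (by apply le_of_eq; field_simp; ring)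
        (by rw [mul_div_assoc', div_le_one (by positivity)]; linarith)
      convert! this using 5
      push_cast
      ring
  intro θ hθ
  obtain ⟨k, hk⟩ := exists_nat_gt (1 / θ)
  refine (key k).mono_exponent (ENNReal.inv_le_inv.2 (ENNReal.ofReal_le_ofReal ?_))
  rw [div_le_iff₀ (by positivity)]
  rw [div_lt_iff₀ hθ] at hk
  nlinarith

theorem Sob.of_isWeakGradient (hΩ : IsOpen Ω) {s : ℝ} {f : E3 → ℝ} {G : E3 → E3}
    (h : IsWeakGradient Ω f G) (hf : LpBelow Ω (s - 1 / 3) f)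
    (hG : ∀ i, LpBelow Ω s (fun x => G x i)) : Sob Ω s f :=
  ⟨h.wgrad, hf, fun i => (hG i).congr ((h.wgrad_ae hΩ).symm.mono fun x hx => by simp only [hx])⟩

theorem MemW.sob_three (hΩ : IsBoundedLipschitzDomain Ω) {f : E3 → ℝ} (h : MemW Ω 3 f) :
    Sob Ω (1 / 3) f := by
  have := isFiniteMeasure_of_isBounded hΩ.2.2.1
  obtain ⟨hf, G, hw, hG⟩ := h
  refine .of_isWeakGradient hΩ.1 hw ?_ fun i => ?_
  · rw [sub_self]
    exact lpBelow_zero_of_memLp_three hΩ hw hf hG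
  · refine LpBelow.coord (LpBelow.of_memLp (by norm_num) ?_) i
    rwa [ENNReal.ofReal_ofNat]

/-- The optimal index `1 / p` is not needed, only some `s < 1` that serves all `f` at once. The
embedding into `L^{3/2}` is just the borderline `s = 1`, and a single improvement step already beats
it: `γ = 1 + (1 - η) / 2` exceeds one and still meets both Hölder conditions when started from the
index 2/3. -/
theorem exists_sob_of_memW (hΩ : IsBoundedLipschitzDomain Ω) {p : ℝ} (hp : 1 < p) :
    ∃ s, 1 / 3 ≤ s ∧ s < 1 ∧ 1 / p ≤ s ∧ ∀ f, MemW Ω (ENNReal.ofReal p) f → Sob Ω s f := by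
  have := isFiniteMeasure_of_isBounded hΩ.2.2.1
  have hp0 : 0 < p := by linarith
  have h1p : (1 : ℝ≥0∞) ≤ ENNReal.ofReal p := by
    rw [← ENNReal.ofReal_one]
    exact ENNReal.ofReal_le_ofReal hp.le
  set η := 1 / p with hη
  have hη0 : 0 < η := by positivity
  have hη1 : η < 1 := by
    rw [hη, div_lt_one hp0]
    exact hp
  set γ := 1 + (1 - η) / 2 with hγ
  have hγ1 : 1 < γ := by rw [hγ]; linarith
  set θ := 2 / (3 * γ) with hθ
  have hθ1 : θ < 2 / 3 := by
    rw [hθ, div_lt_div_iff₀ (by positivity) (by norm_num)]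
    linarith
  have hθ0 : 0 < θ := by positivity
  refine ⟨max η (θ + 1 / 3), le_max_of_le_right (by linarith), max_lt hη1 (by linarith),
    le_max_left _ _, fun f ⟨hf, G, hw, hG⟩ => .of_isWeakGradient hΩ.1 hw ?_ fun i => ?_⟩
  · have hL := memLp_three_half hΩ hw (hf.integrable h1p) (hG.integrable h1p)
    rw [← memLp_inv_iff (by norm_num)] at hL
    have him := memLp_improve hΩ (γ := γ) hw hγ1 (by norm_num) hη0 hL ((memLp_inv_iff hp0).2 hG)
      (by norm_num; rw [hγ]; linarith) (by norm_num; rw [hγ]; linarith)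
    intro t ht
    have hmax := le_max_right η (θ + 1 / 3)
    exact him.mono_exponent (ENNReal.inv_le_inv.2 (ENNReal.ofReal_le_ofReal (by linarith)))
  · exact ((LpBelow.of_memLp hp0 hG).coord i).mono (le_max_left _ _)

theorem MemW.exists_sob (hΩ : IsBoundedLipschitzDomain Ω) {p : ℝ} (hp : 1 < p) {f : E3 → ℝ}
    (h : MemW Ω (ENNReal.ofReal p) f) : ∃ s, 1 / 3 ≤ s ∧ s < 1 ∧ Sob Ω s f :=
  (exists_sob_of_memW hΩ hp).imp fun _ hs => ⟨hs.1, hs.2.1, hs.2.2.2 f h⟩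

namespace Sob

variable {s t : ℝ} {f g : E3 → ℝ}

theorem mono (h : Sob Ω s f) (hst : s ≤ t) : Sob Ω t f :=
  ⟨h.grad, h.lp.mono (by linarith), fun i => (h.lpGrad i).mono hst⟩

theorem congr (hΩ : IsOpen Ω) (h : Sob Ω s f) (hfg : f =ᵐ[volume.restrict Ω] g) : Sob Ω s g :=
  .of_isWeakGradient hΩ (h.grad.congr hΩ hfg ae_eq_rfl) (h.lp.congr hfg) h.lpGrad

theorem add (hΩ : IsOpen Ω) (h : Sob Ω s f) (hg : Sob Ω s g) : Sob Ω s (fun x => f x + g x) :=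
  .of_isWeakGradient hΩ (h.grad.add hg.grad) (h.lp.add hg.lp)
    fun i => (h.lpGrad i).add (hg.lpGrad i)

theorem sub (hΩ : IsOpen Ω) (h : Sob Ω s f) (hg : Sob Ω s g) : Sob Ω s (fun x => f x - g x) :=
  .of_isWeakGradient hΩ (h.grad.sub hg.grad) (h.lp.sub hg.lp)
    fun i => (h.lpGrad i).sub (hg.lpGrad i)

theorem neg (hΩ : IsOpen Ω) (h : Sob Ω s f) : Sob Ω s (fun x => - f x) :=
  .of_isWeakGradient hΩ h.grad.neg h.lp.neg fun i => (h.lpGrad i).neg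

theorem const_mul (hΩ : IsOpen Ω) (h : Sob Ω s f) (c : ℝ) : Sob Ω s (fun x => c * f x) :=
  .of_isWeakGradient hΩ (h.grad.const_mul c) (h.lp.const_mul c)
    fun i => (h.lpGrad i).const_mul c

theorem const (hΩ : IsOpen Ω) [IsFiniteMeasure (volume.restrict Ω)] (c : ℝ) :
    Sob Ω s (fun _ => c) :=
  .of_isWeakGradient hΩ (.const c) (.const c) fun _ => .const _

theorem sum (hΩ : IsOpen Ω) {ι : Type*} (u : Finset ι) {f : ι → E3 → ℝ}
    (h : ∀ i ∈ u, Sob Ω s (f i)) : Sob Ω s (fun x => ∑ i ∈ u, f i x) :=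
  .of_isWeakGradient hΩ (.sum u fun i hi => (h i hi).grad) (.sum u fun i hi => (h i hi).lp)
    fun j => by simpa [Finset.sum_apply] using LpBelow.sum u fun i hi => (h i hi).lpGrad j

theorem lp_zero (h : Sob Ω (1 / 3) f) : LpBelow Ω 0 f := by
  simpa using h.lp

/-- A factor of class `1 / 3` lies in every `L^q` with `q < ∞` and so costs nothing in Hölder's
inequality, while `g ∇f` has index `(s - 1 / 3) + 1 / 3 = s`. All terms of the product rule are
therefore integrable. -/
theorem isWeakGradient_mul (hΩ : IsOpen Ω) (hs : 1 / 3 ≤ s) (hs1 : s < 1) (h : Sob Ω (1 / 3) f)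
    (hg : Sob Ω s g) : IsWeakGradient Ω (fun x => f x * g x)
      (fun x => g x • wgrad Ω f x + f x • wgrad Ω g x) := by
  have h0 := h.lp_zero
  refine isWeakGradient_of_forall fun i => ?_
  have := (h.grad.hasWeakDeriv i).mul hΩ (hg.grad.hasWeakDeriv i)
    (((h0.mul le_rfl (by linarith) hg.lp).integrable (by linarith)).locallyIntegrableOn)
    ((((h.lpGrad i).mul (by norm_num) (by linarith) hg.lp).integrable
      (by linarith)).locallyIntegrableOn)
    (((h0.mul le_rfl (by linarith) (hg.lpGrad i)).integrable (by linarith)).locallyIntegrableOn)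
  simpa [mul_comm] using this

theorem mul (hΩ : IsOpen Ω) (hs : 1 / 3 ≤ s) (hs1 : s < 1) (h : Sob Ω (1 / 3) f)
    (hg : Sob Ω s g) : Sob Ω s (fun x => f x * g x) := by
  have h0 := h.lp_zero
  refine .of_isWeakGradient hΩ (isWeakGradient_mul hΩ hs hs1 h hg) ?_ fun i => ?_
  · exact (h0.mul le_rfl (by linarith) hg.lp).mono (by linarith)
  · refine LpBelow.add ?_ ?_
    · refine LpBelow.mono (s := (s - 1 / 3) + 1 / 3) ?_ (by linarith)
      exact hg.lp.mul (by linarith) (by norm_num) (h.lpGrad i)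
    · exact (h0.mul le_rfl (by linarith) (hg.lpGrad i)).mono (by linarith)

theorem wgrad_mul (hΩ : IsOpen Ω) (hs : 1 / 3 ≤ s) (hs1 : s < 1) (h : Sob Ω (1 / 3) f)
    (hg : Sob Ω s g) : wgrad Ω (fun x => f x * g x) =ᵐ[volume.restrict Ω]
      fun x => g x • wgrad Ω f x + f x • wgrad Ω g x :=
  (isWeakGradient_mul hΩ hs hs1 h hg).wgrad_ae hΩ

theorem memW (h : Sob Ω s f) {q : ℝ} (hq : 0 < q) (hs : s < 1 / q) :
    MemW Ω (ENNReal.ofReal q) f :=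
  ⟨h.lp.memLp hq (by linarith), wgrad Ω f, h.grad, (LpBelow.of_coord h.lpGrad).memLp hq hs⟩

/-- Returns to a genuine Sobolev space, as is needed for testing the normal trace condition. The
reciprocal of `q` is the midpoint of `s` and 1. -/
theorem exists_memW (h : Sob Ω s f) (hs0 : 0 < s) (hs : s < 1) :
    ∃ q : ℝ, 1 < q ∧ MemW Ω (ENNReal.ofReal q) f := by
  refine ⟨2 / (1 + s), ?_, h.memW (by positivity) ?_⟩
  · rw [lt_div_iff₀ (by positivity)]
    linarith
  · rw [one_div_div]
    linarith

end Sob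

/-! ### Linear operations in `W^{1,p}`. -/

theorem MemW.grad {p : ℝ≥0∞} {f : E3 → ℝ} (h : MemW Ω p f) : IsWeakGradient Ω f (wgrad Ω f) :=
  h.2.choose_spec.1.wgrad

theorem MemW.memLp_grad (hΩ : IsOpen Ω) {p : ℝ≥0∞} {f : E3 → ℝ} (h : MemW Ω p f) :
    MemLp (wgrad Ω f) p (volume.restrict Ω) := by
  obtain ⟨-, G, hw, hG⟩ := h
  exact (memLp_congr_ae (hw.wgrad_ae hΩ)).2 hG

theorem MemW.add {p : ℝ≥0∞} {f g : E3 → ℝ} (h : MemW Ω p f) (hg : MemW Ω p g) :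
    MemW Ω p (fun x => f x + g x) := by
  obtain ⟨hf, G, hw, hG⟩ := h
  obtain ⟨hf', G', hw', hG'⟩ := hg
  exact ⟨hf.add hf', _, hw.add hw', hG.add hG'⟩

theorem MemW.const_mul {p : ℝ≥0∞} {f : E3 → ℝ} (h : MemW Ω p f) (c : ℝ) :
    MemW Ω p (fun x => c * f x) := by
  obtain ⟨hf, G, hw, hG⟩ := h
  exact ⟨hf.const_mul c, _, hw.const_mul c, hG.const_smul c⟩

/-! ### The normal trace condition -/

theorem wdiv_apply (w : E3 → E3) (x : E3) :
    wdiv Ω w x = ∑ i, wgrad Ω (fun y => w y i) x i := rfl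

/-- The integrand of the Gauss-Green formula is integrable. -/
theorem integrable_gaussGreen {s : ℝ} {w : E3 → E3} {ψ : E3 → ℝ}
    (hw : ∀ i, Sob Ω (1 / 3) fun x => w x i) (hs : 1 / 3 ≤ s) (hs1 : s < 1) (hψ : Sob Ω s ψ) :
    IntegrableOn (fun x => inner ℝ (w x) (wgrad Ω ψ x) + ψ x * wdiv Ω w x) Ω := by
  refine Integrable.add ?_ ?_
  · simp only [PiLp.inner_apply]
    refine integrable_finsetSum _ fun i _ => ?_
    refine LpBelow.integrable (s := 0 + s) ?_ (by linarith)
    simpa [mul_comm] using (hw i).lp_zero.mul le_rfl (by linarith) (hψ.lpGrad i)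
  · have hd : LpBelow Ω (1 / 3) (wdiv Ω w) := LpBelow.sum Finset.univ fun i _ => (hw i).lpGrad i
    exact (hψ.lp.mul (by linarith) (by norm_num) hd).integrable (by linarith)

theorem integral_gaussGreen_eq_zero {s : ℝ} {w : E3 → E3} {ψ : E3 → ℝ} (hn : NormalTraceZero Ω w)
    (hs : 1 / 3 ≤ s) (hs1 : s < 1) (hψ : Sob Ω s ψ) :
    ∫ x in Ω, (inner ℝ (w x) (wgrad Ω ψ x) + ψ x * wdiv Ω w x) = 0 := by
  obtain ⟨q, hq, hm⟩ := hψ.exists_memW (by linarith) hs1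
  exact hn q hq ψ hm

theorem wdiv_add_smul (hΩ : IsOpen Ω) {w w' : E3 → E3} (c : ℝ)
    (hw : ∀ i, IsWeakGradient Ω (fun x => w x i) (wgrad Ω fun x => w x i))
    (hw' : ∀ i, IsWeakGradient Ω (fun x => w' x i) (wgrad Ω fun x => w' x i)) :
    wdiv Ω (fun x => w x + c • w' x) =ᵐ[volume.restrict Ω]
      fun x => wdiv Ω w x + c * wdiv Ω w' x := by
  have h : ∀ i : Fin 3, wgrad Ω (fun x => (w x + c • w' x) i) =ᵐ[volume.restrict Ω]
      fun x => wgrad Ω (fun x => w x i) x + c • wgrad Ω (fun x => w' x i) x := fun i =>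
    ((hw i).add ((hw' i).const_mul c)).wgrad_ae hΩ
  filter_upwards [ae_all_iff.2 h] with x hx
  simp only [wdiv_apply]
  simp only [hx]
  simp only [PiLp.add_apply, PiLp.smul_apply, smul_eq_mul, Finset.sum_add_distrib,
    Finset.mul_sum]

theorem NormalTraceZero.add_smul (hΩ : IsBoundedLipschitzDomain Ω) {w w' : E3 → E3} (c : ℝ)
    (hw : ∀ i, Sob Ω (1 / 3) fun x => w x i) (hw' : ∀ i, Sob Ω (1 / 3) fun x => w' x i)
    (h : NormalTraceZero Ω w) (h' : NormalTraceZero Ω w') :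
    NormalTraceZero Ω (fun x => w x + c • w' x) := by
  intro r hr ψ hψ
  obtain ⟨s, hs, hs1, hS⟩ := hψ.exists_sob hΩ hr
  have i1 := integrable_gaussGreen hw hs hs1 hS
  have i2 := (integrable_gaussGreen hw' hs hs1 hS).const_mul c
  have e : ∫ x in Ω, (inner ℝ (w x + c • w' x) (wgrad Ω ψ x)
        + ψ x * wdiv Ω (fun x => w x + c • w' x) x)
      = ∫ x in Ω, ((inner ℝ (w x) (wgrad Ω ψ x) + ψ x * wdiv Ω w x)
        + c * (inner ℝ (w' x) (wgrad Ω ψ x) + ψ x * wdiv Ω w' x)) := by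
    refine integral_congr_ae ?_
    filter_upwards [wdiv_add_smul hΩ.1 c (fun i => (hw i).grad) fun i => (hw' i).grad] with x hx
    simp only [hx, inner_add_left, real_inner_smul_left]
    ring
  rw [e, integral_add i1 i2, integral_const_mul, h r hr ψ hψ, h' r hr ψ hψ]
  ring

theorem phaseSpace_add_smul {ν : ℕ} (hΩ : IsBoundedLipschitzDomain Ω) {z w : Fields ν}
    (hz : z ∈ phaseSpace Ω) (hw : w ∈ phaseSpace Ω) (c : ℝ) :
    z + c • w ∈ phaseSpace Ω := by
  obtain ⟨h1, ⟨h2, h3⟩, h4⟩ := hz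
  obtain ⟨g1, ⟨g2, g3⟩, g4⟩ := hw
  refine ⟨fun α => (h1 α).add ((g1 α).const_mul c), ⟨fun i => (h2 i).add ((g2 i).const_mul c), ?_⟩,
    h4.add (g4.const_mul c)⟩
  exact NormalTraceZero.add_smul hΩ c (fun i => (h2 i).sob_three hΩ)
    (fun i => (g2 i).sob_three hΩ) h3 g3

theorem phaseSpace_sub {ν : ℕ} (hΩ : IsBoundedLipschitzDomain Ω) {z w : Fields ν}
    (hz : z ∈ phaseSpace Ω) (hw : w ∈ phaseSpace Ω) : z - w ∈ phaseSpace Ω := by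
  simpa [sub_eq_add_neg] using phaseSpace_add_smul hΩ hz hw (-1)

end Mixture

end

set_option linter.unusedSectionVars false

noncomputable section

namespace Mixture

open MeasureTheory Filter Topology
open scoped ENNReal

variable {Ω : Set E3} {ν : ℕ}

/-! ### Norm and pairing of the phase space -/

theorem sobNorm_const_mul (hΩ : IsOpen Ω) {p : ℝ≥0∞} {f : E3 → ℝ} (h : MemW Ω p f) (c : ℝ) :
    sobNorm Ω p (fun x => c * f x) = |c| * sobNorm Ω p f := by
  have e1 : eLpNorm (fun x => c * f x) p (volume.restrict Ω)
      = ‖c‖ₑ * eLpNorm f p (volume.restrict Ω) := eLpNorm_const_smul c f p _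
  have e2 : eLpNorm (wgrad Ω fun x => c * f x) p (volume.restrict Ω)
      = ‖c‖ₑ * eLpNorm (wgrad Ω f) p (volume.restrict Ω) := by
    rw [eLpNorm_congr_ae ((h.grad.const_mul c).wgrad_ae hΩ)]
    exact eLpNorm_const_smul c (wgrad Ω f) p _
  simp only [sobNorm, e1, e2, ENNReal.toReal_mul, toReal_enorm, Real.norm_eq_abs]
  ring

theorem sobNorm_nonneg (p : ℝ≥0∞) (f : E3 → ℝ) : 0 ≤ sobNorm Ω p f :=
  add_nonneg ENNReal.toReal_nonneg ENNReal.toReal_nonneg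

theorem phaseNorm_nonneg (z : Fields ν) : 0 ≤ phaseNorm Ω z :=
  add_nonneg (add_nonneg (Finset.sum_nonneg fun _ _ => sobNorm_nonneg _ _)
    (Finset.sum_nonneg fun _ _ => sobNorm_nonneg _ _)) (sobNorm_nonneg _ _)

theorem phaseNorm_smul (hΩ : IsOpen Ω) {z : Fields ν} (hz : z ∈ phaseSpace Ω) (c : ℝ) :
    phaseNorm Ω (c • z) = |c| * phaseNorm Ω z := by
  obtain ⟨h1, ⟨h2, -⟩, h4⟩ := hz
  have e1 : ∀ α, sobNorm Ω 3 ((c • z).rho α) = |c| * sobNorm Ω 3 (z.rho α) := fun α =>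
    sobNorm_const_mul hΩ (h1 α) c
  have e2 : ∀ i, sobNorm Ω 3 (fun x => (c • z).M x i) = |c| * sobNorm Ω 3 (fun x => z.M x i) :=
    fun i => sobNorm_const_mul hΩ (h2 i) c
  have e3 : sobNorm Ω 3 ((c • z).e) = |c| * sobNorm Ω 3 z.e := sobNorm_const_mul hΩ h4 c
  simp only [phaseNorm, e1, e2, e3, ← Finset.mul_sum]
  ring

theorem inner_eq_sum (u w : E3) : inner ℝ u w = ∑ i, u i * w i := by
  simp [PiLp.inner_apply, mul_comm]

theorem integrable_pairing (hΩ : IsBoundedLipschitzDomain Ω) {g h : Fields ν}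
    (hg : g ∈ phaseSpace Ω) (hh : h ∈ phaseSpace Ω) :
    IntegrableOn (fun x => ∑ α, g.rho α x * h.rho α x + inner ℝ (g.M x) (h.M x)
      + g.e x * h.e x) Ω := by
  obtain ⟨h1, ⟨h2, -⟩, h4⟩ := hg
  obtain ⟨g1, ⟨g2, -⟩, g4⟩ := hh
  have aux : ∀ {f g : E3 → ℝ}, MemW Ω 3 f → MemW Ω 3 g → LpBelow Ω 0 (fun x => f x * g x) :=
    fun hf hg => ((hf.sob_three hΩ).lp_zero.mul le_rfl le_rfl (hg.sob_three hΩ).lp_zero).mono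
      (by norm_num)
  refine LpBelow.integrable (s := 0) ?_ one_pos
  refine ((LpBelow.sum _ fun α _ => aux (h1 α) (g1 α)).add ?_).add (aux h4 g4)
  simp only [inner_eq_sum]
  exact LpBelow.sum _ fun i _ => aux (h2 i) (g2 i)

theorem pairing_comm (g h : Fields ν) : pairing Ω g h = pairing Ω h g := by
  unfold pairing
  refine integral_congr_ae (Eventually.of_forall fun x => ?_)
  simp only [real_inner_comm, mul_comm]

theorem pairing_sub_right (hΩ : IsBoundedLipschitzDomain Ω) {g h h' : Fields ν}
    (hg : g ∈ phaseSpace Ω) (hh : h ∈ phaseSpace Ω) (hh' : h' ∈ phaseSpace Ω) :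
    pairing Ω g (h - h') = pairing Ω g h - pairing Ω g h' := by
  unfold pairing
  rw [← integral_sub (integrable_pairing hΩ hg hh) (integrable_pairing hΩ hg hh')]
  refine integral_congr_ae (Eventually.of_forall fun x => ?_)
  have e1 : (h - h').M x = h.M x - h'.M x := rfl
  have e2 : ∀ α, (h - h').rho α x = h.rho α x - h'.rho α x := fun α => rfl
  have e3 : (h - h').e x = h.e x - h'.e x := rfl
  simp only [e1, e2, e3, inner_sub_right, mul_sub, Finset.sum_sub_distrib]
  ring

/-! ### Differentiation of observables along a curve -/

/-- The mean value theorem on the segment, which convexity keeps in `Z`. The functional derivative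
gives a two-sided derivative only at interior parameters; at the two ends the continuity of `A`
suffices. -/
theorem exists_pairing_eq_sub (hΩ : IsBoundedLipschitzDomain Ω) {Z : Set (Fields ν)}
    (hZ : Z ⊆ phaseSpace Ω) (hconv : Convex ℝ Z) {A : Fields ν → ℝ} {δA : Fields ν → Fields ν}
    (hA : IsSmoothObservable Ω Z A δA) {w w' : Fields ν} (hw : w ∈ Z) (hw' : w' ∈ Z) :
    ∃ θ ∈ Set.Ioo (0 : ℝ) 1, w + θ • (w' - w) ∈ Z ∧
      A w' - A w = pairing Ω (w' - w) (δA (w + θ • (w' - w))) := by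
  have hh : w' - w ∈ phaseSpace Ω := phaseSpace_sub hΩ (hZ hw') (hZ hw)
  set h := w' - w with hdef
  have hmem : ∀ θ ∈ Set.Icc (0 : ℝ) 1, w + θ • h ∈ Z := fun θ hθ =>
    hconv.add_smul_sub_mem hw hw' hθ
  have hcontOn : ContinuousOn (fun θ : ℝ => A (w + θ • h)) (Set.Icc 0 1) := by
    rw [Metric.continuousOn_iff]
    intro θ hθ ε hε
    obtain ⟨η, hη, H⟩ := hA.continuous _ (hmem θ hθ) ε hε
    refine ⟨η / (phaseNorm Ω h + 1), div_pos hη (by linarith [phaseNorm_nonneg (Ω := Ω) h]),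
      fun θ' hθ' hd => ?_⟩
    rw [Real.dist_eq]
    refine H _ (hmem θ' hθ') ?_
    have e : w + θ' • h - (w + θ • h) = (θ' - θ) • h := by
      rw [sub_smul]
      abel
    rw [e, phaseNorm_smul hΩ.1 hh]
    rw [Real.dist_eq, lt_div_iff₀ (by linarith [phaseNorm_nonneg (Ω := Ω) h])] at hd
    nlinarith [abs_nonneg (θ' - θ)]
  have hder : ∀ θ ∈ Set.Ioo (0 : ℝ) 1, HasDerivAt (fun θ : ℝ => A (w + θ • h))
      (pairing Ω (δA (w + θ • h)) h) θ := by
    intro θ hθ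
    have hev : ∀ᶠ ε in 𝓝 (0 : ℝ), w + θ • h + ε • h ∈ Z := by
      have : ∀ᶠ ε in 𝓝 (0 : ℝ), θ + ε ∈ Set.Ioo (0 : ℝ) 1 := by
        have hc : Tendsto (fun ε : ℝ => θ + ε) (𝓝 0) (𝓝 (θ + 0)) :=
          (continuous_const.add continuous_id).tendsto 0
        rw [add_zero] at hc
        exact hc.eventually (isOpen_Ioo.mem_nhds hθ)
      filter_upwards [this] with ε hε
      have := hmem _ ⟨hε.1.le, hε.2.le⟩
      rwa [add_smul, ← add_assoc] at this
    have h1 := hA.hasDeriv _ (hmem θ ⟨hθ.1.le, hθ.2.le⟩) h hh hev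
    have h2 := HasDerivAt.comp_sub_const (f := fun ε : ℝ => A (w + θ • h + ε • h)) θ θ
      (by rwa [sub_self])
    refine h2.congr_of_eventuallyEq (Eventually.of_forall fun θ' => ?_)
    simp only
    congr 1
    rw [sub_smul]
    abel
  obtain ⟨θ, hθ, he⟩ := exists_hasDerivAt_eq_slope _ _ one_pos hcontOn hder
  refine ⟨θ, hθ, hmem θ ⟨hθ.1.le, hθ.2.le⟩, ?_⟩
  rw [pairing_comm, he]
  simp [hdef]

/-- The increment of `A` is `⟨z τ - z t, φ'⟩` with `φ'` the derivative of `A` at an intermediate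
state. Against the fixed `φ` the pairing is differentiated by hypothesis. Against `φ' - φ`, which is
small in norm, it is controlled because the dual derivative is uniform in the test field and `ℓ` is
bounded. -/
theorem hasDerivAt_observable (hΩ : IsBoundedLipschitzDomain Ω) {Z : Set (Fields ν)}
    (hZ : Z ⊆ phaseSpace Ω) (hconv : Convex ℝ Z) {a b t : ℝ} {z : ℝ → Fields ν}
    (hz : ∀ t ∈ Set.Ioo a b, z t ∈ Z) (hcont : IsContinuousCurve Ω a b z) (ht : t ∈ Set.Ioo a b)
    {ℓ : Fields ν → ℝ} (hd : HasDualDerivAt Ω z ℓ t) {A : Fields ν → ℝ}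
    {δA : Fields ν → Fields ν} (hA : IsSmoothObservable Ω Z A δA) :
    HasDerivAt (fun τ => A (z τ)) (ℓ (δA (z t))) t := by
  obtain ⟨⟨C, hC⟩, hdual⟩ := hd
  rw [hasDerivAt_iff_isLittleO, Asymptotics.isLittleO_iff]
  intro ε hε
  set φ := δA (z t) with hφ
  have hφm : φ ∈ phaseSpace Ω := hA.mem _ (hz t ht)
  set N := phaseNorm Ω φ with hN
  have hN0 : 0 ≤ N := phaseNorm_nonneg φ
  -- The second bound makes `|C|` times the norm of `φ' - φ` at most `ε / 2`. The first keeps that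
  -- norm below one, so the two remainders of the dual derivative, each with rate `ε / (2 * (N +
  -- 1))`, add up to the other `ε / 2`.
  set κ := min 1 (ε / (2 * (|C| + 1))) with hκ
  have hκ0 : 0 < κ := by positivity
  obtain ⟨η, hη, hδ⟩ := hA.continuous_deriv _ (hz t ht) κ hκ0
  have hε1 : 0 < ε / (2 * (N + 1)) := by positivity
  filter_upwards [hdual _ hε1, (hcont t ht).eventually_lt_const hη, isOpen_Ioo.mem_nhds ht]
    with τ h1 h2 h3
  obtain ⟨θ, hθ, hmem, he⟩ := exists_pairing_eq_sub hΩ hZ hconv hA (hz t ht) (hz τ h3)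
  have hh : z τ - z t ∈ phaseSpace Ω := phaseSpace_sub hΩ (hZ (hz τ h3)) (hZ (hz t ht))
  set φ' := δA (z t + θ • (z τ - z t)) with hφ'
  have hφm' : φ' ∈ phaseSpace Ω := hA.mem _ hmem
  have hclose : phaseNorm Ω (φ' - φ) < κ := by
    refine hδ _ hmem ?_
    rw [add_sub_cancel_left, phaseNorm_smul hΩ.1 hh, abs_of_pos hθ.1]
    have := phaseNorm_nonneg (Ω := Ω) (z τ - z t)
    nlinarith [hθ.2]
  have hdm : φ' - φ ∈ phaseSpace Ω := phaseSpace_sub hΩ hφm' hφm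
  have b1 := h1 φ hφm
  have b2 := h1 _ hdm
  have b3 := hC _ hdm
  rw [pairing_sub_right hΩ hh hφm' hφm, ← he] at b2
  set P := phaseNorm Ω (φ' - φ) with hP
  have hP0 : 0 ≤ P := phaseNorm_nonneg _
  have hκ1 : κ ≤ 1 := min_le_left _ _
  have hκ2 : κ ≤ ε / (2 * (|C| + 1)) := min_le_right _ _
  rw [smul_eq_mul, Real.norm_eq_abs, Real.norm_eq_abs]
  set δ := |τ - t| with hδdef
  have hδ0 : 0 ≤ δ := abs_nonneg _
  have c1 : |(τ - t) * ℓ (φ' - φ)| ≤ δ * (|C| * P) := by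
    rw [abs_mul]
    exact mul_le_mul_of_nonneg_left (b3.trans (mul_le_mul_of_nonneg_right (le_abs_self C) hP0)) hδ0
  have c2 : |C| * P ≤ ε / 2 := by
    calc |C| * P ≤ (|C| + 1) * (ε / (2 * (|C| + 1))) :=
          mul_le_mul (by linarith) (hclose.le.trans hκ2) hP0 (by positivity)
      _ = ε / 2 := by field_simp
  have c3 : ε / (2 * (N + 1)) * N + ε / (2 * (N + 1)) * P ≤ ε / 2 := by
    calc ε / (2 * (N + 1)) * N + ε / (2 * (N + 1)) * P
        ≤ ε / (2 * (N + 1)) * N + ε / (2 * (N + 1)) * 1 := by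
          gcongr
          exact hclose.le.trans hκ1
      _ = ε / 2 := by field_simp
  have c4 := abs_add_le ((A (z τ) - A (z t) - pairing Ω (z τ - z t) φ) - (τ - t) * ℓ (φ' - φ))
    ((pairing Ω (z τ - z t) φ - (τ - t) * ℓ φ) + (τ - t) * ℓ (φ' - φ))
  have c5 := abs_add_le (pairing Ω (z τ - z t) φ - (τ - t) * ℓ φ) ((τ - t) * ℓ (φ' - φ))
  have e : A (z τ) - A (z t) - (τ - t) * ℓ φ
      = ((A (z τ) - A (z t) - pairing Ω (z τ - z t) φ) - (τ - t) * ℓ (φ' - φ))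
        + ((pairing Ω (z τ - z t) φ - (τ - t) * ℓ φ) + (τ - t) * ℓ (φ' - φ)) := by ring
  rw [e]
  have d1 := mul_le_mul_of_nonneg_left c2 hδ0
  have d2 := mul_le_mul_of_nonneg_left c3 hδ0
  nlinarith

end Mixture

end

set_option linter.unusedSectionVars false

noncomputable section

namespace Mixture

open MeasureTheory Filter Topology
open scoped ENNReal

/-! ### Localization in the values of a function -/

section Localization

variable {P : Type*} [NormedAddCommGroup P] [NormedSpace ℝ P] [FiniteDimensional ℝ P]

/-- A property holds almost everywhere if it does so where `η ∘ p ≠ 0`, for each cutoff `η`. -/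
theorem ae_of_forall_bump {X : Type*} [MeasurableSpace X] {μ : Measure X} {O : Set P}
    (hO : IsOpen O) {p : X → P} (hp : ∀ᵐ x ∂μ, p x ∈ O) {Q : X → Prop}
    (h : ∀ η : P → ℝ, ContDiff ℝ (⊤ : ℕ∞) η → HasCompactSupport η → tsupport η ⊆ O →
      ∀ᵐ x ∂μ, η (p x) ≠ 0 → Q x) : ∀ᵐ x ∂μ, Q x := by
  have hb : ∀ y : O, ∃ η : P → ℝ, tsupport η ⊆ O ∧ HasCompactSupport η ∧
      ContDiff ℝ (⊤ : ℕ∞) η ∧ η y ≠ 0 := by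
    intro y
    obtain ⟨η, h1, h2, h3, -, h5⟩ := exists_contDiff_tsupport_subset (n := (⊤ : ℕ∞))
      (hO.mem_nhds y.2)
    exact ⟨η, h1, h2, h3, by simp [h5]⟩
  choose η h1 h2 h3 h4 using hb
  have hop : ∀ y : O, IsOpen {q | η y q ≠ 0} := fun y =>
    isOpen_ne_fun (h3 y).continuous continuous_const
  obtain ⟨T, hT, hcov⟩ := TopologicalSpace.isOpen_iUnion_countable _ hop
  have := (ae_ball_iff hT).2 fun y _ => h (η y) (h3 y) (h2 y) (h1 y)
  filter_upwards [hp, this] with x hx hall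
  have : p x ∈ ⋃ y : O, {q | η y q ≠ 0} := Set.mem_iUnion.2 ⟨⟨p x, hx⟩, h4 ⟨p x, hx⟩⟩
  rw [← hcov] at this
  obtain ⟨y, hy, hne⟩ := Set.mem_iUnion₂.1 this
  exact hall y hy hne

theorem aestronglyMeasurable_comp_of_continuousOn [MeasurableSpace P] [BorelSpace P]
    {X : Type*} [MeasurableSpace X] {μ : Measure X} {O : Set P} (hO : IsOpen O) {F : P → ℝ}
    (hF : ContinuousOn F O) {p : X → P} (hp : AEMeasurable p μ) (hpO : ∀ᵐ x ∂μ, p x ∈ O) :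
    AEStronglyMeasurable (fun x => F (p x)) μ := by
  classical
  have hm : Measurable (O.piecewise F fun _ => (0 : ℝ)) :=
    hF.measurable_piecewise continuousOn_const hO.measurableSet
  refine ((hm.comp_aemeasurable hp).congr ?_).aestronglyMeasurable
  filter_upwards [hpO] with x hx
  simp [hx]

/-- Differentiation of an integral along a perturbation that is localized in the values. -/
theorem hasDerivAt_integral_perturbation [MeasurableSpace P] [BorelSpace P]
    {X : Type*} [MeasurableSpace X] {μ : Measure X} [IsFiniteMeasure μ] {O K : Set P}
    (hO : IsOpen O) (hK : IsCompact K) (hKO : K ⊆ O) {F : P → ℝ} (hF : ContDiffOn ℝ 1 F O)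
    {p : X → P} (hp : AEMeasurable p μ) (hpO : ∀ᵐ x ∂μ, p x ∈ O)
    (hint : Integrable (fun x => F (p x)) μ) {c : X → ℝ} (hc : AEMeasurable c μ) {C : ℝ}
    (hC : ∀ x, |c x| ≤ C) (hcK : ∀ x, c x ≠ 0 → p x ∈ K) (e : P) :
    HasDerivAt (fun ε : ℝ => ∫ x, F (p x + ε • c x • e) ∂μ)
      (∫ x, c x * fderiv ℝ F (p x) e ∂μ) 0 := by
  obtain ⟨δ, hδ, hδO⟩ := hK.exists_cthickening_subset_open hO hKO
  have hC0 : 0 ≤ max C 0 := le_max_right _ _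
  have hK' : IsCompact (Metric.cthickening δ K) := hK.cthickening
  have hdF : ContinuousOn (fun y => fderiv ℝ F y) O := hF.continuousOn_fderiv_of_isOpen hO le_rfl
  obtain ⟨B, hB⟩ := hK'.exists_bound_of_continuousOn (hdF.mono hδO)
  -- For `|ε| < R` the perturbed values stay in the compact thickening of `K`, where the derivative
  -- of `F` is bounded. Where `c` vanishes the integrand does not depend on `ε`, so no bound on `F`
  -- is needed there.
  set R := δ / (max C 0 * ‖e‖ + 1) with hR
  have hR0 : 0 < R := by positivity
  have hmem : ∀ ε ∈ Metric.ball (0 : ℝ) R, ∀ x, c x ≠ 0 →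
      p x + ε • c x • e ∈ Metric.cthickening δ K := by
    intro ε hε x hx
    refine Metric.mem_cthickening_of_dist_le _ (p x) _ _ (hcK x hx) ?_
    rw [dist_eq_norm, add_sub_cancel_left, norm_smul, norm_smul, Real.norm_eq_abs, Real.norm_eq_abs]
    rw [mem_ball_zero_iff, Real.norm_eq_abs] at hε
    have h1 : |c x| * ‖e‖ ≤ max C 0 * ‖e‖ :=
      mul_le_mul_of_nonneg_right ((hC x).trans (le_max_left _ _)) (norm_nonneg _)
    calc |ε| * (|c x| * ‖e‖) ≤ R * (max C 0 * ‖e‖ + 1) :=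
          mul_le_mul hε.le (by linarith) (by positivity) hR0.le
      _ = δ := by rw [hR]; field_simp
  have hmemO : ∀ ε ∈ Metric.ball (0 : ℝ) R, ∀ᵐ x ∂μ, p x + ε • c x • e ∈ O := by
    intro ε hε
    filter_upwards [hpO] with x hx
    by_cases h0 : c x = 0
    · simpa [h0] using hx
    · exact hδO (hmem ε hε x h0)
  have hmeas : ∀ ε : ℝ, AEMeasurable (fun x => p x + ε • c x • e) μ := fun ε =>
    hp.add ((hc.smul_const e).const_smul ε)
  have hde : ContinuousOn (fun y => fderiv ℝ F y e) O := hdF.clm_apply continuousOn_const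
  have main := hasDerivAt_integral_of_dominated_loc_of_deriv_le (μ := μ)
    (F := fun (ε : ℝ) x => F (p x + ε • c x • e))
    (F' := fun (ε : ℝ) x => c x * fderiv ℝ F (p x + ε • c x • e) e) (x₀ := (0 : ℝ))
    (s := Metric.ball 0 R) (bound := fun _ => max C 0 * (max B 0 * ‖e‖))
    (Metric.ball_mem_nhds 0 hR0) ?_ (by simpa using hint) ?_ ?_ (integrable_const _) ?_
  · simpa using main.2
  · filter_upwards [Metric.ball_mem_nhds 0 hR0] with ε hε
    exact aestronglyMeasurable_comp_of_continuousOn hO hF.continuousOn (hmeas ε) (hmemO ε hε)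
  · simp only [zero_smul, add_zero]
    exact hc.aestronglyMeasurable.mul (aestronglyMeasurable_comp_of_continuousOn hO hde hp hpO)
  · refine Eventually.of_forall fun x ε hε => ?_
    by_cases h0 : c x = 0
    · rw [h0, zero_mul, norm_zero]
      positivity
    · have h1 := hB _ (hmem ε hε x h0)
      rw [norm_mul, Real.norm_eq_abs]
      refine mul_le_mul ((hC x).trans (le_max_left _ _)) ?_ (norm_nonneg _) hC0
      exact (ContinuousLinearMap.le_opNorm _ _).trans
        (mul_le_mul_of_nonneg_right (h1.trans (le_max_left _ _)) (norm_nonneg _))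
  · filter_upwards [hpO] with x hx ε hε
    have hy : p x + ε • c x • e ∈ O := by
      by_cases h0 : c x = 0
      · simpa [h0] using hx
      · exact hδO (hmem ε hε x h0)
    have h1 := ((hF.differentiableOn one_ne_zero).differentiableAt (hO.mem_nhds hy)).hasFDerivAt
    have h2 : HasDerivAt (fun ε : ℝ => p x + ε • c x • e) (c x • e) ε := by
      simpa using ((hasDerivAt_id ε).smul_const (c x • e)).const_add (p x)
    have h3 := h1.comp_hasDerivAt ε h2
    rw [map_smul, smul_eq_mul] at h3
    exact h3

end Localization

end Mixture

end

set_option linter.unusedSectionVars false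

noncomputable section

namespace Mixture

open MeasureTheory Filter Topology
open scoped ENNReal

variable {Ω : Set E3} {ν : ℕ}

/-! ### Localized test fields -/

/-- All components of a block vector of fields at a point. -/
abbrev Components (ν : ℕ) := Values ν × (Fin 3 → ℝ)

def Fields.components (z : Fields ν) (x : E3) : Components ν := (z.val x, fun i => z.M x i)

theorem MemW.comp_of_compactSupport (hΩ : IsOpen Ω) [IsFiniteMeasure (volume.restrict Ω)]
    {P : Type*} [NormedAddCommGroup P] [NormedSpace ℝ P] [CompleteSpace P] {p : ℝ≥0∞}
    {w : E3 → P} {W : Fin 3 → E3 → P} (hw : ∀ i, HasWeakDeriv Ω (basisVec i) w (W i))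
    (hW : ∀ i, MemLp (W i) p (volume.restrict Ω)) {η : P → ℝ} (hη : ContDiff ℝ 1 η)
    (hc : HasCompactSupport η) : MemW Ω p (fun x => η (w x)) ∧
      ∀ i, (fun x => wgrad Ω (fun x => η (w x)) x i) =ᵐ[volume.restrict Ω]
        fun x => fderiv ℝ η (w x) (W i x) := by
  obtain ⟨C, hC⟩ := (hc.fderiv (𝕜 := ℝ)).exists_bound_of_continuous
    (hη.continuous_fderiv one_ne_zero)
  obtain ⟨B, hB⟩ := hc.exists_bound_of_continuous hη.continuous
  have hcomp : ∀ i, HasWeakDeriv Ω (basisVec i) (fun x => η (w x))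
      (fun x => fderiv ℝ η (w x) (W i x)) := fun i => (hw i).comp hΩ hη hC
  have hgrad : IsWeakGradient Ω (fun x => η (w x))
      (fun x => WithLp.toLp 2 fun i => fderiv ℝ η (w x) (W i x)) :=
    isWeakGradient_of_forall fun i => hcomp i
  refine ⟨⟨?_, _, hgrad, memLp_of_coord fun i => ?_⟩, fun i => ?_⟩
  · refine MemLp.of_bound ?_ B (Eventually.of_forall fun x => hB _)
    exact (hcomp 0).loc.aestronglyMeasurable
  · refine (hW i).of_le_mul (c := C) (hcomp i).loc'.aestronglyMeasurable
      (Eventually.of_forall fun x => ?_)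
    exact (ContinuousLinearMap.le_opNorm _ _).trans
      (mul_le_mul_of_nonneg_right (hC _) (norm_nonneg _))
  · filter_upwards [hgrad.wgrad_ae hΩ] with x hx
    rw [hx]

theorem IsTest.memW_mul (hΩ : IsOpen Ω) [IsFiniteMeasure (volume.restrict Ω)] {p : ℝ≥0∞}
    (hp : 1 ≤ p) {ψ f : E3 → ℝ} (hψ : IsTest Ω ψ) (hf : MemW Ω p f) :
    MemW Ω p (fun x => ψ x * f x) := by
  obtain ⟨B, hB⟩ := hψ.compact.exists_bound_of_continuous hψ.continuous
  have hB' : ∀ i : Fin 3, ∃ C, ∀ x, ‖fderiv ℝ ψ x (basisVec i)‖ ≤ C := fun i =>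
    (hψ.compact_fderiv (basisVec i)).exists_bound_of_continuous (hψ.continuous_fderiv _)
  choose C hC using hB'
  have hG := hf.memLp_grad hΩ
  have hfg := hf.grad
  have hmul : ∀ {g h : E3 → ℝ} {K : ℝ}, Continuous g → (∀ x, ‖g x‖ ≤ K) →
      MemLp h p (volume.restrict Ω) → MemLp (fun x => g x * h x) p (volume.restrict Ω) := by
    intro g h K hg hK hh
    refine hh.of_le_mul (c := K) (hg.aestronglyMeasurable.mul hh.1) (Eventually.of_forall ?_)
    intro x
    rw [norm_mul]
    exact mul_le_mul_of_nonneg_right (hK x) (norm_nonneg _)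
  have h0 := hmul hψ.continuous hB hf.1
  have h1 : ∀ i : Fin 3, MemLp (fun x => fderiv ℝ ψ x (basisVec i) * f x) p
      (volume.restrict Ω) := fun i => hmul (hψ.continuous_fderiv _) (hC i) hf.1
  have h2 : ∀ i : Fin 3, MemLp (fun x => ψ x * wgrad Ω f x i) p (volume.restrict Ω) := fun i =>
    hmul hψ.continuous hB (memLp_coord hG i)
  have loc : ∀ {g : E3 → ℝ}, MemLp g p (volume.restrict Ω) → LocallyIntegrableOn g Ω := fun hg =>
    IntegrableOn.locallyIntegrableOn (hg.integrable hp)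
  have hw : IsWeakGradient Ω (fun x => ψ x * f x) (fun x => WithLp.toLp 2 fun i =>
      fderiv ℝ ψ x (basisVec i) * f x + ψ x * wgrad Ω f x i) :=
    isWeakGradient_of_forall fun i => (HasWeakDeriv.of_contDiff hψ.smooth).mul hΩ
      (hfg.hasWeakDeriv i) (loc h0) (loc (h1 i)) (loc (h2 i))
  exact ⟨h0, _, hw, memLp_of_coord fun i => (h1 i).add (h2 i)⟩

/-- Fields that vanish near the boundary satisfy the boundary condition. -/
theorem IsTest.normalTraceZero (hΩ : IsBoundedLipschitzDomain Ω) {ψ f : E3 → ℝ}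
    (hψ : IsTest Ω ψ) (hf : Sob Ω (1 / 3) f) (u : E3) :
    NormalTraceZero Ω (fun x => (ψ x * f x) • u) := by
  have := isFiniteMeasure_of_isBounded hΩ.2.2.1
  intro r hr g hg
  obtain ⟨s, hs, hs1, hS⟩ := hg.exists_sob hΩ hr
  have hψS : Sob Ω (1 / 3) ψ := by
    have h1 : MemW Ω 3 (fun _ : E3 => (1 : ℝ)) :=
      ⟨memLp_const _, _, .const 1, memLp_const 0⟩
    have := (hψ.memW_mul hΩ.1 (by norm_num) h1).sob_three hΩ
    simpa using this
  have hψf := hψS.mul hΩ.1 le_rfl (by norm_num) hf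
  have hfg := hf.mul hΩ.1 hs hs1 hS
  -- The Gauss-Green integrand is the divergence of `ψ (f g) u`. Its integral vanishes by the
  -- definition of the weak derivative of `f g`, with `ψ` as test function.
  have key : ∀ i : Fin 3, ∫ x in Ω, (ψ x * wgrad Ω (fun x => f x * g x) x i
      + fderiv ℝ ψ x (basisVec i) * (f x * g x)) = 0 := by
    intro i
    have h := (hfg.grad.hasWeakDeriv i).eq ψ hψ
    simp only [smul_eq_mul] at h
    rw [integral_add, h, add_neg_cancel]
    · exact (hψ.integrable_smul (hfg.grad.hasWeakDeriv i).loc').restrict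
    · exact (hψ.integrable_fderiv_smul _ (hfg.grad.hasWeakDeriv i).loc).restrict
  have e : (fun x => inner ℝ ((ψ x * f x) • u) (wgrad Ω g x)
      + g x * wdiv Ω (fun x => (ψ x * f x) • u) x) =ᵐ[volume.restrict Ω]
      fun x => ∑ i, u i * (ψ x * wgrad Ω (fun x => f x * g x) x i
        + fderiv ℝ ψ x (basisVec i) * (f x * g x)) := by
    have a1 := hf.wgrad_mul hΩ.1 hs hs1 hS
    have a2 := hψS.wgrad_mul hΩ.1 le_rfl (by norm_num) hf
    have a3 := ae_all_iff.2 fun i => (hψS.grad.hasWeakDeriv i).ae_unique hΩ.1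
      (HasWeakDeriv.of_contDiff hψ.smooth)
    have a4 : ∀ i : Fin 3, wgrad Ω (fun x => ((ψ x * f x) • u) i) =ᵐ[volume.restrict Ω]
        fun x => u i • wgrad Ω (fun x => ψ x * f x) x := by
      intro i
      have := (hψf.grad.const_mul (u i)).wgrad_ae hΩ.1
      simpa [mul_comm] using this
    filter_upwards [a1, a2, a3, ae_all_iff.2 a4] with x h1 h2 h3 h4
    rw [inner_eq_sum, wdiv_apply, Finset.mul_sum, ← Finset.sum_add_distrib]
    refine Finset.sum_congr rfl fun i _ => ?_
    rw [h4, h1, ← h3 i]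
    simp only [PiLp.add_apply, PiLp.smul_apply, smul_eq_mul, h2]
    ring
  rw [integral_congr_ae e, integral_finsetSum]
  · simp_rw [integral_const_mul, key, mul_zero, Finset.sum_const_zero]
  · intro i _
    refine Integrable.const_mul (Integrable.add ?_ ?_) _
    · exact (hψ.integrable_smul (hfg.grad.hasWeakDeriv i).loc').restrict
    · exact (hψ.integrable_fderiv_smul _ (hfg.grad.hasWeakDeriv i).loc).restrict

/-- The field with constant direction `e` and scalar amplitude `c`. -/
def directionField (c : E3 → ℝ) (e : Components ν) : Fields ν :=
  (fun α x => c x * e.1.1 α, fun x => c x • WithLp.toLp 2 e.2, fun x => c x * e.1.2)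

theorem components_add_smul_directionField (z : Fields ν) (c : E3 → ℝ) (e : Components ν) (ε : ℝ)
    (x : E3) : (z + ε • directionField c e).components x = z.components x + ε • c x • e := rfl

theorem pairing_directionField (g : Fields ν) (c : E3 → ℝ) (e : Components ν) :
    pairing Ω g (directionField c e) = ∫ x in Ω, c x *
      (∑ α, g.rho α x * e.1.1 α + ∑ i, g.M x i * e.2 i + g.e x * e.1.2) := by
  unfold pairing
  refine integral_congr_ae (Eventually.of_forall fun x => ?_)
  have hM : ∀ i, (directionField c e).M x i = c x * e.2 i := fun _ => rfl
  have hr : ∀ α, (directionField c e).rho α x = c x * e.1.1 α := fun _ => rfl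
  have he : (directionField c e).e x = c x * e.1.2 := rfl
  simp only [hM, hr, he, inner_eq_sum, mul_add, Finset.mul_sum, mul_left_comm]

variable {z : Fields ν}

/-- Weak derivatives of the components. -/
def Fields.componentDeriv (Ω : Set E3) (z : Fields ν) (i : Fin 3) (x : E3) : Components ν :=
  ((fun α => wgrad Ω (z.rho α) x i, wgrad Ω z.e x i), fun j => wgrad Ω (fun y => z.M y j) x i)

theorem hasWeakDeriv_val (hz : z ∈ phaseSpace Ω) (i : Fin 3) :
    HasWeakDeriv Ω (basisVec i) z.val (fun x => (z.componentDeriv Ω i x).1) :=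
  .prodMk (.pi fun α => (hz.1 α).grad.hasWeakDeriv i) (hz.2.2.grad.hasWeakDeriv i)

theorem hasWeakDeriv_components (hz : z ∈ phaseSpace Ω) (i : Fin 3) :
    HasWeakDeriv Ω (basisVec i) z.components (z.componentDeriv Ω i) :=
  .prodMk (hasWeakDeriv_val hz i) (.pi fun j => (hz.2.1.1 j).grad.hasWeakDeriv i)

theorem memLp_componentDeriv (hΩ : IsOpen Ω) (hz : z ∈ phaseSpace Ω) (i : Fin 3) :
    MemLp (z.componentDeriv Ω i) 3 (volume.restrict Ω) := by
  have h1 := fun α => memLp_coord ((hz.1 α).memLp_grad hΩ) i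
  have h2 := fun j => memLp_coord ((hz.2.1.1 j).memLp_grad hΩ) i
  have h3 := memLp_coord (hz.2.2.memLp_grad hΩ) i
  exact memLp_prod_iff.2 ⟨memLp_prod_iff.2 ⟨memLp_pi_iff.2 h1, h3⟩, memLp_pi_iff.2 h2⟩

theorem aemeasurable_components (hz : z ∈ phaseSpace Ω) :
    AEMeasurable z.components (volume.restrict Ω) :=
  (hasWeakDeriv_components hz 0).loc.aestronglyMeasurable.aemeasurable

theorem directionField_mem_phaseSpace (hΩ : IsBoundedLipschitzDomain Ω) {ψ f : E3 → ℝ}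
    (hψ : IsTest Ω ψ) (hf : MemW Ω 3 f) (e : Components ν) :
    directionField (fun x => ψ x * f x) e ∈ phaseSpace Ω := by
  have := isFiniteMeasure_of_isBounded hΩ.2.2.1
  have h := hψ.memW_mul hΩ.1 (by norm_num) hf
  refine ⟨fun α => ?_, ⟨fun i => ?_, hψ.normalTraceZero hΩ (hf.sob_three hΩ) _⟩, ?_⟩
  · exact (congrArg (MemW Ω 3) (funext fun x => mul_comm _ _)).mp (h.const_mul (e.1.1 α))
  · exact (congrArg (MemW Ω 3) (funext fun x => mul_comm _ _)).mp (h.const_mul (e.2 i))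
  · exact (congrArg (MemW Ω 3) (funext fun x => mul_comm _ _)).mp (h.const_mul e.1.2)

end Mixture

end

set_option linter.unusedSectionVars false

noncomputable section

namespace Mixture

open MeasureTheory Filter Topology
open scoped ENNReal

variable {Ω : Set E3} {ν : ℕ} {D : Set (Values ν)} {z : Fields ν}

/-! ### Identification of functional derivatives -/

/-- The values of the components of states at points where the mass density is positive. -/
def admissible (D : Set (Values ν)) : Set (Components ν) := {y | y.1 ∈ D ∧ 0 < ∑ α, y.1.1 α}

theorem contDiff_massOf : ContDiff ℝ 1 (fun y : Components ν => ∑ α, y.1.1 α) :=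
  ContDiff.sum fun α _ => (contDiff_apply ℝ ℝ α).comp (contDiff_fst.comp contDiff_fst)

theorem isOpen_admissible (hD : IsOpen D) : IsOpen (admissible D) :=
  (hD.preimage continuous_fst).inter (isOpen_lt continuous_const contDiff_massOf.continuous)

theorem ae_components_mem (hz : z ∈ stateSpace Ω D) :
    ∀ᵐ x ∂volume.restrict Ω, z.components x ∈ admissible D := by
  obtain ⟨-, ⟨r, hr, h1⟩, h2⟩ := hz
  filter_upwards [h1, h2] with x h1 h2
  exact ⟨h2, hr.trans_le h1⟩

/-- A bounded amplitude moves the values uniformly little, and only at points where they lie in a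
compact part of the open admissible set. For small `ε` they stay admissible, and the mass density
loses at most `r / 2`. -/
theorem eventually_mem_stateSpace (hΩ : IsBoundedLipschitzDomain Ω) (hD : IsOpen D)
    (hz : z ∈ stateSpace Ω D) {e : Components ν} {c : E3 → ℝ} {C : ℝ} (hC : ∀ x, |c x| ≤ C)
    (hc : directionField c e ∈ phaseSpace Ω) {K : Set (Components ν)} (hK : IsCompact K)
    (hKO : K ⊆ admissible D) (hcK : ∀ x, c x ≠ 0 → z.components x ∈ K) :
    ∀ᶠ ε in 𝓝 (0 : ℝ), z + ε • directionField c e ∈ stateSpace Ω D := by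
  obtain ⟨hzp, ⟨r, hr, h1⟩, h2⟩ := hz
  obtain ⟨δ, hδ, hδO⟩ := hK.exists_cthickening_subset_open (isOpen_admissible hD) hKO
  have t1 : Tendsto (fun ε : ℝ => |ε| * (|C| * ‖e‖)) (𝓝 0) (𝓝 0) := by
    have : Continuous fun ε : ℝ => |ε| * (|C| * ‖e‖) := by fun_prop
    simpa using this.tendsto 0
  have t2 : Tendsto (fun ε : ℝ => |ε| * (|C| * |∑ α, e.1.1 α|)) (𝓝 0) (𝓝 0) := by
    have : Continuous fun ε : ℝ => |ε| * (|C| * |∑ α, e.1.1 α|) := by fun_prop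
    simpa using this.tendsto 0
  have hC' : ∀ x, |c x| ≤ |C| := fun x => (hC x).trans (le_abs_self C)
  filter_upwards [t1.eventually (gt_mem_nhds hδ), t2.eventually (gt_mem_nhds (half_pos hr))]
    with ε hε1 hε2
  refine ⟨phaseSpace_add_smul hΩ hzp hc ε, ⟨r / 2, half_pos hr, ?_⟩, ?_⟩
  · filter_upwards [h1] with x hx
    have e1 : (z + ε • directionField c e).mass x = z.mass x + ε * (c x * ∑ α, e.1.1 α) := by
      simp only [Fields.mass]
      rw [Finset.mul_sum, Finset.mul_sum, ← Finset.sum_add_distrib]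
      rfl
    have e2 : |ε * (c x * ∑ α, e.1.1 α)| ≤ |ε| * (|C| * |∑ α, e.1.1 α|) := by
      rw [abs_mul, abs_mul]
      exact mul_le_mul_of_nonneg_left
        (mul_le_mul_of_nonneg_right (hC' x) (abs_nonneg _)) (abs_nonneg _)
    rw [e1]
    linarith [neg_abs_le (ε * (c x * ∑ α, e.1.1 α))]
  · filter_upwards [h2] with x hx
    by_cases h0 : c x = 0
    · have : (z + ε • directionField c e).components x = z.components x := by
        rw [components_add_smul_directionField, h0, zero_smul, smul_zero, add_zero]
      exact (congrArg (· ∈ D) (congrArg Prod.fst this)).mpr hx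
    · refine (hδO (Metric.mem_cthickening_of_dist_le _ (z.components x) _ _ (hcK x h0) ?_) :
        (z + ε • directionField c e).components x ∈ admissible D).1
      rw [components_add_smul_directionField, dist_eq_norm, add_sub_cancel_left, norm_smul,
        norm_smul, Real.norm_eq_abs, Real.norm_eq_abs]
      exact (mul_le_mul_of_nonneg_left
        (mul_le_mul_of_nonneg_right (hC' x) (norm_nonneg _)) (abs_nonneg _)).trans hε1.le

/-- `W^{1,3}` does not embed into the bounded functions, so a general direction may leave the state
space at once. Directions `ψ(x) η(z(x)) e` with `ψ` a test function and `η` a cutoff in the values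
are admissible, and along them the functional can be differentiated under the integral. Comparing
with the pairing and varying `ψ` gives the identity where `η(z) ≠ 0`, and varying `η` gives it
almost everywhere. Two integrands are kept apart because `Φ` is required as a sum of two integrals
for all `w`, where integrals need not be additive. -/
theorem HasFunctionalDeriv.ae_eq (hΩ : IsBoundedLipschitzDomain Ω) (hD : IsOpen D)
    (hz : z ∈ stateSpace Ω D) {Φ : Fields ν → ℝ} {F₁ F₂ : Components ν → ℝ}
    (hF₁ : ContDiffOn ℝ 1 F₁ (admissible D)) (hF₂ : ContDiffOn ℝ 1 F₂ (admissible D))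
    (hi₁ : IntegrableOn (fun x => F₁ (z.components x)) Ω)
    (hi₂ : IntegrableOn (fun x => F₂ (z.components x)) Ω)
    (hΦ : ∀ w, Φ w = (∫ x in Ω, F₁ (w.components x)) + ∫ x in Ω, F₂ (w.components x))
    {g : Fields ν} (hg : g ∈ phaseSpace Ω)
    (h : HasFunctionalDeriv Ω (stateSpace Ω D) Φ z g) (e : Components ν) :
    ∀ᵐ x ∂volume.restrict Ω, ∑ α, g.rho α x * e.1.1 α + ∑ i, g.M x i * e.2 i + g.e x * e.1.2
      = fderiv ℝ F₁ (z.components x) e + fderiv ℝ F₂ (z.components x) e := by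
  have hfin := isFiniteMeasure_of_isBounded hΩ.2.2.1
  have hO := isOpen_admissible hD
  have hpO := ae_components_mem hz
  have hp := aemeasurable_components hz.1
  have hd : ∀ {F : Components ν → ℝ}, ContDiffOn ℝ 1 F (admissible D) →
      ContinuousOn (fun y => fderiv ℝ F y e) (admissible D) := fun hF =>
    (hF.continuousOn_fderiv_of_isOpen hO le_rfl).clm_apply continuousOn_const
  set q : E3 → ℝ := fun x =>
    ∑ α, g.rho α x * e.1.1 α + ∑ i, g.M x i * e.2 i + g.e x * e.1.2 with hq
  have hqint : IntegrableOn q Ω := by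
    have hi : ∀ {f : E3 → ℝ}, MemW Ω 3 f → IntegrableOn f Ω := fun hf =>
      hf.1.integrable (by norm_num)
    refine Integrable.add (Integrable.add ?_ ?_) ((hi hg.2.2).mul_const _)
    · exact integrable_finsetSum _ fun α _ => (hi (hg.1 α)).mul_const _
    · exact integrable_finsetSum _ fun i _ => (hi (hg.2.1.1 i)).mul_const _
  refine ae_of_forall_bump hO hpO fun η hη hηc hηO => ?_
  obtain ⟨Cη, hCη⟩ := hηc.exists_bound_of_continuous hη.continuous
  have hfd := fun i => memLp_componentDeriv hΩ.1 hz.1 i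
  have hηw := (MemW.comp_of_compactSupport hΩ.1 (hasWeakDeriv_components hz.1) hfd
    (hη.of_le (by simp)) hηc).1
  have hηm : AEMeasurable (fun x => η (z.components x)) (volume.restrict Ω) :=
    hη.continuous.measurable.comp_aemeasurable hp
  have hdi : ∀ {F : Components ν → ℝ}, ContDiffOn ℝ 1 F (admissible D) →
      IntegrableOn (fun x => η (z.components x) * fderiv ℝ F (z.components x) e) Ω := by
    intro F hF
    obtain ⟨B, hB⟩ := hηc.exists_bound_of_continuousOn ((hd hF).mono hηO)
    refine Integrable.of_bound (C := Cη * |B|) (hηm.aestronglyMeasurable.mul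
      (aestronglyMeasurable_comp_of_continuousOn hO (hd hF) hp hpO))
      (Eventually.of_forall fun x => ?_)
    by_cases h0 : η (z.components x) = 0
    · have := (norm_nonneg _).trans (hCη (z.components x))
      rw [h0, zero_mul, norm_zero]
      positivity
    · rw [norm_mul]
      have h1 := hB _ (subset_tsupport η h0)
      exact mul_le_mul (hCη _) (h1.trans (le_abs_self B)) (norm_nonneg _)
        ((norm_nonneg _).trans (hCη (z.components x)))
  have hηq : IntegrableOn (fun x => η (z.components x) * q x) Ω :=
    Integrable.bdd_mul hqint hηm.aestronglyMeasurable
      (Eventually.of_forall fun x => hCη (z.components x))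
  set f : E3 → ℝ := fun x => η (z.components x) * q x
    - (η (z.components x) * fderiv ℝ F₁ (z.components x) e
      + η (z.components x) * fderiv ℝ F₂ (z.components x) e) with hf
  have hfint : IntegrableOn f Ω := hηq.sub ((hdi hF₁).add (hdi hF₂))
  have hzero : ∀ᵐ x, x ∈ Ω → f x = 0 := by
    refine hΩ.1.ae_eq_zero_of_integral_contDiff_smul_eq_zero hfint.locallyIntegrableOn
      fun ψ hψ1 hψ2 hψ3 => ?_
    have hψ : IsTest Ω ψ := ⟨hψ1, hψ2, hψ3⟩
    obtain ⟨Cψ, hCψ⟩ := hψ2.exists_bound_of_continuous hψ1.continuous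
    set c : E3 → ℝ := fun x => ψ x * η (z.components x) with hcdef
    have hC : ∀ x, |c x| ≤ Cψ * Cη := fun x => by
      rw [hcdef, abs_mul]
      exact mul_le_mul (hCψ x) (hCη _) (abs_nonneg _) ((norm_nonneg _).trans (hCψ x))
    have hcK : ∀ x, c x ≠ 0 → z.components x ∈ tsupport η := fun x hx =>
      subset_tsupport η (right_ne_zero_of_mul hx)
    have hcm : AEMeasurable c (volume.restrict Ω) :=
      hψ1.continuous.measurable.aemeasurable.mul hηm
    have hmem := directionField_mem_phaseSpace hΩ hψ hηw e
    have d0 := h _ hmem (eventually_mem_stateSpace hΩ hD hz hC hmem hηc hηO hcK)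
    have d1 := hasDerivAt_integral_perturbation hO hηc hηO hF₁ hp hpO hi₁ hcm hC hcK e
    have d2 := hasDerivAt_integral_perturbation hO hηc hηO hF₂ hp hpO hi₂ hcm hC hcK e
    have d3 : HasDerivAt (fun ε : ℝ => Φ (z + ε • directionField c e))
        ((∫ x in Ω, c x * fderiv ℝ F₁ (z.components x) e)
          + ∫ x in Ω, c x * fderiv ℝ F₂ (z.components x) e) 0 := by
      simp only [hΦ, components_add_smul_directionField]
      exact d1.add d2
    have key := d0.unique d3
    rw [pairing_directionField] at key
    rw [← setIntegral_smul_of_tsupport_subset (Ω := Ω) hψ3]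
    have hs : ∀ {k : E3 → ℝ}, IntegrableOn k Ω → IntegrableOn (fun x => ψ x * k x) Ω := fun hk =>
      Integrable.bdd_mul hk hψ1.continuous.aestronglyMeasurable (Eventually.of_forall hCψ)
    have e1 : ∫ x in Ω, ψ x • f x = (∫ x in Ω, c x * q x)
        - ((∫ x in Ω, c x * fderiv ℝ F₁ (z.components x) e)
          + ∫ x in Ω, c x * fderiv ℝ F₂ (z.components x) e) := by
      simp only [hcdef, mul_assoc]
      rw [← integral_add (hs (hdi hF₁)) (hs (hdi hF₂)), ← integral_sub (hs hηq)]
      · refine integral_congr_ae (Eventually.of_forall fun x => ?_)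
        simp only [hf, smul_eq_mul]
        ring
      · exact (hs (hdi hF₁)).add (hs (hdi hF₂))
    rw [e1, key, sub_self]
  rw [← ae_restrict_iff' hΩ.1.measurableSet] at hzero
  filter_upwards [hzero] with x hx hne
  have : η (z.components x) * (q x - (fderiv ℝ F₁ (z.components x) e
      + fderiv ℝ F₂ (z.components x) e)) = 0 := by
    rw [← hx]
    simp only [hf]
    ring
  exact sub_eq_zero.1 ((mul_eq_zero.1 this).resolve_left hne)

end Mixture

end

set_option linter.unusedSectionVars false

noncomputable section

namespace Mixture

open MeasureTheory Filter Topology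
open scoped ENNReal

variable {Ω : Set E3} {ν n : ℕ} {D : Set (Values ν)} {z : Fields ν} {rep : Representation}
  {pot : Values ν → ℝ} {c : Coefficients ν n}

/-! ### Regular states and the integrability of energy and entropy densities. -/

theorem LpBelow.inner {s t : ℝ} {G H : E3 → E3} (hs : 0 ≤ s) (ht : 0 ≤ t) (h : LpBelow Ω s G)
    (h' : LpBelow Ω t H) : LpBelow Ω (s + t) (fun x => inner ℝ (G x) (H x)) := by
  simp only [inner_eq_sum]
  exact .sum _ fun i _ => (h.coord i).mul hs ht (h'.coord i)

theorem LpBelow.smul {s t : ℝ} {f : E3 → ℝ} {G : E3 → E3} (hs : 0 ≤ s) (ht : 0 ≤ t)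
    (h : LpBelow Ω s f) (h' : LpBelow Ω t G) : LpBelow Ω (s + t) (fun x => f x • G x) :=
  .of_coord fun i => h.mul hs ht (h'.coord i)

theorem Sob.lp_wgrad {s : ℝ} {f : E3 → ℝ} (h : Sob Ω s f) : LpBelow Ω s (wgrad Ω f) :=
  .of_coord h.lpGrad

/-- The regularity of a state and of the constitutive functions at it, in terms of two exponents:
`s` for the pressure and the reaction coefficients, `k` for the transport coefficients. -/
structure Regular (rep : Representation) (pot : Values ν → ℝ) (c : Coefficients ν n)
    (Ω : Set E3) (s k : ℝ) (z : Fields ν) : Prop where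
  le_s : 1 / 3 ≤ s
  s_lt : s < 1
  k_nonneg : 0 ≤ k
  k_lt : k < 1 / 3
  rho : ∀ α, Sob Ω (1 / 3) (z.rho α)
  M : ∀ i, Sob Ω (1 / 3) (fun x => z.M x i)
  e : Sob Ω (1 / 3) z.e
  temp_pos : ∀ᵐ x ∂volume.restrict Ω, 0 < temp rep pot (z.val x)
  temp : Sob Ω (1 / 3) (fun x => temp rep pot (z.val x))
  invTemp : Sob Ω (1 / 3) (fun x => 1 / Mixture.temp rep pot (z.val x))
  chem : ∀ α, Sob Ω (1 / 3) (fun x => chem rep pot α (z.val x))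
  chemTemp : ∀ α, Sob Ω (1 / 3) (fun x => Mixture.chem rep pot α (z.val x) /
    Mixture.temp rep pot (z.val x))
  pressure : Sob Ω s (fun x => pressure rep pot (z.val x))
  bL : ∀ α, Sob Ω s (fun x => c.bL α (z.val x))
  bLL : ∀ α β, LpBelow Ω s (fun x => c.bLL α β (z.val x))
  lam : LpBelow Ω k (fun x => c.lam (z.val x))
  kappa : LpBelow Ω k (fun x => c.kappa (z.val x))
  zeta : LpBelow Ω k (fun x => c.zeta (z.val x))
  B : ∀ α, LpBelow Ω k (fun x => c.B α (z.val x))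
  BB : ∀ α β, LpBelow Ω k (fun x => c.BB α β (z.val x))

theorem WellBehaved.exists_regular (hΩ : IsBoundedLipschitzDomain Ω) {ε : ℝ} (hε : 0 < ε)
    (hz : z ∈ phaseSpace Ω) (h : WellBehaved rep pot c Ω ε z) :
    ∃ s k, Regular rep pot c Ω s k z := by
  have := isFiniteMeasure_of_isBounded hΩ.2.2.1
  obtain ⟨s, hs, hs1, hps, hS⟩ := exists_sob_of_memW hΩ (p := 1 + ε) (by linarith)
  have hk : ∀ {f : E3 → ℝ}, MemLp f (ENNReal.ofReal (3 + ε)) (volume.restrict Ω) →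
      LpBelow Ω (1 / (3 + ε)) f := fun hf => .of_memLp (by linarith) hf
  exact ⟨s, 1 / (3 + ε), {
    le_s := hs
    s_lt := hs1
    k_nonneg := by positivity
    k_lt := one_div_lt_one_div_of_lt (by norm_num) (by linarith)
    rho := fun α => (hz.1 α).sob_three hΩ
    M := fun i => (hz.2.1.1 i).sob_three hΩ
    e := hz.2.2.sob_three hΩ
    temp_pos := h.temp_pos
    temp := h.temp.sob_three hΩ
    invTemp := h.invTemp.sob_three hΩ
    chem := fun α => (h.chem α).sob_three hΩ
    chemTemp := fun α => (h.chemTemp α).sob_three hΩ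
    pressure := hS _ h.pressure
    bL := fun α => hS _ (h.bL α)
    bLL := fun α β => (LpBelow.of_memLp (by linarith) (h.bLL α β)).mono hps
    lam := hk h.lam
    kappa := hk h.kappa
    zeta := hk h.zeta
    B := fun α => hk (h.B α)
    BB := fun α β => hk (h.BB α β) }⟩

namespace Regular

variable {s k : ℝ}

/-- The potential, composed with the state, is a Sobolev function. -/
theorem uDens_energy (hΩ : IsOpen Ω) (h : Regular .energy pot c Ω s k z) :
    Sob Ω s (fun x => pot (z.val x)) := by
  -- Without growth bounds on the potential, its regularity has to come from that of the pressure: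
  -- the definition of `p` is solved for `u = T s + ∑ ρ_α μ_α - p`.
  have h1 : Sob Ω s (fun x => Mixture.temp .energy pot (z.val x) * z.e x) :=
    h.temp.mul hΩ h.le_s h.s_lt (h.e.mono h.le_s)
  have h2 : Sob Ω s (fun x => ∑ α, z.rho α x * Mixture.chem .energy pot α (z.val x)) :=
    .sum hΩ _ fun α _ => (h.rho α).mul hΩ h.le_s h.s_lt ((h.chem α).mono h.le_s)
  refine ((h1.add hΩ h2).sub hΩ h.pressure).congr hΩ (Eventually.of_forall fun x => ?_)
  simp only [Mixture.pressure, uDens, sDens, Fields.val]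
  ring

/-- The definition of the pressure is solved for `s = (p + u - ∑ ρ_α μ_α) / T`, which is possible
where `T > 0`. -/
theorem sDens_entropy (hΩ : IsOpen Ω) (h : Regular .entropy pot c Ω s k z) :
    Sob Ω s (fun x => pot (z.val x)) := by
  have h2 : Sob Ω s (fun x => ∑ α, z.rho α x * Mixture.chem .entropy pot α (z.val x)) :=
    .sum hΩ _ fun α _ => (h.rho α).mul hΩ h.le_s h.s_lt ((h.chem α).mono h.le_s)
  refine (h.invTemp.mul hΩ h.le_s h.s_lt
    ((h.pressure.add hΩ (h.e.mono h.le_s)).sub hΩ h2)).congr hΩ ?_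
  filter_upwards [h.temp_pos] with x hx
  simp only [Mixture.pressure, uDens, sDens, Fields.val] at hx ⊢
  field_simp
  ring

theorem integrable_uDens (hΩ : IsOpen Ω) (h : Regular rep pot c Ω s k z) :
    IntegrableOn (fun x => uDens rep pot (z.val x)) Ω := by
  have hs := h.s_lt
  cases rep with
  | energy => exact (h.uDens_energy hΩ).lp.integrable (by linarith)
  | entropy => exact h.e.lp.integrable (by norm_num)

theorem integrable_sDens (hΩ : IsOpen Ω) (h : Regular rep pot c Ω s k z) :
    IntegrableOn (fun x => sDens rep pot (z.val x)) Ω := by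
  have hs := h.s_lt
  cases rep with
  | energy => exact h.e.lp.integrable (by norm_num)
  | entropy => exact (h.sDens_entropy hΩ).lp.integrable (by linarith)

end Regular

/-! ### The functional derivatives of the energy and of the entropy -/

theorem fderiv_apply_eq_sum (F : Values ν → ℝ) (y e : Values ν) :
    fderiv ℝ F y e = ∑ α, dRho F α y * e.1 α + dE F y * e.2 := by
  have he : e = ∑ α, e.1 α • ((Pi.single α 1, 0) : Values ν) + e.2 • ((0, 1) : Values ν) := by
    refine Prod.ext ?_ ?_
    · funext β
      simp [Prod.fst_sum, Finset.sum_apply, Pi.single_apply]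
    · simp [Prod.snd_sum]
  conv_lhs => rw [he]
  simp only [map_add, map_sum, map_smul, smul_eq_mul, dRho, dE, mul_comm]

/-- The kinetic energy density as a function of the components. -/
def kinetic (y : Components ν) : ℝ := (∑ i, y.2 i * y.2 i) / (2 * ∑ α, y.1.1 α)

theorem contDiff_momentumSq : ContDiff ℝ 1 (fun y : Components ν => ∑ i, y.2 i * y.2 i) :=
  ContDiff.sum fun i _ => ((contDiff_apply ℝ ℝ i).comp contDiff_snd).mul
    ((contDiff_apply ℝ ℝ i).comp contDiff_snd)

theorem contDiffOn_kinetic : ContDiffOn ℝ 1 (kinetic (ν := ν)) (admissible D) :=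
  contDiff_momentumSq.contDiffOn.div (contDiff_const.mul contDiff_massOf).contDiffOn
    fun _ hy => (mul_pos two_pos hy.2).ne'

/-- The differential of `|M|² / (2ρ)` is `v · dM - |v|²/2 dρ`. It is computed along the line in
direction `e`, where the one-variable quotient rule suffices. -/
theorem fderiv_kinetic {y : Components ν} (hy : 0 < ∑ α, y.1.1 α) (e : Components ν) :
    fderiv ℝ kinetic y e = (∑ i, y.2 i / (∑ α, y.1.1 α) * e.2 i)
      - (∑ i, y.2 i / (∑ α, y.1.1 α) * (y.2 i / (∑ α, y.1.1 α))) / 2 * ∑ α, e.1.1 α := by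
  have hd : DifferentiableAt ℝ (kinetic (ν := ν)) y :=
    (contDiffOn_kinetic (D := Set.univ)).differentiableOn one_ne_zero |>.differentiableAt
      ((isOpen_admissible isOpen_univ).mem_nhds ⟨trivial, hy⟩)
  have hline : HasDerivAt (fun t : ℝ => y + t • e) e 0 := by
    simpa using ((hasDerivAt_id (0 : ℝ)).smul_const e).const_add y
  have h1 : HasDerivAt (fun t : ℝ => kinetic (y + t • e)) (fderiv ℝ kinetic y e) 0 := by
    have h0 : HasFDerivAt (kinetic (ν := ν)) (fderiv ℝ kinetic y) (y + (0 : ℝ) • e) := by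
      simpa using hd.hasFDerivAt
    exact h0.comp_hasDerivAt (0 : ℝ) hline
  have hi : ∀ i, HasDerivAt (fun t : ℝ => y.2 i + t * e.2 i) (e.2 i) 0 := fun i => by
    simpa using ((hasDerivAt_id (0 : ℝ)).mul_const (e.2 i)).const_add (y.2 i)
  have hα : ∀ α, HasDerivAt (fun t : ℝ => y.1.1 α + t * e.1.1 α) (e.1.1 α) 0 := fun α => by
    simpa using ((hasDerivAt_id (0 : ℝ)).mul_const (e.1.1 α)).const_add (y.1.1 α)
  have hn := HasDerivAt.fun_sum (u := Finset.univ) fun i _ => (hi i).mul (hi i)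
  have hm := (HasDerivAt.fun_sum (u := Finset.univ) fun α _ => hα α).const_mul (2 : ℝ)
  have h2 := hn.div hm (by simpa using hy.ne')
  rw [show fderiv ℝ kinetic y e = _ from h1.unique h2]
  simp only [zero_mul, add_zero, Pi.mul_apply]
  set m := ∑ α, y.1.1 α
  have e1 : ∑ i, (e.2 i * y.2 i + y.2 i * e.2 i) = 2 * ∑ i, y.2 i * e.2 i := by
    rw [Finset.mul_sum]
    exact Finset.sum_congr rfl fun i _ => by ring
  have e2 : ∑ i, y.2 i / m * e.2 i = (∑ i, y.2 i * e.2 i) / m := by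
    rw [Finset.sum_div]
    exact Finset.sum_congr rfl fun i _ => by ring
  have e3 : ∑ i, y.2 i / m * (y.2 i / m) = (∑ i, y.2 i * y.2 i) / m ^ 2 := by
    rw [Finset.sum_div]
    exact Finset.sum_congr rfl fun i _ => by ring
  rw [e1, e2, e3]
  field_simp

theorem vel_apply (z : Fields ν) (x : E3) (i : Fin 3) : z.vel x i = z.M x i / z.mass x := by
  simp [Fields.vel, div_eq_inv_mul]

theorem integrable_kinetic (hz : z ∈ stateSpace Ω D) (hM : ∀ i, Sob Ω (1 / 3) fun x => z.M x i) :
    IntegrableOn (fun x => kinetic (z.components x)) Ω := by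
  obtain ⟨hzp, ⟨r, hr, h1⟩, -⟩ := hz
  have hsq : IntegrableOn (fun x => ∑ i, z.M x i * z.M x i) Ω :=
    integrable_finsetSum _ fun i _ => ((hM i).lp_zero.mul le_rfl le_rfl
      (hM i).lp_zero).integrable (by norm_num)
  have hm : AEMeasurable (fun x => 2 * z.mass x) (volume.restrict Ω) :=
    ((contDiff_massOf.continuous.measurable.comp_aemeasurable
      (aemeasurable_components hzp)).const_mul 2)
  have := Integrable.bdd_mul (c := (2 * r)⁻¹) hsq hm.inv.aestronglyMeasurable (by
    filter_upwards [h1] with x hx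
    have hp : 0 < z.mass x := hr.trans_le hx
    rw [Pi.inv_apply, norm_inv, Real.norm_eq_abs, abs_of_pos (by positivity)]
    gcongr)
  refine this.congr (Eventually.of_forall fun x => ?_)
  simp only [Pi.inv_apply, kinetic, Fields.components, Fields.val, Fields.mass]
  rw [inv_mul_eq_div]

theorem contDiffOn_comp_fst {F : Values ν → ℝ} (hF : ContDiffOn ℝ 1 F D) :
    ContDiffOn ℝ 1 (fun y : Components ν => F y.1) (admissible D) :=
  hF.comp contDiff_fst.contDiffOn fun _ hy => hy.1

theorem fderiv_comp_fst_apply (hD : IsOpen D) {F : Values ν → ℝ} (hF : ContDiffOn ℝ 1 F D)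
    {y : Components ν} (hy : y.1 ∈ D) (e : Components ν) :
    fderiv ℝ (fun y : Components ν => F y.1) y e
      = ∑ α, dRho F α y.1 * e.1.1 α + dE F y.1 * e.1.2 := by
  have h1 := ((hF.differentiableOn one_ne_zero).differentiableAt (hD.mem_nhds hy)).hasFDerivAt
  have h2 := h1.comp y (hasFDerivAt_fst (p := y))
  rw [show fderiv ℝ (fun y : Components ν => F y.1) y = _ from h2.fderiv, ← fderiv_apply_eq_sum]
  rfl

theorem contDiffOn_uDens (hpot : ContDiffOn ℝ 1 pot D) : ContDiffOn ℝ 1 (uDens rep pot) D := by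
  cases rep with
  | energy => exact hpot
  | entropy => exact contDiff_snd.contDiffOn

theorem contDiffOn_sDens (hpot : ContDiffOn ℝ 1 pot D) : ContDiffOn ℝ 1 (sDens rep pot) D := by
  cases rep with
  | energy => exact contDiff_snd.contDiffOn
  | entropy => exact hpot

/-- The functional derivative of the total energy. -/
theorem energyDeriv_ae_eq {s k : ℝ} (hΩ : IsBoundedLipschitzDomain Ω) (hD : IsOpen D)
    (hpot : ContDiffOn ℝ 1 pot D) (hz : z ∈ stateSpace Ω D) (hr : Regular rep pot c Ω s k z)
    {g : Fields ν} (hg : g ∈ phaseSpace Ω)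
    (h : HasFunctionalDeriv Ω (stateSpace Ω D) (totalEnergy rep pot Ω) z g) :
    ∀ᵐ x ∂volume.restrict Ω, (∀ α, g.rho α x = dRho (uDens rep pot) α (z.val x)
      - (∑ i, z.vel x i * z.vel x i) / 2) ∧ g.M x = z.vel x
      ∧ g.e x = dE (uDens rep pot) (z.val x) := by
  have hu := contDiffOn_uDens (rep := rep) hpot
  have key := h.ae_eq (F₁ := kinetic) (F₂ := fun y => uDens rep pot y.1) hΩ hD hz
    contDiffOn_kinetic (contDiffOn_comp_fst hu) (integrable_kinetic hz hr.M)
    (hr.integrable_uDens hΩ.1) (fun w => by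
      simp only [totalEnergy, inner_eq_sum]
      rfl) hg
  filter_upwards [ae_components_mem hz,
    ae_all_iff.2 fun α => key ((Pi.single α 1, 0), 0),
    ae_all_iff.2 fun i => key ((0, 0), Pi.single i 1), key ((0, 1), 0)] with x hx h1 h2 h3
  have hpos : 0 < ∑ α, (z.components x).1.1 α := hx.2
  have hv : ∀ i, (z.components x).2 i / (∑ α, (z.val x).1 α) = z.vel x i := fun i =>
    (vel_apply z x i).symm
  have hval : (z.components x).1 = z.val x := rfl
  simp only [fderiv_kinetic hpos, fderiv_comp_fst_apply hD hu hx.1, hv, hval] at h1 h2 h3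
  refine ⟨fun α => ?_, ?_, ?_⟩
  · have := h1 α
    simp only [Pi.single_apply, mul_ite, mul_one, mul_zero, Finset.sum_ite_eq', Finset.mem_univ,
      if_true, Pi.zero_apply, Finset.sum_const_zero, add_zero, zero_sub] at this
    rw [this]
    ring
  · ext i
    have := h2 i
    simpa [Pi.single_apply] using this
  · simpa using h3

/-- The functional derivative of the total entropy. -/
theorem entropyDeriv_ae_eq {s k : ℝ} (hΩ : IsBoundedLipschitzDomain Ω) (hD : IsOpen D)
    (hpot : ContDiffOn ℝ 1 pot D) (hz : z ∈ stateSpace Ω D) (hr : Regular rep pot c Ω s k z)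
    {g : Fields ν} (hg : g ∈ phaseSpace Ω)
    (h : HasFunctionalDeriv Ω (stateSpace Ω D) (totalEntropy rep pot Ω) z g) :
    ∀ᵐ x ∂volume.restrict Ω, (∀ α, g.rho α x = dRho (sDens rep pot) α (z.val x)) ∧ g.M x = 0
      ∧ g.e x = dE (sDens rep pot) (z.val x) := by
  have hu := contDiffOn_sDens (rep := rep) hpot
  have key := h.ae_eq (F₁ := fun _ => 0) (F₂ := fun y => sDens rep pot y.1) hΩ hD hz
    contDiffOn_const (contDiffOn_comp_fst hu) integrableOn_zero
    (hr.integrable_sDens hΩ.1) (fun w => by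
      simp only [totalEntropy, integral_zero, zero_add]
      rfl) hg
  filter_upwards [ae_components_mem hz,
    ae_all_iff.2 fun α => key ((Pi.single α 1, 0), 0),
    ae_all_iff.2 fun i => key ((0, 0), Pi.single i 1), key ((0, 1), 0)] with x hx h1 h2 h3
  have hval : (z.components x).1 = z.val x := rfl
  simp only [fderiv_comp_fst_apply hD hu hx.1, hval] at h1 h2 h3
  refine ⟨fun α => ?_, ?_, ?_⟩
  · simpa [Pi.single_apply] using h1 α
  · ext i
    simpa [Pi.single_apply] using h2 i
  · simpa using h3

end Mixture

end

set_option linter.unusedSectionVars false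

noncomputable section

namespace Mixture

open MeasureTheory Filter Topology
open scoped ENNReal

variable {Ω : Set E3} {ν n : ℕ} {D : Set (Values ν)} {z : Fields ν} {pot : Values ν → ℝ}
  {c : Coefficients ν n}

/-! ### The Gibbs-Duhem relation -/

theorem contDiff_mul_of_tsupport_subset {P : Type*} [NormedAddCommGroup P] [NormedSpace ℝ P]
    {O : Set P} (hO : IsOpen O) {η F : P → ℝ} (hη : ContDiff ℝ 1 η) (hηO : tsupport η ⊆ O)
    (hF : ContDiffOn ℝ 1 F O) : ContDiff ℝ 1 (fun y => η y * F y) := by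
  rw [contDiff_iff_contDiffAt]
  intro y
  by_cases hy : y ∈ tsupport η
  · exact hη.contDiffAt.mul (hF.contDiffAt (hO.mem_nhds (hηO hy)))
  · refine (contDiffAt_const (c := (0 : ℝ))).congr_of_eventuallyEq ?_
    filter_upwards [(isClosed_tsupport η).isOpen_compl.mem_nhds hy] with q hq
    rw [image_eq_zero_of_notMem_tsupport hq, zero_mul]

/-- The chain rule for a potential which is only known to be a Sobolev function after composition
with the state. -/
theorem wgrad_comp_val (hΩ : IsBoundedLipschitzDomain Ω) (hD : IsOpen D)
    (hpot : ContDiffOn ℝ 1 pot D) (hz : z ∈ stateSpace Ω D) {s : ℝ} (hs : 1 / 3 ≤ s) (hs1 : s < 1)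
    (hu : Sob Ω s fun x => pot (z.val x)) :
    ∀ᵐ x ∂volume.restrict Ω, ∀ i, wgrad Ω (fun x => pot (z.val x)) x i
      = ∑ α, dRho pot α (z.val x) * wgrad Ω (z.rho α) x i
        + dE pot (z.val x) * wgrad Ω z.e x i := by
  have := isFiniteMeasure_of_isBounded hΩ.2.2.1
  refine ae_of_forall_bump hD hz.2.2 fun η hη hηc hηD => ?_
  have hη1 : ContDiff ℝ 1 η := hη.of_le (by simp)
  have hW : ∀ i, MemLp (fun x => (z.componentDeriv Ω i x).1) 3 (volume.restrict Ω) := fun i =>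
    (memLp_prod_iff.1 (memLp_componentDeriv hΩ.1 hz.1 i)).1
  -- The gradient of `(η pot)(z)` is computed twice: by the chain rule, since `η pot` is C¹ with
  -- compact support, and by the product rule, since both `η(z)` and `pot(z)` are Sobolev functions.
  -- The terms with the derivative of `η` cancel and `η` times the claim remains.
  have hηF := contDiff_mul_of_tsupport_subset hD hη1 hηD hpot
  have hc := hasWeakDeriv_val hz.1
  obtain ⟨m1, g1⟩ := MemW.comp_of_compactSupport hΩ.1 hc hW hη1 hηc
  obtain ⟨-, g2⟩ := MemW.comp_of_compactSupport hΩ.1 hc hW hηF (hηc.mul_right (f' := pot))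
  have g3 := (m1.sob_three hΩ).wgrad_mul hΩ.1 hs hs1 hu
  filter_upwards [ae_all_iff.2 g1, ae_all_iff.2 g2, g3, hz.2.2] with x h1 h2 h3 hx hne i
  have e2 := h2 i
  rw [h3] at e2
  simp only [PiLp.add_apply, PiLp.smul_apply, smul_eq_mul, h1 i] at e2
  have d1 : DifferentiableAt ℝ η (z.val x) := hη1.differentiable one_ne_zero _
  have d2 : DifferentiableAt ℝ pot (z.val x) :=
    (hpot.differentiableOn one_ne_zero).differentiableAt (hD.mem_nhds hx)
  rw [fderiv_fun_mul d1 d2] at e2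
  simp only [add_apply, smul_apply, smul_eq_mul] at e2
  have e3 : η (z.val x) * (wgrad Ω (fun x => pot (z.val x)) x i
      - fderiv ℝ pot (z.val x) (z.componentDeriv Ω i x).1) = 0 := by linarith
  rw [sub_eq_zero.1 ((mul_eq_zero.1 e3).resolve_left hne), fderiv_apply_eq_sum]
  rfl

/-- Differentiating `p = -u + T s + ∑ ρ_α μ_α`, the terms `T ∇s + ∑ μ_α ∇ρ_α` cancel against `∇u`.
Only the energy representation needs this, since in the other one the pressure appears in the
Poisson bracket itself. -/
theorem gibbs_duhem {s k : ℝ} (hΩ : IsBoundedLipschitzDomain Ω) (hD : IsOpen D)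
    (hpot : ContDiffOn ℝ 1 pot D) (hz : z ∈ stateSpace Ω D)
    (hr : Regular .energy pot c Ω s k z) :
    ∀ᵐ x ∂volume.restrict Ω, ∀ i, wgrad Ω (fun x => pressure .energy pot (z.val x)) x i
      = ∑ α, z.rho α x * wgrad Ω (fun x => chem .energy pot α (z.val x)) x i
        + z.e x * wgrad Ω (fun x => temp .energy pot (z.val x)) x i := by
  have hs := hr.le_s
  have hs1 := hr.s_lt
  have hu := hr.uDens_energy hΩ.1
  have he := hr.e.mono hs
  have hTs := hr.temp.mul hΩ.1 hs hs1 he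
  have hμ := fun α => (hr.chem α).mono hs
  have hρμ := fun α => (hr.rho α).mul hΩ.1 hs hs1 (hμ α)
  have hgrad := (((hu.grad.neg).add hTs.grad).add (IsWeakGradient.sum Finset.univ
    fun α _ => (hρμ α).grad)).wgrad_ae hΩ.1
  filter_upwards [hgrad, hr.temp.wgrad_mul hΩ.1 hs hs1 he,
    ae_all_iff.2 fun α => (hr.rho α).wgrad_mul hΩ.1 hs hs1 (hμ α),
    wgrad_comp_val hΩ hD hpot hz hs hs1 hu] with x h1 h2 h3 h4 i
  have e1 : wgrad Ω (fun x => pressure .energy pot (z.val x)) x = _ := h1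
  rw [e1, h2]
  simp only [h3, PiLp.add_apply, PiLp.neg_apply, PiLp.smul_apply, smul_eq_mul, h4 i,
    WithLp.ofLp_sum, Finset.sum_apply, Finset.sum_add_distrib]
  have e2 : ∀ α, dRho pot α (z.val x) = chem .energy pot α (z.val x) := fun α => rfl
  have e3 : dE pot (z.val x) = temp .energy pot (z.val x) := rfl
  simp only [e2, e3]
  ring

end Mixture

end

set_option linter.unusedSectionVars false

noncomputable section

namespace Mixture

open MeasureTheory Filter Topology
open scoped ENNReal

variable {Ω : Set E3} {ν n : ℕ} {D : Set (Values ν)} {z φ g h : Fields ν} {rep : Representation}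
  {pot : Values ν → ℝ} {c : Coefficients ν n} {s k : ℝ}

/-! ### The dissipation bracket with the entropy -/

/-- The integrand of the dissipation bracket with the entropy, in terms of fluxes. -/
def dissipationForm (rep : Representation) (pot : Values ν → ℝ) (c : Coefficients ν n)
    (Ω : Set E3) (z φ : Fields ν) (x : E3) : ℝ :=
  inner ℝ (heatFlux rep pot c Ω z x) (wgrad Ω (thermalPart rep pot z φ) x)
    + ∑ α, inner ℝ (diffFlux rep pot c Ω z α x) (wgrad Ω (chemPart rep pot z φ α) x)
    - dcontr (viscousStress c Ω z x) (jac Ω φ.M x)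
    + thermalPart rep pot z φ x * dcontr (viscousStress c Ω z x) (jac Ω z.vel x)
    - ∑ α, chemPart rep pot z φ α x * ∑ β, c.bLL α β (z.val x) * chem rep pot β (z.val x)

theorem sob_thermalPart (hΩ : IsBoundedLipschitzDomain Ω) (hr : Regular rep pot c Ω s k z)
    (hφ : φ ∈ phaseSpace Ω) : Sob Ω (1 / 3) (thermalPart rep pot z φ) := by
  cases rep with
  | energy => exact hr.invTemp.mul hΩ.1 le_rfl (by norm_num) (hφ.2.2.sob_three hΩ)
  | entropy => exact hφ.2.2.sob_three hΩ

theorem sob_chemPart (hΩ : IsBoundedLipschitzDomain Ω) (hr : Regular rep pot c Ω s k z)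
    (hφ : φ ∈ phaseSpace Ω) (α : Fin ν) : Sob Ω (1 / 3) (chemPart rep pot z φ α) := by
  cases rep with
  | energy =>
    exact ((hφ.1 α).sob_three hΩ).sub hΩ.1
      ((hr.chemTemp α).mul hΩ.1 le_rfl (by norm_num) (hφ.2.2.sob_three hΩ))
  | entropy => exact (hφ.1 α).sob_three hΩ

theorem dcontr_smul_right (A B : Matrix (Fin 3) (Fin 3) ℝ) (t : ℝ) :
    dcontr A (t • B) = t * dcontr A B := by
  simp only [dcontr, Matrix.smul_apply, smul_eq_mul, Finset.mul_sum, mul_left_comm]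

/-- Contracting with the symmetric matrix `V + Vᵀ` does not distinguish a matrix from its transpose,
which absorbs the factor 1/2. The shear and bulk terms thus combine into the contraction of the
stress with `A - θ V`. -/
theorem dcontr_stress (A V : Matrix (Fin 3) (Fin 3) ℝ) (θ ζ l : ℝ) :
    ζ / 2 * dcontr (A + A.transpose - θ • (V + V.transpose)) (V + V.transpose)
      + l * (A.trace - V.trace * θ) * V.trace
      = dcontr ((l * V.trace) • (1 : Matrix (Fin 3) (Fin 3) ℝ) + ζ • (V + V.transpose)) A
        - θ * dcontr ((l * V.trace) • (1 : Matrix (Fin 3) (Fin 3) ℝ)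
          + ζ • (V + V.transpose)) V := by
  have h01 : (0 : Fin 3) ≠ 1 := by decide
  have h02 : (0 : Fin 3) ≠ 2 := by decide
  have h12 : (1 : Fin 3) ≠ 2 := by decide
  simp only [dcontr, Fin.sum_univ_three, Matrix.trace, Matrix.diag, Matrix.add_apply,
    Matrix.sub_apply, Matrix.smul_apply, Matrix.transpose_apply, Matrix.one_apply_eq,
    Matrix.one_apply_ne h01, Matrix.one_apply_ne h02, Matrix.one_apply_ne h12,
    Matrix.one_apply_ne h01.symm, Matrix.one_apply_ne h02.symm, Matrix.one_apply_ne h12.symm,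
    smul_eq_mul]
  ring

/-- For the entropy the momentum derivative vanishes, so its shear and divergence parts are `-1/T`
times those of `v` and cancel the factor `T` of the bracket. The gradients of `1/T` and `-μ_β/T`
turn the remaining linear combinations into the heat and diffusion fluxes. -/
theorem dissipation_eq_integral (hΩ : IsBoundedLipschitzDomain Ω)
    (hr : Regular rep pot c Ω s k z) (hgM : ∀ᵐ x ∂volume.restrict Ω, g.M x = 0)
    (hθ : ∀ᵐ x ∂volume.restrict Ω, thermalPart rep pot z g x = 1 / temp rep pot (z.val x))
    (hχ : ∀ α, ∀ᵐ x ∂volume.restrict Ω,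
      chemPart rep pot z g α x = - (chem rep pot α (z.val x) / temp rep pot (z.val x))) :
    dissipation rep pot c Ω z φ g = ∫ x in Ω, dissipationForm rep pot c Ω z φ x := by
  have hjac : ∀ᵐ x ∂volume.restrict Ω, jac Ω g.M x = 0 := by
    have h0 : ∀ i, wgrad Ω (fun x => g.M x i) =ᵐ[volume.restrict Ω] fun _ => 0 := fun i => by
      rw [wgrad_congr_ae hΩ.1 (g := fun _ => 0) (hgM.mono fun x hx => by simp [hx])]
      exact (IsWeakGradient.const 0).wgrad_ae hΩ.1
    filter_upwards [ae_all_iff.2 h0] with x hx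
    ext i j
    simp [jac, hx]
  have hgθ : wgrad Ω (thermalPart rep pot z g) = gradInvT rep pot Ω z := wgrad_congr_ae hΩ.1 hθ
  have hgχ : ∀ β, ∀ᵐ x ∂volume.restrict Ω,
      wgrad Ω (chemPart rep pot z g β) x = - gradMuT rep pot Ω z β x := fun β => by
    rw [wgrad_congr_ae hΩ.1 (hχ β)]
    exact (hr.chemTemp β).grad.neg.wgrad_ae hΩ.1
  refine integral_congr_ae ?_
  filter_upwards [hjac, hr.temp_pos, hθ, ae_all_iff.2 hχ, ae_all_iff.2 hgχ]
    with x hj hT hθx hχx hgχx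
  have hTi : temp rep pot (z.val x) * (1 / temp rep pot (z.val x)) = 1 := by
    field_simp
  have e1 : shearPart rep pot Ω z g x
      = (- (1 / temp rep pot (z.val x))) • symGrad Ω z.vel x := by
    rw [shearPart, hθx, symGrad, hj]
    simp
  have e2 : divPart rep pot Ω z g x = - (wdiv Ω z.vel x * (1 / temp rep pot (z.val x))) := by
    rw [divPart, hθx, wdiv, hj]
    simp
  have e3 := dcontr_stress (jac Ω φ.M x) (jac Ω z.vel x) (thermalPart rep pot z φ x)
    (c.zeta (z.val x)) (c.lam (z.val x) - 2 * c.zeta (z.val x) / 3)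
  have e4 : (c.kappa (z.val x) * temp rep pot (z.val x) ^ 2) • wgrad Ω (thermalPart rep pot z g) x
      + ∑ β, c.B β (z.val x) • wgrad Ω (chemPart rep pot z g β) x
      = heatFlux rep pot c Ω z x := by
    simp only [heatFlux, hgθ, hgχx, smul_neg, Finset.sum_neg_distrib, sub_eq_add_neg]
  have e5 : ∀ α, c.B α (z.val x) • wgrad Ω (thermalPart rep pot z g) x
      + ∑ β, c.BB α β (z.val x) • wgrad Ω (chemPart rep pot z g β) x
      = diffFlux rep pot c Ω z α x := fun α => by
    simp only [diffFlux, hgθ, hgχx, smul_neg, Finset.sum_neg_distrib, sub_eq_add_neg]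
  have e6 : temp rep pot (z.val x) * ∑ α, ∑ β,
        chemPart rep pot z φ α x * c.bLL α β (z.val x) * chemPart rep pot z g β x
      = - ∑ α, chemPart rep pot z φ α x *
        ∑ β, c.bLL α β (z.val x) * chem rep pot β (z.val x) := by
    simp only [hχx, Finset.mul_sum, ← Finset.sum_neg_distrib]
    refine Finset.sum_congr rfl fun α _ => Finset.sum_congr rfl fun β _ => ?_
    field_simp
  simp only [e1, e2, e4, e5, e6, dcontr_smul_right]
  simp only [dissipationForm, shearPart, divPart, symGrad, viscousStress, wdiv,
    real_inner_comm (heatFlux rep pot c Ω z x), real_inner_comm (diffFlux rep pot c Ω z _ x)] at e3 ⊢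
  generalize dcontr (_ - _) (_ + _) = Q at e3 ⊢
  -- The viscous terms carry the factor `-T (1/T)`; the first summand replaces it by `-1`, and `e3`
  -- rewrites them through the stress.
  linear_combination (-(c.zeta (z.val x) / 2 * Q + (c.lam (z.val x) - 2 * c.zeta (z.val x) / 3)
    * ((jac Ω φ.M x).trace - (jac Ω z.vel x).trace * thermalPart rep pot z φ x)
    * (jac Ω z.vel x).trace)) * hTi - e3

/-! ### Integrability -/

theorem lpBelow_heatFlux (hr : Regular rep pot c Ω s k z) :
    LpBelow Ω (k + 1 / 3) (heatFlux rep pot c Ω z) := by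
  have hk := hr.k_nonneg
  have hT := hr.temp.lp_zero
  refine LpBelow.sub ?_ (.sum _ fun β _ => ?_)
  · have h1 := hr.kappa.mul hk (by norm_num) (hT.mul le_rfl le_rfl hT)
    refine ((h1.smul (by linarith) (by norm_num) hr.invTemp.lp_wgrad).mono (t := k + 1 / 3)
      (by linarith)).congr (Eventually.of_forall fun x => ?_)
    simp only [gradInvT, sq]
  · exact (hr.B β).smul hk (by norm_num) (hr.chemTemp β).lp_wgrad

theorem lpBelow_diffFlux (hr : Regular rep pot c Ω s k z) (α : Fin ν) :
    LpBelow Ω (k + 1 / 3) (diffFlux rep pot c Ω z α) :=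
  .sub ((hr.B α).smul hr.k_nonneg (by norm_num) hr.invTemp.lp_wgrad)
    (.sum _ fun β _ => (hr.BB α β).smul hr.k_nonneg (by norm_num) (hr.chemTemp β).lp_wgrad)

theorem lpBelow_viscousStress (hr : Regular rep pot c Ω s k z)
    (hv : ∀ i, Sob Ω (1 / 3) fun x => z.vel x i) (i j : Fin 3) :
    LpBelow Ω (k + 1 / 3) (fun x => viscousStress c Ω z x i j) := by
  have hj : ∀ i j, LpBelow Ω (1 / 3) (fun x => jac Ω z.vel x i j) := fun i j => (hv i).lpGrad j
  have hd : LpBelow Ω (1 / 3) (wdiv Ω z.vel) := LpBelow.sum Finset.univ fun i _ => (hv i).lpGrad i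
  have hl : LpBelow Ω k (fun x => c.lam (z.val x) - 2 * c.zeta (z.val x) / 3) :=
    (hr.lam.sub (hr.zeta.const_mul (2 / 3))).congr (Eventually.of_forall fun x => by ring)
  have h1 := (hl.mul hr.k_nonneg (by norm_num) hd).const_mul
    ((1 : Matrix (Fin 3) (Fin 3) ℝ) i j)
  have h2 := hr.zeta.mul hr.k_nonneg (by norm_num) ((hj i j).add (hj j i))
  refine (h1.add h2).congr (Eventually.of_forall fun x => ?_)
  simp only [viscousStress, symGrad, Matrix.add_apply, Matrix.smul_apply, Matrix.transpose_apply,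
    smul_eq_mul]
  ring

/-- The critical terms are a transport coefficient of index `k` times two gradients of index `1 /
3`. Their sum stays below one exactly because `k < 1 / 3`, that is, because of the exponent `3 + ε`.
-/
theorem integrable_dissipationForm (hΩ : IsBoundedLipschitzDomain Ω)
    (hr : Regular rep pot c Ω s k z) (hv : ∀ i, Sob Ω (1 / 3) fun x => z.vel x i)
    (hφ : φ ∈ phaseSpace Ω) : IntegrableOn (dissipationForm rep pot c Ω z φ) Ω := by
  have hk := hr.k_nonneg
  have hk1 := hr.k_lt
  have hs := hr.le_s
  have hs1 := hr.s_lt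
  have hθ := sob_thermalPart hΩ hr hφ
  have hχ := sob_chemPart hΩ hr hφ
  have hS : ∀ {w : E3 → E3}, (∀ i, Sob Ω (1 / 3) fun x => w x i) →
      LpBelow Ω (k + 1 / 3 + 1 / 3) (fun x => dcontr (viscousStress c Ω z x) (jac Ω w x)) :=
    fun hw => .sum _ fun i _ => .sum _ fun j _ =>
      (lpBelow_viscousStress hr hv i j).mul (by linarith) (by norm_num) ((hw i).lpGrad j)
  refine Integrable.sub (Integrable.add (Integrable.sub (Integrable.add ?_ ?_) ?_) ?_) ?_
  · exact ((lpBelow_heatFlux hr).inner (by linarith) (by norm_num) hθ.lp_wgrad).integrable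
      (by linarith)
  · exact integrable_finsetSum _ fun α _ => ((lpBelow_diffFlux hr α).inner (by linarith)
      (by norm_num) (hχ α).lp_wgrad).integrable (by linarith)
  · exact (hS fun i => (hφ.2.1.1 i).sob_three hΩ).integrable (by linarith)
  · exact (hθ.lp_zero.mul le_rfl (by linarith) (hS hv)).integrable (by linarith)
  · refine integrable_finsetSum _ fun α _ => LpBelow.integrable (s := 0 + s)
      ((hχ α).lp_zero.mul le_rfl (by linarith) (.sum _ fun β _ => ?_)) (by linarith)
    exact ((hr.bLL α β).mul (by linarith) le_rfl (hr.chem β).lp_zero).mono (by linarith)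

end Mixture

end

set_option linter.unusedSectionVars false

noncomputable section

namespace Mixture

open MeasureTheory Filter Topology
open scoped ENNReal

variable {Ω : Set E3} {ν n : ℕ} {D : Set (Values ν)} {z φ g h : Fields ν} {rep : Representation}
  {pot : Values ν → ℝ} {c : Coefficients ν n} {s k : ℝ}

/-! ### The Poisson bracket with the energy -/

theorem sum_bL_eq_zero (hc : c.MassConserving) (y : Values ν) : ∑ α, c.bL α y = 0 := by
  simp only [Coefficients.bL]
  rw [Finset.sum_comm]
  simp only [← Finset.sum_mul, hc _, zero_mul, Finset.sum_const_zero]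

/-- Separates the dissipative production, which belongs to the dissipation bracket, from the part
`𝕃_α div v`, which completes a Poisson term to a Gauss-Green integrand. -/
theorem massProd_eq (z : Fields ν) (α : Fin ν) (x : E3) :
    massProd rep pot c Ω z α x = - ∑ β, c.bLL α β (z.val x) * chem rep pot β (z.val x)
      + c.bL α (z.val x) * wdiv Ω z.vel x := by
  simp only [massProd, reactionRate, Coefficients.bLL, Coefficients.bL, mul_add,
    Finset.sum_add_distrib, Finset.sum_mul, Finset.mul_sum, mul_neg, Finset.sum_neg_distrib]
  congr 1
  · congr 1
    conv_rhs =>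
      rw [Finset.sum_comm]
      enter [2, k]
      rw [Finset.sum_comm]
    exact Finset.sum_congr rfl fun k _ => Finset.sum_congr rfl fun b _ =>
      Finset.sum_congr rfl fun β _ => by ring
  · exact Finset.sum_congr rfl fun k _ => by ring

/-- The kinetic part of the energy derivative: contributions of `|v|² / 2`. -/
theorem wgrad_energyDeriv (hΩ : IsBoundedLipschitzDomain Ω) (hc : c.MassConserving)
    (hs : 1 / 3 ≤ s) (hs1 : s < 1) (hbL : ∀ α, Sob Ω s fun x => c.bL α (z.val x))
    {m : Fin ν → E3 → ℝ} (hm : ∀ α, Sob Ω (1 / 3) (m α))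
    (hv : ∀ i, Sob Ω (1 / 3) fun x => z.vel x i)
    (hh : ∀ α, ∀ᵐ x ∂volume.restrict Ω,
      h.rho α x = m α x - (∑ i, z.vel x i * z.vel x i) / 2) :
    ∀ᵐ x ∂volume.restrict Ω,
      (∀ α, wgrad Ω (h.rho α) x
        = wgrad Ω (m α) x - ∑ i, z.vel x i • wgrad Ω (fun y => z.vel y i) x) ∧
      ∑ α, wgrad Ω (fun y => h.rho α y * c.bL α (z.val y)) x
        = wgrad Ω (fun y => ∑ α, c.bL α (z.val y) * m α y) x := by
  have := isFiniteMeasure_of_isBounded hΩ.2.2.1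
  set K : E3 → ℝ := fun x => 1 / 2 * ∑ i, z.vel x i * z.vel x i with hK
  have hvv := fun i => (hv i).mul hΩ.1 le_rfl (by norm_num) (hv i)
  have hKS : Sob Ω (1 / 3) K := (Sob.sum hΩ.1 Finset.univ fun i _ => hvv i).const_mul hΩ.1 _
  have hKg := ((IsWeakGradient.sum Finset.univ fun i _ => (hvv i).grad).const_mul
    (1 / 2 : ℝ)).wgrad_ae hΩ.1
  have hh' : ∀ α, h.rho α =ᵐ[volume.restrict Ω] fun x => m α x - K x := fun α =>
    (hh α).mono fun x hx => by rw [hx, hK]; ring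
  have e1 : ∀ α, wgrad Ω (h.rho α) =ᵐ[volume.restrict Ω]
      fun x => wgrad Ω (m α) x - wgrad Ω K x := fun α => by
    rw [wgrad_congr_ae hΩ.1 (hh' α)]
    exact ((hm α).grad.sub hKS.grad).wgrad_ae hΩ.1
  have hmL := fun α => (hm α).mul hΩ.1 hs hs1 (hbL α)
  have hKL := fun α => hKS.mul hΩ.1 hs hs1 (hbL α)
  have hhL : ∀ α, Sob Ω s (fun y => h.rho α y * c.bL α (z.val y)) := fun α =>
    ((hmL α).sub hΩ.1 (hKL α)).congr hΩ.1 ((hh' α).mono fun x hx => by simp only [hx]; ring)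
  have e2 := (IsWeakGradient.sum Finset.univ fun α _ => (hhL α).grad).wgrad_ae hΩ.1
  have e3 : wgrad Ω (fun y => ∑ α, h.rho α y * c.bL α (z.val y))
      = wgrad Ω (fun y => ∑ α, c.bL α (z.val y) * m α y) := by
    refine wgrad_congr_ae hΩ.1 ?_
    filter_upwards [ae_all_iff.2 hh'] with x hx
    -- Mass conservation removes the kinetic contribution, which is the same for all constituents.
    have h0 : ∑ α, c.bL α (z.val x) * K x = 0 := by
      rw [← Finset.sum_mul, sum_bL_eq_zero hc, zero_mul]
    rw [← sub_zero (∑ α, c.bL α (z.val x) * m α x), ← h0, ← Finset.sum_sub_distrib]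
    exact Finset.sum_congr rfl fun α _ => by rw [hx α]; ring
  filter_upwards [hKg, ae_all_iff.2 e1, e2,
    ae_all_iff.2 fun i => (hv i).wgrad_mul hΩ.1 le_rfl (by norm_num) (hv i)] with x h1 h2 h3 h4
  refine ⟨fun α => ?_, ?_⟩
  · rw [h2 α, h1]
    simp only [h4, ← two_smul ℝ, Finset.smul_sum, smul_smul, ← mul_assoc]
    norm_num
  · rw [← h3, e3]

/-- The integrand of the Poisson bracket with the energy, in terms of the fields. -/
def poissonForm (rep : Representation) (pot : Values ν → ℝ) (c : Coefficients ν n)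
    (Ω : Set E3) (z φ : Fields ν) (x : E3) : ℝ :=
  ∑ α, z.rho α x * inner ℝ (z.vel x) (wgrad Ω (φ.rho α) x)
    + ∑ i, z.M x i * inner ℝ (z.vel x) (wgrad Ω (fun y => φ.M y i) x)
    + z.e x * inner ℝ (z.vel x) (wgrad Ω φ.e x)
    + inner ℝ (φ.M x)
        (wgrad Ω (fun y => - pressure rep pot (z.val y) + sumLmu rep pot c (z.val y)) x)
    - ∑ α, inner ℝ (z.vel x) (wgrad Ω (fun y => φ.rho α y * c.bL α (z.val y)) x)
    - match rep with
      | .energy => 0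
      | .entropy => inner ℝ (z.vel x)
          (wgrad Ω (fun y => (- pressure .entropy pot (z.val y)
            + sumLmu .entropy pot c (z.val y)) * φ.e y) x)

theorem sob_sumLmu (hΩ : IsBoundedLipschitzDomain Ω) (hr : Regular rep pot c Ω s k z) :
    Sob Ω s (fun x => sumLmu rep pot c (z.val x)) :=
  Sob.congr hΩ.1 (.sum hΩ.1 Finset.univ fun α _ => (hr.chem α).mul hΩ.1 hr.le_s hr.s_lt (hr.bL α))
    (Eventually.of_forall fun x => by simp only [sumLmu, mul_comm])

/-- With the energy derivatives `μ_α - |v|²/2`, `v` and `T`, the terms `-∑ ρ_α ∇μ_α - s ∇T` combine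
to `-∇p` by Gibbs-Duhem. The kinetic terms `∑ ρ_α v_i ∇v_i` cancel `∑ M_i ∇v_i`, because `M = ρ v`.
-/
theorem poisson_energy_eq_integral (hΩ : IsBoundedLipschitzDomain Ω) (hD : IsOpen D)
    (hpot : ContDiffOn ℝ 1 pot D) (hc : c.MassConserving) (hz : z ∈ stateSpace Ω D)
    (hr : Regular .energy pot c Ω s k z) (hv : ∀ i, Sob Ω (1 / 3) fun x => z.vel x i)
    (hh : ∀ α, ∀ᵐ x ∂volume.restrict Ω,
      h.rho α x = chem .energy pot α (z.val x) - (∑ i, z.vel x i * z.vel x i) / 2)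
    (hhM : ∀ᵐ x ∂volume.restrict Ω, h.M x = z.vel x)
    (hhe : ∀ᵐ x ∂volume.restrict Ω, h.e x = temp .energy pot (z.val x)) :
    poisson .energy pot c Ω z φ h = ∫ x in Ω, poissonForm .energy pot c Ω z φ x := by
  have e1 : ∀ i, wgrad Ω (fun y => h.M y i) = wgrad Ω (fun y => z.vel y i) := fun i =>
    wgrad_congr_ae hΩ.1 (hhM.mono fun x hx => by simp only [hx])
  have e2 : wgrad Ω h.e = wgrad Ω (fun y => temp .energy pot (z.val y)) := wgrad_congr_ae hΩ.1 hhe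
  have e3 := (hr.pressure.grad.neg.add (sob_sumLmu hΩ hr).grad).wgrad_ae hΩ.1
  refine integral_congr_ae ?_
  filter_upwards [wgrad_energyDeriv hΩ hc hr.le_s hr.s_lt hr.bL hr.chem hv hh, hhM, e3,
    gibbs_duhem hΩ hD hpot hz hr, ae_components_mem hz] with x ⟨h1, h2⟩ h3 h4 h5 h6
  have hm : z.mass x ≠ 0 := (show 0 < z.mass x from h6.2).ne'
  have hMv : ∀ i, z.M x i = z.mass x * z.vel x i := fun i => by
    rw [vel_apply]
    field_simp
  have g1 : wgrad Ω (fun x => pressure .energy pot (z.val x)) x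
      = ∑ α, z.rho α x • wgrad Ω (fun x => chem .energy pot α (z.val x)) x
        + z.e x • wgrad Ω (fun x => temp .energy pot (z.val x)) x := by
    ext i
    simp [h5 i, Finset.sum_apply]
  have g2 : ∑ α, inner ℝ (φ.M x) (wgrad Ω (fun y => h.rho α y * c.bL α (z.val y)) x)
      = inner ℝ (φ.M x) (wgrad Ω (fun x => sumLmu .energy pot c (z.val x)) x) := by
    rw [← inner_sum, h2]
    rfl
  have g3 : ∑ α, z.rho α x * ∑ i, z.vel x i *
        inner ℝ (φ.M x) (wgrad Ω (fun y => z.vel y i) x)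
      = ∑ i, z.M x i * inner ℝ (φ.M x) (wgrad Ω (fun y => z.vel y i) x) := by
    rw [← Finset.sum_mul, Finset.mul_sum]
    exact Finset.sum_congr rfl fun i _ => by rw [hMv, mul_assoc]; rfl
  simp only [poissonForm, h3, e1, e2, h1, h4, g1, inner_add_right, inner_neg_right,
    inner_sub_right, inner_sum, inner_smul_right, mul_sub, Finset.sum_sub_distrib,
    g2, g3]
  ring

/-- Here the energy derivatives are `-|v|²/2`, `v` and `1`. The reaction gradients contracted with
`φ.M` vanish by mass conservation, and the extra term of the bracket with second argument `1`
supplies the whole reversible stress. -/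
theorem poisson_entropy_eq_integral (hΩ : IsBoundedLipschitzDomain Ω)
    (hc : c.MassConserving) (hz : z ∈ stateSpace Ω D) (hφ : φ ∈ phaseSpace Ω)
    (hr : Regular .entropy pot c Ω s k z) (hv : ∀ i, Sob Ω (1 / 3) fun x => z.vel x i)
    (hh : ∀ α, ∀ᵐ x ∂volume.restrict Ω, h.rho α x = - (∑ i, z.vel x i * z.vel x i) / 2)
    (hhM : ∀ᵐ x ∂volume.restrict Ω, h.M x = z.vel x)
    (hhe : ∀ᵐ x ∂volume.restrict Ω, h.e x = 1) :
    poisson .entropy pot c Ω z φ h = ∫ x in Ω, poissonForm .entropy pot c Ω z φ x := by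
  have := isFiniteMeasure_of_isBounded hΩ.2.2.1
  have e1 : ∀ i, wgrad Ω (fun y => h.M y i) = wgrad Ω (fun y => z.vel y i) := fun i =>
    wgrad_congr_ae hΩ.1 (hhM.mono fun x hx => by simp only [hx])
  have e2 : wgrad Ω h.e =ᵐ[volume.restrict Ω] fun _ => 0 := by
    rw [wgrad_congr_ae hΩ.1 hhe]
    exact (IsWeakGradient.const 1).wgrad_ae hΩ.1
  have hπ : Sob Ω s (fun y => - pressure .entropy pot (z.val y)
      + sumLmu .entropy pot c (z.val y)) := (hr.pressure.neg hΩ.1).add hΩ.1 (sob_sumLmu hΩ hr)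
  have e3 : ∀ᵐ x ∂volume.restrict Ω, wgrad Ω (fun y => h.e y *
      (pressure .entropy pot (z.val y) - sumLmu .entropy pot c (z.val y))) x
      = - wgrad Ω (fun y => - pressure .entropy pot (z.val y)
        + sumLmu .entropy pot c (z.val y)) x := by
    rw [wgrad_congr_ae hΩ.1 (g := fun y => - (- pressure .entropy pot (z.val y)
      + sumLmu .entropy pot c (z.val y))) (hhe.mono fun x hx => by simp only [hx]; ring)]
    exact hπ.grad.neg.wgrad_ae hΩ.1
  have hφπ : Sob Ω s (fun y => (- pressure .entropy pot (z.val y)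
      + sumLmu .entropy pot c (z.val y)) * φ.e y) :=
    ((hφ.2.2.sob_three hΩ).mul hΩ.1 hr.le_s hr.s_lt hπ).congr hΩ.1
      (Eventually.of_forall fun x => mul_comm _ _)
  have e4 : ∀ᵐ x ∂volume.restrict Ω, wgrad Ω (fun y => φ.e y *
      (pressure .entropy pot (z.val y) - sumLmu .entropy pot c (z.val y))) x
      = - wgrad Ω (fun y => (- pressure .entropy pot (z.val y)
        + sumLmu .entropy pot c (z.val y)) * φ.e y) x := by
    rw [wgrad_congr_ae hΩ.1 (g := fun y => - ((- pressure .entropy pot (z.val y)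
      + sumLmu .entropy pot c (z.val y)) * φ.e y)) (Eventually.of_forall fun x => by ring)]
    exact hφπ.grad.neg.wgrad_ae hΩ.1
  refine integral_congr_ae ?_
  filter_upwards [wgrad_energyDeriv (h := h) (m := fun _ _ => 0) hΩ hc hr.le_s hr.s_lt hr.bL
    (fun _ => .const hΩ.1 0) hv (fun α => (hh α).mono fun x hx => by rw [hx]; ring),
    hhM, e2, e3, e4, ae_components_mem hz, (IsWeakGradient.const (Ω := Ω) 0).wgrad_ae hΩ.1]
    with x ⟨h1, h2⟩ h3 h4 h5 h5' h6 h7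
  have hm : z.mass x ≠ 0 := (show 0 < z.mass x from h6.2).ne'
  have hMv : ∀ i, z.M x i = z.mass x * z.vel x i := fun i => by
    rw [vel_apply]
    field_simp
  have g2 : ∑ α, inner ℝ (φ.M x) (wgrad Ω (fun y => h.rho α y * c.bL α (z.val y)) x) = 0 := by
    rw [← inner_sum, h2]
    simp only [mul_zero, Finset.sum_const_zero]
    rw [h7, inner_zero_right]
  have g3 : ∑ α, z.rho α x * ∑ i, z.vel x i *
        inner ℝ (φ.M x) (wgrad Ω (fun y => z.vel y i) x)
      = ∑ i, z.M x i * inner ℝ (φ.M x) (wgrad Ω (fun y => z.vel y i) x) := by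
    rw [← Finset.sum_mul, Finset.mul_sum]
    exact Finset.sum_congr rfl fun i _ => by rw [hMv, mul_assoc]; rfl
  simp only [poissonForm, h3, e1, h4, h5, h5', h1, h7]
  generalize wgrad Ω (fun y => - pressure .entropy pot (z.val y)
    + sumLmu .entropy pot c (z.val y)) x = G₁
  generalize wgrad Ω (fun y => (- pressure .entropy pot (z.val y)
    + sumLmu .entropy pot c (z.val y)) * φ.e y) x = G₂
  simp only [inner_neg_right, inner_zero_right, inner_sub_right, inner_sum, inner_smul_right,
    mul_sub, mul_zero, Finset.sum_sub_distrib, Finset.sum_const_zero, g2, g3]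
  ring

theorem lpBelow_vel (hv : ∀ i, Sob Ω (1 / 3) fun x => z.vel x i) : LpBelow Ω 0 z.vel :=
  .of_coord fun i => (hv i).lp_zero

theorem integrable_poissonForm (hΩ : IsBoundedLipschitzDomain Ω)
    (hr : Regular rep pot c Ω s k z) (hv : ∀ i, Sob Ω (1 / 3) fun x => z.vel x i)
    (hφ : φ ∈ phaseSpace Ω) : IntegrableOn (poissonForm rep pot c Ω z φ) Ω := by
  have hs := hr.le_s
  have hs1 := hr.s_lt
  have hv0 := lpBelow_vel hv
  have hin : ∀ {t : ℝ} {f : E3 → ℝ}, 1 / 3 ≤ t → Sob Ω t f →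
      LpBelow Ω t (fun x => inner ℝ (z.vel x) (wgrad Ω f x)) := fun ht hf =>
    (hv0.inner le_rfl (by linarith) hf.lp_wgrad).mono (by linarith)
  have hin' : ∀ {f k : E3 → ℝ}, Sob Ω (1 / 3) k → MemW Ω 3 f →
      IntegrableOn (fun x => k x * inner ℝ (z.vel x) (wgrad Ω f x)) Ω := fun hk hf =>
    (hk.lp_zero.mul le_rfl (by norm_num) (hin le_rfl (hf.sob_three hΩ))).integrable (by norm_num)
  have hπ : Sob Ω s (fun y => - pressure rep pot (z.val y) + sumLmu rep pot c (z.val y)) :=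
    (hr.pressure.neg hΩ.1).add hΩ.1 (sob_sumLmu hΩ hr)
  refine Integrable.sub (Integrable.sub (Integrable.add (Integrable.add (Integrable.add
    ?_ ?_) ?_) ?_) ?_) ?_
  · exact integrable_finsetSum _ fun α _ => hin' (hr.rho α) (hφ.1 α)
  · exact integrable_finsetSum _ fun i _ => hin' (hr.M i) (hφ.2.1.1 i)
  · exact hin' hr.e hφ.2.2
  · exact ((LpBelow.of_coord fun i => ((hφ.2.1.1 i).sob_three hΩ).lp_zero).inner le_rfl
      (by linarith) hπ.lp_wgrad).integrable (by linarith)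
  · exact integrable_finsetSum _ fun α _ => (hin hs (((hφ.1 α).sob_three hΩ).mul hΩ.1 hs hs1
      (hr.bL α))).integrable hs1
  · cases rep with
    | energy => exact integrableOn_zero
    | entropy =>
      refine (hin hs (((hφ.2.2.sob_three hΩ).mul hΩ.1 hs hs1 hπ).congr hΩ.1
        (Eventually.of_forall fun x => mul_comm _ _))).integrable hs1

/-! ### The weak form in terms of the brackets -/

/-- The boundary terms of the reaction coefficients, as Gauss-Green integrands. -/
def reactionFluxForm (c : Coefficients ν n) (Ω : Set E3) (z φ : Fields ν) (x : E3) : ℝ :=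
  ∑ α, (inner ℝ (z.vel x) (wgrad Ω (fun y => φ.rho α y * c.bL α (z.val y)) x)
    + φ.rho α x * c.bL α (z.val x) * wdiv Ω z.vel x)

theorem momentumFlux_eq (z φ : Fields ν) (x : E3) :
    dcontr (Matrix.of fun i j => z.M x i * z.vel x j) (jac Ω φ.M x)
      = ∑ i, z.M x i * inner ℝ (z.vel x) (wgrad Ω (fun y => φ.M y i) x) := by
  simp only [dcontr, jac, Matrix.of_apply, inner_eq_sum, Finset.mul_sum, mul_assoc]

/-- In the energy representation the flux terms tested with `φ_α` and with `μ_α φ_e / T` merge into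
`chemPart`. The reversible production `𝕃_α div v` survives only against `φ_α`, and together with the
Poisson term `v · ∇(φ_α 𝕃_α)` it is the one discrepancy between weak form and brackets. -/
theorem weakForm_integrand_ae_eq (hΩ : IsBoundedLipschitzDomain Ω)
    (hr : Regular rep pot c Ω s k z) (hφ : φ ∈ phaseSpace Ω) :
    ∀ᵐ x ∂volume.restrict Ω, massForm rep pot c Ω z φ x + momentumForm rep pot c Ω z φ x
        + thermalForm rep pot c Ω z φ x
      = poissonForm rep pot c Ω z φ x + dissipationForm rep pot c Ω z φ x
        + reactionFluxForm c Ω z φ x := by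
  cases rep with
  | energy =>
    have e1 : (fun y => φ.e y / temp .energy pot (z.val y)) = thermalPart .energy pot z φ := by
      funext y
      simp only [thermalPart]
      ring
    have e2 : ∀ α, ∀ᵐ x ∂volume.restrict Ω, wgrad Ω (chemPart .energy pot z φ α) x
        = wgrad Ω (φ.rho α) x - wgrad Ω (fun y => chem .energy pot α (z.val y) * φ.e y
          / temp .energy pot (z.val y)) x := fun α => by
      have h1 := ((hr.chemTemp α).mul hΩ.1 le_rfl (by norm_num) (hφ.2.2.sob_three hΩ))
      have h2 : (fun y => chem .energy pot α (z.val y) * φ.e y / temp .energy pot (z.val y))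
          = fun y => chem .energy pot α (z.val y) / temp .energy pot (z.val y) * φ.e y := by
        funext y
        ring
      rw [h2]
      exact ((hφ.1 α).grad.sub h1.grad).wgrad_ae hΩ.1
    filter_upwards [ae_all_iff.2 e2] with x h2
    simp only [massForm, momentumForm, thermalForm, poissonForm, dissipationForm,
      reactionFluxForm, momentumFlux_eq, e1, h2, massProd_eq]
    have e3 : φ.e x / temp .energy pot (z.val x) = thermalPart .energy pot z φ x := congrFun e1 x
    have e4 : ∀ α, chem .energy pot α (z.val x) * φ.e x / temp .energy pot (z.val x)
        = φ.rho α x - chemPart .energy pot z φ α x := fun α => by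
      simp only [chemPart]
      ring
    have e5 : ∑ α, c.bL α (z.val x) * wdiv Ω z.vel x * φ.rho α x
        = ∑ α, φ.rho α x * c.bL α (z.val x) * wdiv Ω z.vel x :=
      Finset.sum_congr rfl fun α _ => by ring
    have e6 : ∀ ξ : Fin ν → ℝ,
        ∑ α, ξ α * ∑ β, c.bLL α β (z.val x) * chem .energy pot β (z.val x)
        = ∑ α, (∑ β, c.bLL α β (z.val x) * chem .energy pot β (z.val x)) * ξ α := fun ξ =>
      Finset.sum_congr rfl fun α _ => mul_comm _ _
    simp only [e3, e4, inner_add_left, inner_sub_right, real_inner_smul_left,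
      Finset.sum_add_distrib, Finset.sum_sub_distrib, add_mul, mul_sub, neg_mul,
      Finset.sum_neg_distrib, add_sub_cancel_right, e5, e6 (chemPart .energy pot z φ · x)]
    ring
  | entropy =>
    refine Eventually.of_forall fun x => ?_
    simp only [massForm, momentumForm, thermalForm, poissonForm, dissipationForm,
      reactionFluxForm, momentumFlux_eq, massProd_eq]
    have e1 : thermalPart .entropy pot z φ = φ.e := rfl
    have e2 : ∀ α, chemPart .entropy pot z φ α = φ.rho α := fun α => rfl
    have e5 : ∑ α, c.bL α (z.val x) * wdiv Ω z.vel x * φ.rho α x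
        = ∑ α, φ.rho α x * c.bL α (z.val x) * wdiv Ω z.vel x :=
      Finset.sum_congr rfl fun α _ => by ring
    have e6 : ∑ α, φ.rho α x * ∑ β, c.bLL α β (z.val x) * chem .entropy pot β (z.val x)
        = ∑ α, (∑ β, c.bLL α β (z.val x) * chem .entropy pot β (z.val x)) * φ.rho α x :=
      Finset.sum_congr rfl fun α _ => mul_comm _ _
    generalize wgrad Ω (fun y => (- pressure .entropy pot (z.val y)
      + sumLmu .entropy pot c (z.val y)) * φ.e y) x = G
    simp only [e1, e2, inner_add_left, real_inner_smul_left,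
      Finset.sum_add_distrib, add_mul, neg_mul, Finset.sum_neg_distrib, e5, e6]
    ring

/-- The discrepancy is the Gauss-Green integrand of `v` against `φ_α 𝕃_α`; this product is regular
enough to be tested, so the integral vanishes by `v · n = 0`. Integrability of each part permits
splitting the integral. -/
theorem weakForm_eq_integral (hΩ : IsBoundedLipschitzDomain Ω)
    (hr : Regular rep pot c Ω s k z) (hv : ∀ i, Sob Ω (1 / 3) fun x => z.vel x i)
    (hn : NormalTraceZero Ω z.vel) (hφ : φ ∈ phaseSpace Ω) :
    weakForm rep pot c Ω z φ = (∫ x in Ω, poissonForm rep pot c Ω z φ x)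
      + ∫ x in Ω, dissipationForm rep pot c Ω z φ x := by
  have hφL := fun α => ((hφ.1 α).sob_three hΩ).mul hΩ.1 hr.le_s hr.s_lt (hr.bL α)
  have i1 := integrable_poissonForm hΩ hr hv hφ
  have i2 := integrable_dissipationForm hΩ hr hv hφ
  have i3 := fun α => integrable_gaussGreen hv hr.le_s hr.s_lt (hφL α)
  have h0 : ∫ x in Ω, reactionFluxForm c Ω z φ x = 0 := by
    simp only [reactionFluxForm]
    rw [integral_finsetSum _ fun α _ => i3 α]
    exact Finset.sum_eq_zero fun α _ => integral_gaussGreen_eq_zero hn hr.le_s hr.s_lt (hφL α)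
  have i4 : IntegrableOn (reactionFluxForm c Ω z φ) Ω := integrable_finsetSum _ fun α _ => i3 α
  rw [weakForm, integral_congr_ae (weakForm_integrand_ae_eq hΩ hr hφ),
    integral_add (f := fun x => poissonForm rep pot c Ω z φ x + dissipationForm rep pot c Ω z φ x)
      (i1.add i2) i4, integral_add i1 i2, h0, add_zero]

end Mixture

end

set_option linter.unusedSectionVars false

noncomputable section

namespace Mixture

open MeasureTheory Filter Topology
open scoped ENNReal

variable {Ω : Set E3} {ν n : ℕ} {D : Set (Values ν)} {z φ g h : Fields ν} {rep : Representation}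
  {pot : Values ν → ℝ} {c : Coefficients ν n}

/-! ### The weak form as a sum of brackets, and the conclusion. -/

theorem dE_snd (y : Values ν) : dE Prod.snd y = 1 := by
  simp [dE, fderiv_snd]

theorem dRho_snd (α : Fin ν) (y : Values ν) : dRho Prod.snd α y = 0 := by
  simp [dRho, fderiv_snd]

/-- The weak form of the field equations is the sum of the Poisson bracket with the energy and the
dissipation bracket with the entropy. -/
theorem weakForm_eq_brackets (hΩ : IsBoundedLipschitzDomain Ω) (hD : IsOpen D)
    (hpot : ContDiffOn ℝ 1 pot D) (hc : c.MassConserving) (hz : z ∈ stateSpace Ω D) {ε : ℝ}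
    (hε : 0 < ε) (hreg : WellBehaved rep pot c Ω ε z) (hn : NormalTraceZero Ω z.vel)
    (hh : h ∈ phaseSpace Ω)
    (hH : HasFunctionalDeriv Ω (stateSpace Ω D) (totalEnergy rep pot Ω) z h)
    (hg : g ∈ phaseSpace Ω)
    (hS : HasFunctionalDeriv Ω (stateSpace Ω D) (totalEntropy rep pot Ω) z g)
    (hφ : φ ∈ phaseSpace Ω) :
    weakForm rep pot c Ω z φ = poisson rep pot c Ω z φ h + dissipation rep pot c Ω z φ g := by
  obtain ⟨s, k, hr⟩ := hreg.exists_regular hΩ hε hz.1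
  have dH := energyDeriv_ae_eq hΩ hD hpot hz hr hh hH
  have dS := entropyDeriv_ae_eq hΩ hD hpot hz hr hg hS
  have hM := dH.mono fun x hx => hx.2.1
  -- No Sobolev regularity of `v = M / ρ` is assumed directly; it comes from the identification of
  -- `v` with the momentum component of the energy derivative.
  have hv : ∀ i, Sob Ω (1 / 3) fun x => z.vel x i := fun i =>
    ((hh.2.1.1 i).sob_three hΩ).congr hΩ.1 (hM.mono fun x hx => by simp only [hx])
  rw [weakForm_eq_integral hΩ hr hv hn hφ]
  have hgM := dS.mono fun x hx => hx.2.1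
  cases rep with
  | energy =>
    rw [poisson_energy_eq_integral hΩ hD hpot hc hz hr hv
      (fun α => dH.mono fun x hx => hx.1 α) hM (dH.mono fun x hx => hx.2.2)]
    have hsnd : sDens .energy pot = Prod.snd := rfl
    simp only [hsnd, dE_snd, dRho_snd] at dS
    rw [dissipation_eq_integral hΩ hr hgM
      (dS.mono fun x hx => by simp only [thermalPart, hx.2.2, mul_one])
      (fun α => dS.mono fun x hx => by
        simp only [chemPart, hx.1 α, hx.2.2, mul_one, zero_sub])]
  | entropy =>
    have hsnd : uDens .entropy pot = Prod.snd := rfl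
    simp only [hsnd, dE_snd, dRho_snd] at dH
    rw [poisson_entropy_eq_integral hΩ hc hz hφ hr hv
      (fun α => dH.mono fun x hx => by rw [hx.1 α]; ring) hM (dH.mono fun x hx => hx.2.2)]
    rw [dissipation_eq_integral hΩ hr hgM
      (dS.mono fun x hx => by
        simp only [thermalPart, hx.2.2, temp, one_div, inv_inv]
        rfl)
      (fun α => by
        -- Here `μ_α = -T ∂s/∂ρ_α` by definition, so recovering `∂s/∂ρ_α = -μ_α/T` requires `T ≠ 0`.
        filter_upwards [dS, hr.temp_pos] with x hx hT
        simp only [chemPart, hx.1 α, chem]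
        field_simp
        rfl)]

end Mixture

end

theorem theorem4p12 {ν n : ℕ} (rep : Mixture.Representation)
    (Ω : Set Mixture.E3) (hΩ : Mixture.IsBoundedLipschitzDomain Ω)
    (D : Set (Mixture.Values ν)) (hD : IsOpen D)
    (pot : Mixture.Values ν → ℝ) (hpot : ContDiffOn ℝ 1 pot D)
    (c : Mixture.Coefficients ν n) (hc : c.MassConserving)
    (Z : Set (Mixture.Fields ν)) (hZ : Z ⊆ Mixture.stateSpace Ω D) (hZconv : Convex ℝ Z)
    (a b : ℝ) (z : ℝ → Mixture.Fields ν) (hz : ∀ t ∈ Set.Ioo a b, z t ∈ Z)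
    (hcont : Mixture.IsContinuousCurve Ω a b z)
    (ε : ℝ) (hε : 0 < ε)
    (hreg : ∀ᵐ t ∂MeasureTheory.volume.restrict (Set.Ioo a b),
      Mixture.WellBehaved rep pot c Ω ε (z t))
    (δH δS : ℝ → Mixture.Fields ν)
    (hH : ∀ᵐ t ∂MeasureTheory.volume.restrict (Set.Ioo a b), δH t ∈ Mixture.phaseSpace Ω ∧
      Mixture.HasFunctionalDeriv Ω (Mixture.stateSpace Ω D)
        (Mixture.totalEnergy rep pot Ω) (z t) (δH t))
    (hS : ∀ᵐ t ∂MeasureTheory.volume.restrict (Set.Ioo a b), δS t ∈ Mixture.phaseSpace Ω ∧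
      Mixture.HasFunctionalDeriv Ω (Mixture.stateSpace Ω D)
        (Mixture.totalEntropy rep pot Ω) (z t) (δS t))
    (hsol : Mixture.IsIsolatedSolution rep pot c Ω a b z) :
    ∀ᵐ t ∂MeasureTheory.volume.restrict (Set.Ioo a b),
      ∀ (A : Mixture.Fields ν → ℝ) (δA : Mixture.Fields ν → Mixture.Fields ν),
        Mixture.IsSmoothObservable Ω Z A δA →
          HasDerivAt (fun τ => A (z τ))
            (Mixture.poisson rep pot c Ω (z t) (δA (z t)) (δH t)
              + Mixture.dissipation rep pot c Ω (z t) (δA (z t)) (δS t)) t := by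
  have hZ' : Z ⊆ Mixture.phaseSpace Ω := fun w hw => (hZ hw).1
  -- All exceptional times are collected before `A` is introduced, so one null set serves every
  -- observable.
  filter_upwards [hreg, hH, hS, hsol,
    MeasureTheory.ae_restrict_mem (measurableSet_Ioo (a := a) (b := b))]
    with t hr ⟨hHm, hHd⟩ ⟨hSm, hSd⟩ ⟨hn, hd⟩ ht A δA hA
  have key := Mixture.hasDerivAt_observable hΩ hZ' hZconv hz hcont ht hd hA
  rwa [Mixture.weakForm_eq_brackets hΩ hD hpot hc (hZ (hz t ht)) hε hr hn hHm hHd hSm hSd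
    (hA.mem _ (hz t ht))] at key
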